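/- Let $M$ be a smooth manifold of dimension $m$, let $p<m$, and let a Lie group $G$ act smoothly (possibly only locally) on $M$. Let $J^k=J^k(M,p)$ be the space of $k$-jets of $p$-dimensional submanifolds of $M$ with the prolonged action of $G$, and let $n$ be the order of stabilization, i.e. the minimal order at which the orbits of the prolonged actions attain the maximal dimension attained in any $J^k$. Jets whose orbit has this maximal dimension are called regular. A (local) $k$-th order differential invariant is a smooth function on an open subset of $J^k$ which is invariant under the prolonged action of the group elements near the identity; a family $I_1,\dots,I_N$ of such invariants is complete near a jet if, near this jet, every $k$-th order invariant is a smooth function of $I_1,\dots,I_N$. Let $S\subset M$ be an (immersed) $p$-dimensional submanifold all of whose $n$-jets are regular. For $k\ge n$ let $\phi_k$ be the map defined near a point of $S$ by restricting a complete family of $k$-th order invariants to the prolongation $j^k(S)$. Let $l\ge n$ and assume that $S$ is regular in the sense that, for every $k\ge l$, the rank of the differential of $\phi_k$ does not vary on $S$. Then for every $k\ge l$ complete families exist near each jet of $j^k(S)$, and the rank $t_k$ of $\phi_k$ is the same at all points of $S$ and for all complete families. (If $S=\emptyset$ this and what follows are to be read for some sequence $t_k$.) The ranks satisfy $t_l\le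 t_{l+1}\le\dots\le p$, and for every $s\ge l$, $$t_s=t_{s+1}\quad\Longrightarrow\quad t_s=t_{s+1}=t_{s+2}=\cdots .$$ Consequently there is a minimal $s\ge l$ with $t_s=t_{s+1}$ (the differential invariant order of $S$). If $l\le n+p$, in particular if $l=n$, then $s\le n+p$. -/

import Mathlib

open Set Filter Topology Asymptotics Manifold ContDiff

noncomputable section

namespace JetGeom

/-- Euclidean space of dimension `d`. -/
abbrev Vec (d : ℕ) := EuclideanSpace ℝ (Fin d)

/-- The model of a smooth manifold of dimension `p + q`, written with coordinates `(x, u)`. -/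
abbrev Mdl (p q : ℕ) := 𝓘(ℝ, Vec p × Vec q)

section Helpers

variable {E₁ E₂ E₃ H₁ H₂ H₃ M₁ M₂ M₃ : Type*}
  [NormedAddCommGroup E₁] [NormedSpace ℝ E₁] [TopologicalSpace H₁]
  [NormedAddCommGroup E₂] [NormedSpace ℝ E₂] [TopologicalSpace H₂]
  [NormedAddCommGroup E₃] [NormedSpace ℝ E₃] [TopologicalSpace H₃]
  {I₁ : ModelWithCorners ℝ E₁ H₁} {I₂ : ModelWithCorners ℝ E₂ H₂} {I₃ : ModelWithCorners ℝ E₃ H₃}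
  [TopologicalSpace M₁] [ChartedSpace H₁ M₁] [TopologicalSpace M₂] [ChartedSpace H₂ M₂]
  [TopologicalSpace M₃] [ChartedSpace H₃ M₃]

theorem injective_mfderiv_of_comp {f : M₁ → M₂} {u : M₂ → M₃} {h : M₁ → M₃} {x : M₁} {y : M₂}
    (hy : f x = y) (hf : MDifferentiableAt I₁ I₂ f x) (hu : MDifferentiableAt I₂ I₃ u y)
    (he : u ∘ f =ᶠ[𝓝 x] h) (hh : Function.Injective (mfderiv I₁ I₃ h x)) :
    Function.Injective (mfderiv I₁ I₂ f x) := by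
  subst hy
  have h1 : mfderiv I₁ I₃ (u ∘ f) x = (mfderiv I₂ I₃ u (f x)).comp (mfderiv I₁ I₂ f x) :=
    mfderiv_comp x hu hf
  intro v w hvw
  have h2 : mfderiv I₁ I₃ (u ∘ f) x v = mfderiv I₁ I₃ (u ∘ f) x w := by
    rw [h1]
    exact congrArg (mfderiv I₂ I₃ u (f x)) hvw
  rw [he.mfderiv_eq] at h2
  exact hh h2

end Helpers

/-- The germ at `0` of a parametrized `p`-dimensional submanifold of `M`: a map
`ℝ^p → M` which is smooth and immersive at `0`. -/
structure Germ (p q : ℕ) (M : Type*) [TopologicalSpace M]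
    [ChartedSpace (Vec p × Vec q) M] where
  toFun : Vec p → M
  smooth : ContMDiffAt 𝓘(ℝ, Vec p) (Mdl p q) ∞ toFun 0
  immersive : Function.Injective (mfderiv 𝓘(ℝ, Vec p) (Mdl p q) toFun 0)

/-- `ψ` is a local diffeomorphism of `(ℝ^p, 0)`. -/
def IsReparam {p : ℕ} (ψ : OpenPartialHomeomorph (Vec p) (Vec p)) : Prop :=
  0 ∈ ψ.source ∧ ψ 0 = 0 ∧ ContDiffAt ℝ ∞ ψ 0 ∧ ContDiffAt ℝ ∞ ψ.symm 0

section Contact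

variable {p q : ℕ} {M : Type*} [TopologicalSpace M] [ChartedSpace (Vec p × Vec q) M]

/-- Contact of order `k`: both germs are germs at the same point and, after a reparametrization,
they agree up to order `k` in a chart at that point. -/
def Contact (k : ℕ) (f g : Germ p q M) : Prop :=
  f.toFun 0 = g.toFun 0 ∧ ∃ ψ : OpenPartialHomeomorph (Vec p) (Vec p), IsReparam ψ ∧
    (fun y => chartAt (Vec p × Vec q) (f.toFun 0) (f.toFun y)
        - chartAt (Vec p × Vec q) (f.toFun 0) (g.toFun (ψ y)))
      =o[𝓝 0] fun y => ‖y‖ ^ k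

theorem IsReparam.tendsto {ψ : OpenPartialHomeomorph (Vec p) (Vec p)} (h : IsReparam ψ) :
    Tendsto ψ (𝓝 0) (𝓝 0) := by
  have := h.2.2.1.continuousAt.tendsto
  rwa [h.2.1] at this

theorem IsReparam.isBigO {ψ : OpenPartialHomeomorph (Vec p) (Vec p)} (h : IsReparam ψ) (k : ℕ) :
    (fun y => ‖ψ y‖ ^ k) =O[𝓝 0] fun y => ‖y‖ ^ k := by
  have h1 := (h.2.2.1.differentiableAt (by simp)).isBigO_sub
  simp only [h.2.1, sub_zero] at h1
  exact h1.norm_norm.pow k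

theorem IsReparam.symm {ψ : OpenPartialHomeomorph (Vec p) (Vec p)} (h : IsReparam ψ) :
    IsReparam ψ.symm := by
  obtain ⟨h0, h1, h2, h3⟩ := h
  have h4 : ψ.symm 0 = 0 := by
    conv_lhs => rw [← h1]
    exact ψ.left_inv h0
  refine ⟨?_, h4, h3, by simpa using h2⟩
  have := ψ.map_source h0
  rwa [h1] at this

theorem IsReparam.trans {ψ χ : OpenPartialHomeomorph (Vec p) (Vec p)} (h : IsReparam ψ)
    (h' : IsReparam χ) : IsReparam (ψ.trans χ) := by
  refine ⟨?_, ?_, ?_, ?_⟩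
  · rw [OpenPartialHomeomorph.trans_source]
    exact ⟨h.1, by simpa [h.2.1] using h'.1⟩
  · simp [h.2.1, h'.2.1]
  · rw [OpenPartialHomeomorph.coe_trans]
    exact ContDiffAt.comp _ (by rw [h.2.1]; exact h'.2.2.1) h.2.2.1
  · rw [OpenPartialHomeomorph.coe_trans_symm]
    exact ContDiffAt.comp _ (by rw [h'.symm.2.1]; exact h.2.2.2) h'.2.2.2

theorem contact_refl (k : ℕ) (f : Germ p q M) : Contact k f f := by
  refine ⟨rfl, OpenPartialHomeomorph.refl _, ⟨by simp, by simp, ?_, ?_⟩, by simp⟩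
  · exact contDiffAt_id
  · exact contDiffAt_id

theorem contact_symm {k : ℕ} {f g : Germ p q M} (h : Contact k f g) : Contact k g f := by
  obtain ⟨h0, ψ, hψ, hc⟩ := h
  refine ⟨h0.symm, ψ.symm, hψ.symm, ?_⟩
  rw [← h0]
  have h1 := (hc.comp_tendsto hψ.symm.tendsto).trans_isBigO (hψ.symm.isBigO k)
  refine (h1.neg_left).congr' ?_ EventuallyEq.rfl
  filter_upwards [ψ.symm.open_source.mem_nhds hψ.symm.1] with y hy
  have : ψ (ψ.symm y) = y := ψ.right_inv hy
  simp [this]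

theorem contact_trans {k : ℕ} {f g h : Germ p q M} (h1 : Contact k f g) (h2 : Contact k g h) :
    Contact k f h := by
  obtain ⟨h10, ψ, hψ, hc⟩ := h1
  obtain ⟨h20, χ, hχ, hd⟩ := h2
  refine ⟨h10.trans h20, ψ.trans χ, hψ.trans hχ, ?_⟩
  rw [← h10] at hd
  have h3 := (hd.comp_tendsto hψ.tendsto).trans_isBigO (hψ.isBigO k)
  refine (hc.add h3).congr_left ?_
  intro y
  simp

/-- Contact of order `k`, as an equivalence relation on germs of `p`-dimensional submanifolds. -/
def contactSetoid (p q : ℕ) (M : Type*) [TopologicalSpace M] [ChartedSpace (Vec p × Vec q) M]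
    (k : ℕ) : Setoid (Germ p q M) where
  r := Contact k
  iseqv := ⟨contact_refl k, contact_symm, contact_trans⟩

end Contact

/-- The `k`-th order (extended) jet space `J^k(M, p)` of `p`-dimensional submanifolds of the
`(p + q)`-dimensional manifold `M`. -/
def Jet (p q : ℕ) (M : Type*) [TopologicalSpace M] [ChartedSpace (Vec p × Vec q) M]
    (k : ℕ) : Type _ := Quotient (contactSetoid p q M k)

/-- The `k`-jet of a germ. -/
def Germ.jet {p q : ℕ} {M : Type*} [TopologicalSpace M] [ChartedSpace (Vec p × Vec q) M]
    (k : ℕ) (f : Germ p q M) : Jet p q M k := Quotient.mk (contactSetoid p q M k) f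

/-! ### Coordinates on jet spaces -/

/-- Multi-indices `J = (j_1, …, j_p)` with `|J| ≤ k`. -/
abbrev MIdx (p k : ℕ) := {J : Fin p → Fin (k + 1) // ∑ i, (J i : ℕ) ≤ k}

/-- Coordinates `(x, u_J)`, `|J| ≤ k`, on `J^k`. -/
abbrev JetCoord (p q k : ℕ) := Vec p × (MIdx p k → Vec q)

/-- The polynomial map `y ↦ ∑_J u_J y^J / J!`, whose partial derivatives at `0` are the `u_J`. -/
def taylorPoly {p q k : ℕ} (u : MIdx p k → Vec q) (y : Vec p) : Vec q :=
  ∑ J : MIdx p k, (∏ i, y i ^ (J.1 i : ℕ) / ((J.1 i : ℕ).factorial : ℝ)) • u J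

theorem contDiff_taylorPoly {p q k : ℕ} (u : MIdx p k → Vec q) :
    ContDiff ℝ ∞ (taylorPoly u) := by
  unfold taylorPoly
  fun_prop

section Coordinates

variable {p q : ℕ} {M : Type*} [TopologicalSpace M] [ChartedSpace (Vec p × Vec q) M]

/-- The smooth charts `(x, u)` of `M`. -/
abbrev SmoothChart (p q : ℕ) (M : Type*) [TopologicalSpace M] [ChartedSpace (Vec p × Vec q) M] :=
  {φ : OpenPartialHomeomorph M (Vec p × Vec q) // φ ∈ IsManifold.maximalAtlas (Mdl p q) ∞ M}

/-- The open set of all `(x, u_J)` such that `(x, u_0)` lies in the image of the chart `φ`. -/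
def coordDomain (k : ℕ) (φ : SmoothChart p q M) : TopologicalSpace.Opens (JetCoord p q k) :=
  ⟨{c | (c.1, taylorPoly c.2 0) ∈ φ.1.target},
    φ.1.open_target.preimage (by unfold taylorPoly; fun_prop)⟩

/-- In the chart `φ`, the graph of the function `u = h(x)` whose derivatives at the point `x`
are the `u_J` for `|J| ≤ k` and vanish for `|J| > k`. -/
def graphGerm [IsManifold (Mdl p q) ∞ M] {k : ℕ} (φ : SmoothChart p q M)
    (c : coordDomain k φ) : Germ p q M where
  toFun y := φ.1.symm (c.1.1 + y, taylorPoly c.1.2 y)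
  smooth := by
    have h0 : ((c.1.1 + 0, taylorPoly c.1.2 0) : Vec p × Vec q) ∈ φ.1.target := by
      rw [add_zero]
      exact c.2
    have h1 := contMDiffAt_symm_of_mem_maximalAtlas φ.2 h0
    have h2 : ContDiffAt ℝ ∞ (fun y : Vec p => (c.1.1 + y, taylorPoly c.1.2 y)) 0 :=
      ((contDiff_const.add contDiff_id).prodMk (contDiff_taylorPoly _)).contDiffAt
    exact ContMDiffAt.comp (x := (0 : Vec p)) h1 h2.contMDiffAt
  immersive := by
    have h0 : ((c.1.1 + 0, taylorPoly c.1.2 0) : Vec p × Vec q) ∈ φ.1.target := by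
      rw [add_zero]
      exact c.2
    have h1 := contMDiffAt_symm_of_mem_maximalAtlas φ.2 h0
    have h2 : ContDiffAt ℝ ∞ (fun y : Vec p => (c.1.1 + y, taylorPoly c.1.2 y)) 0 :=
      ((contDiff_const.add contDiff_id).prodMk (contDiff_taylorPoly _)).contDiffAt
    have h3 : ContMDiffAt 𝓘(ℝ, Vec p) (Mdl p q) ∞
        (fun y : Vec p => φ.1.symm (c.1.1 + y, taylorPoly c.1.2 y)) 0 :=
      ContMDiffAt.comp (x := (0 : Vec p)) h1 h2.contMDiffAt
    have h4 := contMDiffAt_of_mem_maximalAtlas φ.2 (φ.1.map_target h0)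
    refine injective_mfderiv_of_comp (I₃ := 𝓘(ℝ, Vec p))
      (u := fun z => (φ.1 z).1 - c.1.1) (h := id) rfl (h3.mdifferentiableAt (by simp)) ?_ ?_ ?_
    · have h5 : ContDiffAt ℝ ∞ (fun w : Vec p × Vec q => w.1 - c.1.1)
          (φ.1 (φ.1.symm (c.1.1 + 0, taylorPoly c.1.2 0))) :=
        (contDiff_fst.sub contDiff_const).contDiffAt
      exact (h5.contMDiffAt.comp _ h4).mdifferentiableAt (by simp)
    · have h6 := h2.continuousAt.preimage_mem_nhds (φ.1.open_target.mem_nhds h0)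
      filter_upwards [h6] with y hy
      have := φ.1.right_inv hy
      simp [this]
    · rw [mfderiv_id]
      exact Function.injective_id

/-- The coordinate system `(x, u_J)` on `J^k` attached to a chart `(x, u)` of `M`, as a
parametrization of the open set of jets of submanifolds transverse to `x = const`. -/
def Jet.ofCoord [IsManifold (Mdl p q) ∞ M] {k : ℕ} (φ : SmoothChart p q M)
    (c : coordDomain k φ) : Jet p q M k := (graphGerm φ c).jet k

/-- The topology of `J^k`: a set is open iff it is open in all coordinate systems. -/
instance [IsManifold (Mdl p q) ∞ M] (k : ℕ) : TopologicalSpace (Jet p q M k) :=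
  ⨆ φ : SmoothChart p q M, TopologicalSpace.coinduced (Jet.ofCoord φ) inferInstance

/-- A real function on `J^k` is smooth at `ζ` if it is so in all coordinate systems `(x, u_J)`. -/
def SmoothAtJet [IsManifold (Mdl p q) ∞ M] {k : ℕ} (F : Jet p q M k → ℝ)
    (ζ : Jet p q M k) : Prop :=
  ∀ (φ : SmoothChart p q M) (c : coordDomain k φ), Jet.ofCoord φ c = ζ →
    ContMDiffAt 𝓘(ℝ, JetCoord p q k) 𝓘(ℝ, ℝ) ∞ (fun c' => F (Jet.ofCoord φ c')) c

/-! ### Prolongations of submanifolds -/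

variable {S : Type*} [TopologicalSpace S] [ChartedSpace (Vec p) S]

/-- `ι : S → M` is a smooth immersion. -/
def IsSmoothImmersion (p q : ℕ) {M S : Type*} [TopologicalSpace M]
    [ChartedSpace (Vec p × Vec q) M] [TopologicalSpace S] [ChartedSpace (Vec p) S]
    (ι : S → M) : Prop :=
  ContMDiff 𝓘(ℝ, Vec p) (Mdl p q) ∞ ι ∧
    ∀ s, Function.Injective (mfderiv 𝓘(ℝ, Vec p) (Mdl p q) ι s)

/-- The germ of the immersed submanifold `ι : S → M` at `s`, parametrized by the chart at `s`. -/
def submanifoldGerm [IsManifold 𝓘(ℝ, Vec p) ∞ S] {ι : S → M} (hι : IsSmoothImmersion p q ι)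
    (s : S) : Germ p q M where
  toFun y := ι ((chartAt (Vec p) s).symm (chartAt (Vec p) s s + y))
  smooth := by
    have h0 : chartAt (Vec p) s s + 0 ∈ (chartAt (Vec p) s).target := by simp
    have h1 := contMDiffAt_symm_of_mem_maximalAtlas (n := ∞) (I := 𝓘(ℝ, Vec p))
      (IsManifold.chart_mem_maximalAtlas s) h0
    have h2 : ContDiffAt ℝ ∞ (fun y : Vec p => chartAt (Vec p) s s + y) 0 :=
      (contDiff_const.add contDiff_id).contDiffAt
    have h3 := ContMDiffAt.comp (x := (0 : Vec p)) h1 h2.contMDiffAt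
    exact ContMDiffAt.comp (x := (0 : Vec p)) hι.1.contMDiffAt h3
  immersive := by
    have h0 : chartAt (Vec p) s s + 0 ∈ (chartAt (Vec p) s).target := by simp
    have h1 := contMDiffAt_symm_of_mem_maximalAtlas (n := ∞) (I := 𝓘(ℝ, Vec p))
      (IsManifold.chart_mem_maximalAtlas s) h0
    have h2 : ContDiffAt ℝ ∞ (fun y : Vec p => chartAt (Vec p) s s + y) 0 :=
      (contDiff_const.add contDiff_id).contDiffAt
    have h3 : ContMDiffAt 𝓘(ℝ, Vec p) 𝓘(ℝ, Vec p) ∞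
        (fun y : Vec p => (chartAt (Vec p) s).symm (chartAt (Vec p) s s + y)) 0 :=
      ContMDiffAt.comp (x := (0 : Vec p)) h1 h2.contMDiffAt
    have h4 := contMDiffAt_of_mem_maximalAtlas (n := ∞) (I := 𝓘(ℝ, Vec p))
      (IsManifold.chart_mem_maximalAtlas s) ((chartAt (Vec p) s).map_target h0)
    have h7 : Function.Injective (mfderiv 𝓘(ℝ, Vec p) 𝓘(ℝ, Vec p)
        (fun y : Vec p => (chartAt (Vec p) s).symm (chartAt (Vec p) s s + y)) 0) := by
      refine injective_mfderiv_of_comp (I₃ := 𝓘(ℝ, Vec p))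
        (u := fun z => chartAt (Vec p) s z - chartAt (Vec p) s s) (h := id) rfl
        (h3.mdifferentiableAt (by simp)) ?_ ?_ ?_
      · have h5 : ContDiffAt ℝ ∞ (fun w : Vec p => w - chartAt (Vec p) s s)
            (chartAt (Vec p) s ((chartAt (Vec p) s).symm (chartAt (Vec p) s s + 0))) :=
          (contDiff_id.sub contDiff_const).contDiffAt
        exact (h5.contMDiffAt.comp _ h4).mdifferentiableAt (by simp)
      · have h6 := h2.continuousAt.preimage_mem_nhds
          ((chartAt (Vec p) s).open_target.mem_nhds h0)
        filter_upwards [h6] with y hy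
        have := (chartAt (Vec p) s).right_inv hy
        simp [this]
      · rw [mfderiv_id]
        exact Function.injective_id
    have h8 : mfderiv 𝓘(ℝ, Vec p) (Mdl p q)
        (ι ∘ fun y : Vec p => (chartAt (Vec p) s).symm (chartAt (Vec p) s s + y)) 0 = _ :=
      mfderiv_comp (0 : Vec p)
        ((hι.1 ((chartAt (Vec p) s).symm (chartAt (Vec p) s s + 0))).mdifferentiableAt (by simp))
        (h3.mdifferentiableAt (by simp))
    change Function.Injective (mfderiv 𝓘(ℝ, Vec p) (Mdl p q)
        (ι ∘ fun y : Vec p => (chartAt (Vec p) s).symm (chartAt (Vec p) s s + y)) 0)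
    rw [h8]
    exact (hι.2 _).comp h7

/-- The prolongation `j^k(S)`, parametrized by `S`. -/
def prolongSubmanifold [IsManifold 𝓘(ℝ, Vec p) ∞ S] (k : ℕ) {ι : S → M}
    (hι : IsSmoothImmersion p q ι) (s : S) : Jet p q M k := (submanifoldGerm hι s).jet k

end Coordinates

/-! ### Local transformation groups and their prolongations -/

/-- A smooth local action of a Lie group `G` on `M`, defined on an open neighbourhood `domain` of
`{1} × M` in `G × M`. A global action is the case `domain = univ`. -/
structure LocalAction (r p q : ℕ) (G M : Type*) [Group G] [TopologicalSpace G]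
    [ChartedSpace (Vec r) G] [TopologicalSpace M] [ChartedSpace (Vec p × Vec q) M] where
  domain : Set (G × M)
  isOpen_domain : IsOpen domain
  one_mem : ∀ z : M, ((1 : G), z) ∈ domain
  act : G → M → M
  smooth : ContMDiffOn (𝓘(ℝ, Vec r).prod (Mdl p q)) (Mdl p q) ∞ (fun w : G × M => act w.1 w.2) domain
  one_act : ∀ z, act 1 z = z
  inv_mem : ∀ g z, (g, z) ∈ domain → (g⁻¹, act g z) ∈ domain
  mul_act : ∀ a b z, (b, z) ∈ domain → (a, act b z) ∈ domain → (a * b, z) ∈ domain →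
    act a (act b z) = act (a * b) z

section Action

variable {r p q : ℕ} {G M : Type*} [Group G] [TopologicalSpace G]
  [ChartedSpace (Vec r) G] [TopologicalSpace M] [ChartedSpace (Vec p × Vec q) M]

theorem LocalAction.contMDiffAt (A : LocalAction r p q G M) {g : G} {z : M}
    (h : (g, z) ∈ A.domain) : ContMDiffAt (Mdl p q) (Mdl p q) ∞ (A.act g) z := by
  have h1 := A.smooth.contMDiffAt (A.isOpen_domain.mem_nhds h)
  exact ContMDiffAt.comp (x := z) (f := fun z' : M => (g, z'))
    (g := fun w : G × M => A.act w.1 w.2) h1 (contMDiffAt_const.prodMk contMDiffAt_id)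

open Classical in
/-- The image `g · f` of a germ under `g`. Where `g` is not defined, the germ is left unchanged
(this does not happen for `g` near `1`). -/
def LocalAction.actGerm (A : LocalAction r p q G M) (g : G) (f : Germ p q M) : Germ p q M :=
  if h : (g, f.toFun 0) ∈ A.domain then
    { toFun := fun y => A.act g (f.toFun y)
      smooth := ContMDiffAt.comp (x := (0 : Vec p)) (A.contMDiffAt h) f.smooth
      immersive := by
        have h1 : ContMDiffAt 𝓘(ℝ, Vec p) (Mdl p q) ∞ (fun y => A.act g (f.toFun y)) 0 :=
          ContMDiffAt.comp (x := (0 : Vec p)) (A.contMDiffAt h) f.smooth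
        refine injective_mfderiv_of_comp (I₃ := Mdl p q) (u := A.act g⁻¹) (h := f.toFun) rfl
          (h1.mdifferentiableAt (by simp))
          ((A.contMDiffAt (A.inv_mem _ _ h)).mdifferentiableAt (by simp)) ?_ f.immersive
        have h2 : ∀ᶠ y in 𝓝 (0 : Vec p), (g, f.toFun y) ∈ A.domain :=
          (continuousAt_const.prodMk f.smooth.continuousAt).preimage_mem_nhds
            (A.isOpen_domain.mem_nhds h)
        filter_upwards [h2] with y hy
        have h3 : ((g⁻¹ * g, f.toFun y) : G × M) ∈ A.domain := by
          simpa using A.one_mem _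
        have := A.mul_act _ _ _ hy (A.inv_mem _ _ hy) h3
        simpa [A.one_act] using this }
  else f

theorem isLittleO_comp_chart [IsManifold (Mdl p q) ∞ M] {k : ℕ} {f g : Vec p → M} {w : M → M}
    {a b : M} (hb : w a = b)
    (hf : Tendsto f (𝓝 0) (𝓝 a)) (hg : Tendsto g (𝓝 0) (𝓝 a))
    (hw : ContMDiffAt (Mdl p q) (Mdl p q) ∞ w a)
    (h : (fun y => chartAt (Vec p × Vec q) a (f y) - chartAt (Vec p × Vec q) a (g y))
      =o[𝓝 0] fun y => ‖y‖ ^ k) :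
    (fun y => chartAt (Vec p × Vec q) b (w (f y)) - chartAt (Vec p × Vec q) b (w (g y)))
      =o[𝓝 0] fun y => ‖y‖ ^ k := by
  subst hb
  set e := chartAt (Vec p × Vec q) a with he
  set e' := chartAt (Vec p × Vec q) (w a) with he'
  have ha : a ∈ e.source := mem_chart_source _ a
  have hea : e.symm (e a) = a := e.left_inv ha
  have h1 : ContMDiffAt (Mdl p q) (Mdl p q) ∞ e.symm (e a) :=
    contMDiffAt_symm_of_mem_maximalAtlas (IsManifold.chart_mem_maximalAtlas a) (e.map_source ha)
  have h2 : ContMDiffAt (Mdl p q) (Mdl p q) ∞ e' (w a) :=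
    contMDiffAt_of_mem_maximalAtlas (IsManifold.chart_mem_maximalAtlas (w a))
      (mem_chart_source _ _)
  have h3 : ContMDiffAt (Mdl p q) (Mdl p q) ∞ (fun v => e' (w (e.symm v))) (e a) := by
    refine ContMDiffAt.comp (I' := Mdl p q) (M' := M) (x := e a) (g := e') (f := fun v => w (e.symm v)) ?_ ?_
    · simpa [hea] using h2
    · exact ContMDiffAt.comp (x := e a) (g := w) (f := e.symm) (by rw [hea]; exact hw) h1
  have h4 : ContDiffAt ℝ ∞ (fun v => e' (w (e.symm v))) (e a) := contMDiffAt_iff_contDiffAt.1 h3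
  have h5 := (h4.hasStrictFDerivAt (by simp)).isBigO_sub
  have hc : Tendsto e (𝓝 a) (𝓝 (e a)) := e.continuousAt ha
  have h6 := h5.comp_tendsto ((hc.comp hf).prodMk_nhds (hc.comp hg))
  refine (h6.trans_isLittleO h).congr' ?_ EventuallyEq.rfl
  filter_upwards [hf (e.open_source.mem_nhds ha), hg (e.open_source.mem_nhds ha)] with y hy hy'
  have h7 := e.left_inv hy
  have h8 := e.left_inv hy'
  simp [h7, h8]

theorem LocalAction.contact_actGerm [IsManifold (Mdl p q) ∞ M] (A : LocalAction r p q G M)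
    (k : ℕ) (g : G) {f f' : Germ p q M} (h : Contact k f f') :
    Contact k (A.actGerm g f) (A.actGerm g f') := by
  by_cases hd : (g, f.toFun 0) ∈ A.domain
  · have hd' : (g, f'.toFun 0) ∈ A.domain := h.1 ▸ hd
    obtain ⟨h0, ψ, hψ, hc⟩ := h
    simp only [actGerm, hd, hd', dif_pos]
    refine ⟨by simp [h0], ψ, hψ, ?_⟩
    refine isLittleO_comp_chart (p := p) (q := q) (M := M) (a := f.toFun 0) (w := A.act g) (f := f.toFun)
      (g := fun y => f'.toFun (ψ y)) rfl f.smooth.continuousAt ?_ (A.contMDiffAt hd) hc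
    have := f'.smooth.continuousAt.tendsto
    rw [← h0] at this
    exact this.comp hψ.tendsto
  · have hd' : (g, f'.toFun 0) ∉ A.domain := h.1 ▸ hd
    simpa only [actGerm, hd, hd', dif_neg, not_false_iff] using h

/-- The prolonged action `g^(k)` on `J^k(M, p)`, characterized by `g^(k) · j^k(S) = j^k(g · S)`. -/
def LocalAction.prolong [IsManifold (Mdl p q) ∞ M] (A : LocalAction r p q G M) (k : ℕ) (g : G) :
    Jet p q M k → Jet p q M k :=
  Quotient.map (A.actGerm g) fun _ _ h => A.contact_actGerm k g h

variable [IsManifold (Mdl p q) ∞ M]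

/-- The dimension of the orbit of the prolonged action through `ζ`, that is, the rank at `1` of
the orbit map `g ↦ g^(k) · ζ`. It is computed as the dimension of the image of the transposed
map, which consists of the differentials at `1` of the functions `g ↦ F (g^(k) · ζ)` with `F`
smooth near `ζ`. -/
def orbitDim (A : LocalAction r p q G M) {k : ℕ} (ζ : Jet p q M k) : ℕ :=
  Module.finrank ℝ (Submodule.span ℝ
    {η : TangentSpace 𝓘(ℝ, Vec r) (1 : G) →L[ℝ] ℝ | ∃ F : Jet p q M k → ℝ,
      (∀ᶠ ζ' in 𝓝 ζ, SmoothAtJet F ζ') ∧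
      η = mfderiv 𝓘(ℝ, Vec r) 𝓘(ℝ, ℝ) (fun g : G => F (A.prolong k g ζ)) 1})

/-- The orbit through `ζ` has the maximal dimension among the orbits in the jet spaces of all
orders. -/
def HasMaxOrbit (A : LocalAction r p q G M) {k : ℕ} (ζ : Jet p q M k) : Prop :=
  ∀ (l : ℕ) (ζ' : Jet p q M l), orbitDim A ζ' ≤ orbitDim A ζ

/-- `n` is the order of stabilization: the minimal order at which the orbits of the prolonged
action reach the maximal dimension. -/
def IsStabilizationOrder (A : LocalAction r p q G M) (n : ℕ) : Prop :=
  IsLeast {k : ℕ | ∃ ζ : Jet p q M k, HasMaxOrbit A ζ} n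

/-- `F` is, near `ζ`, a (local) differential invariant of order `k`: a smooth function which is
invariant under the prolonged action of the group elements near the identity. -/
def IsDiffInvariantNear (A : LocalAction r p q G M) {k : ℕ} (F : Jet p q M k → ℝ)
    (ζ : Jet p q M k) : Prop :=
  ∀ᶠ ζ' in 𝓝 ζ, SmoothAtJet F ζ' ∧ ∀ᶠ g in 𝓝 (1 : G), F (A.prolong k g ζ') = F ζ'

/-- `I_1, …, I_N` is, near `ζ`, a complete set of differential invariants of order `k`: any other
invariant is a smooth function of them. -/
def IsCompleteNear (A : LocalAction r p q G M) {k N : ℕ} (I : Jet p q M k → Fin N → ℝ)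
    (ζ : Jet p q M k) : Prop :=
  (∀ i, IsDiffInvariantNear A (fun ζ' => I ζ' i) ζ) ∧
    ∀ F : Jet p q M k → ℝ, IsDiffInvariantNear A F ζ →
      ∃ H : (Fin N → ℝ) → ℝ, ContDiffAt ℝ ∞ H (I ζ) ∧ ∀ᶠ ζ' in 𝓝 ζ, F ζ' = H (I ζ')

variable {S : Type*} [TopologicalSpace S] [ChartedSpace (Vec p) S] [IsManifold 𝓘(ℝ, Vec p) ∞ S]

/-- `t` is the rank `t_k` at `s` of the invariant map `φ_k : S → ℝ^N`, the restriction to `j^k(S)`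
of a complete set of differential invariants of order `k`. -/
def IsInvariantRank (A : LocalAction r p q G M) {ι : S → M} (hι : IsSmoothImmersion p q ι)
    (k : ℕ) (s : S) (t : ℕ) : Prop :=
  ∃ (N : ℕ) (I : Jet p q M k → Fin N → ℝ), IsCompleteNear A I (prolongSubmanifold k hι s) ∧
    t = Module.finrank ℝ (LinearMap.range (mfderiv 𝓘(ℝ, Vec p) 𝓘(ℝ, Fin N → ℝ)
      (fun s' : S => I (prolongSubmanifold k hι s')) s).toLinearMap)

/-- The immersed submanifold `ι : S → M` is regular: `j^n(S)` consists of regular jets, where `n`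
is the order of stabilization, and for `k ≥ l` the rank `t_k` does not vary on `S`. -/
def IsRegularSubmanifold (A : LocalAction r p q G M) {ι : S → M} (hι : IsSmoothImmersion p q ι)
    (n l : ℕ) : Prop :=
  (∀ s, HasMaxOrbit A (prolongSubmanifold n hι s)) ∧
    ∀ k, l ≤ k → ∀ s s' t t', IsInvariantRank A hι k s t → IsInvariantRank A hι k s' t' → t = t'

end Action

end JetGeom

end

noncomputable section

namespace JetGeom

set_option linter.unusedSectionVars false

section MultiIndex

variable {p k : ℕ}

/-- The exponents of a multi-index, as natural numbers. -/
def MIdx.exps (J : MIdx p k) : Fin p → ℕ := fun i => (J.1 i : ℕ)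

/-- The multi-index with given exponents. -/
def MIdx.ofExps (J : Fin p → ℕ) (h : ∑ i, J i ≤ k) : MIdx p k :=
  ⟨fun i => ⟨J i, Nat.lt_succ_of_le
    ((Finset.single_le_sum (fun _ _ => Nat.zero_le _) (Finset.mem_univ i)).trans h)⟩, h⟩

@[simp] theorem MIdx.exps_ofExps (J : Fin p → ℕ) (h : ∑ i, J i ≤ k) :
    (MIdx.ofExps J h).exps = J := rfl

theorem MIdx.sum_exps_le (J : MIdx p k) : ∑ i, J.exps i ≤ k := J.2

theorem MIdx.exps_injective : Function.Injective (MIdx.exps : MIdx p k → Fin p → ℕ) := by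
  intro J J' h
  apply Subtype.ext
  funext i
  exact Fin.ext (congrFun h i)

/-- The multi-index `J + e_i`. -/
def MIdx.add (i : Fin p) (J : MIdx p k) : MIdx p (k + 1) :=
  MIdx.ofExps (J.exps + Pi.single i 1) (by
    simp only [Pi.add_apply, Finset.sum_add_distrib]
    have := J.sum_exps_le
    simp [Finset.sum_pi_single']
    omega)

@[simp] theorem MIdx.exps_add (i : Fin p) (J : MIdx p k) :
    (MIdx.add i J).exps = J.exps + Pi.single i 1 := rfl

/-- A multi-index of order at most `j`, seen as a multi-index of order at most `k ≥ j`. -/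
def MIdx.castLE {j k : ℕ} (h : j ≤ k) (J : MIdx p j) : MIdx p k :=
  MIdx.ofExps J.exps (J.sum_exps_le.trans h)

@[simp] theorem MIdx.exps_castLE {j k : ℕ} (h : j ≤ k) (J : MIdx p j) :
    (MIdx.castLE h J).exps = J.exps := rfl

/-- The zero multi-index. -/
def MIdx.zero : MIdx p k := MIdx.ofExps 0 (by simp)

theorem MIdx.exists_eq_add {J : MIdx p (k + 1)} {i : Fin p} (h : J.exps i ≠ 0) :
    ∃ J', J = MIdx.add i J' := by
  have he : J.exps - Pi.single i 1 + Pi.single i 1 = J.exps := by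
    funext j
    by_cases hj : j = i
    · subst hj; simp [Nat.one_le_iff_ne_zero.2 h]
    · simp [hj]
  have hs : ∑ j, (J.exps - Pi.single i 1 : Fin p → ℕ) j ≤ k := by
    have h1 := J.sum_exps_le
    rw [← he] at h1
    simp only [Pi.add_apply, Finset.sum_add_distrib] at h1
    simp at h1 ⊢
    exact h1
  exact ⟨MIdx.ofExps _ hs, MIdx.exps_injective (by simp [he])⟩

theorem MIdx.eq_zero_or_add (J : MIdx p (k + 1)) :
    J = MIdx.zero ∨ ∃ i J', J = MIdx.add i J' := by
  by_cases h : J.exps = 0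
  · exact Or.inl (MIdx.exps_injective h)
  · obtain ⟨i, hi⟩ := Function.ne_iff.1 h
    exact Or.inr ⟨i, MIdx.exists_eq_add hi⟩

/-- The multiset in which `i` occurs `J i` times, as a list. -/
def mlist (J : Fin p → ℕ) : List (Fin p) :=
  (∑ i, J i • ({i} : Multiset (Fin p))).toList

theorem mlist_add_single (i : Fin p) (J : Fin p → ℕ) :
    (mlist (J + Pi.single i 1)).Perm (i :: mlist J) := by
  rw [← Multiset.coe_eq_coe, ← Multiset.cons_coe]
  simp only [mlist, Multiset.coe_toList, Pi.add_apply, add_smul, Finset.sum_add_distrib]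
  rw [add_comm, ← Multiset.singleton_add]
  congr 1
  rw [Finset.sum_eq_single i]
  · simp
  · intro j _ hj
    simp [hj]
  · simp

theorem length_mlist (J : Fin p → ℕ) : (mlist J).length = ∑ i, J i := by
  simp [mlist]

@[simp] theorem mlist_zero : mlist (0 : Fin p → ℕ) = [] := by
  simp [mlist]

end MultiIndex

section IteratedPartials

variable {p : ℕ} {X V : Type*} [NormedAddCommGroup X] [NormedSpace ℝ X]
  [NormedAddCommGroup V] [NormedSpace ℝ V]

/-- Iterated directional derivatives along the directions `d i`, for `i` in the list `l`. -/
def pderivs (d : Fin p → X) : List (Fin p) → (X → V) → X → V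
  | [], h => h
  | i :: l, h => fun x => fderiv ℝ (pderivs d l h) x (d i)

theorem pderivs_append (d : Fin p → X) (l l' : List (Fin p)) (h : X → V) :
    pderivs d (l ++ l') h = pderivs d l (pderivs d l' h) := by
  induction l with
  | nil => rfl
  | cons i l ih => simp only [List.cons_append, pderivs, ih]

theorem contDiffAt_pderivs (d : Fin p → X) (l : List (Fin p)) {h : X → V} {x : X} (n : ℕ)
    (hh : ContDiffAt ℝ ((n + l.length : ℕ) : WithTop ℕ∞) h x) :
    ContDiffAt ℝ (n : WithTop ℕ∞) (pderivs d l h) x := by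
  induction l generalizing n with
  | nil => exact hh
  | cons i l ih =>
    have h1 := ih (n + 1) (hh.of_le (by simp only [List.length_cons]; norm_cast; omega))
    have h2 : ContDiffAt ℝ (n : WithTop ℕ∞) (fderiv ℝ (pderivs d l h)) x :=
      h1.fderiv_right (by norm_cast)
    exact h2.clm_apply contDiffAt_const

theorem contDiffAt_infty_pderivs (d : Fin p → X) (l : List (Fin p)) {h : X → V} {x : X}
    (hh : ContDiffAt ℝ ∞ h x) : ContDiffAt ℝ ∞ (pderivs d l h) x := by
  rw [contDiffAt_infty]
  intro n
  exact contDiffAt_pderivs d l n (contDiffAt_infty.1 hh _)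

theorem pderivs_perm (d : Fin p → X) {l l' : List (Fin p)} (hl : l.Perm l') {h : X → V} {x : X}
    (hh : ContDiffAt ℝ (l.length : WithTop ℕ∞) h x) :
    pderivs d l h =ᶠ[𝓝 x] pderivs d l' h := by
  induction hl with
  | nil => exact EventuallyEq.rfl
  | cons i _ ih =>
    have h1 := ih (hh.of_le (by simp))
    filter_upwards [h1.fderiv (𝕜 := ℝ)] with y hy
    simp only [pderivs, hy]
  | swap i j l =>
    have h1 : ContDiffAt ℝ (2 : ℕ) (pderivs d l h) x :=
      contDiffAt_pderivs d l 2 (hh.of_le (by simp only [List.length_cons]; norm_cast; omega))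
    filter_upwards [h1.eventually (by simp)] with y hy
    have h2 : IsSymmSndFDerivAt ℝ (pderivs d l h) y := hy.isSymmSndFDerivAt (by simp)
    have h3 : DifferentiableAt ℝ (fderiv ℝ (pderivs d l h)) y :=
      (hy.fderiv_right (m := 1) (by norm_cast)).differentiableAt (by simp)
    have h4 : ∀ v w : X, fderiv ℝ (fun z => fderiv ℝ (pderivs d l h) z v) y w
        = fderiv ℝ (fderiv ℝ (pderivs d l h)) y w v := by
      intro v w
      rw [fderiv_clm_apply h3 (differentiableAt_const v)]
      simp
    simp only [pderivs, h4]
    exact h2 _ _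
  | trans h1 _ ih1 ih2 =>
    exact (ih1 hh).trans (ih2 (h1.length_eq ▸ hh))

/-- The Taylor coefficients of order at most `k` of `h` at `x` along the directions `d`. -/
def jetOf (d : Fin p → X) (k : ℕ) (h : X → V) (x : X) : MIdx p k → V :=
  fun J => pderivs d (mlist J.exps) h x

theorem contDiffAt_jetOf (d : Fin p → X) (k : ℕ) {h : X → V} {x : X}
    (hh : ContDiffAt ℝ ∞ h x) : ContDiffAt ℝ ∞ (jetOf d k h) x :=
  contDiffAt_pi.2 fun _ => contDiffAt_infty_pderivs d _ hh

theorem jetOf_zero (d : Fin p → X) (k : ℕ) (h : X → V) (x : X) :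
    jetOf d k h x MIdx.zero = h x := by
  have : (MIdx.zero : MIdx p k).exps = 0 := rfl
  simp [jetOf, this, pderivs]

/-- Restriction of a family of Taylor coefficients to those of the form `J + e_i`. -/
def shift {k : ℕ} (i : Fin p) (u : MIdx p (k + 1) → V) : MIdx p k → V :=
  fun J => u (MIdx.add i J)

theorem shift_jetOf (d : Fin p → X) (k : ℕ) {h : X → V} {x : X} (i : Fin p)
    (hh : ContDiffAt ℝ ((k + 1 : ℕ) : WithTop ℕ∞) h x) :
    shift i (jetOf d (k + 1) h x) = jetOf d k (fun z => fderiv ℝ h z (d i)) x := by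
  funext J
  have h1 : (mlist (MIdx.add i J).exps).Perm (mlist J.exps ++ [i]) :=
    (mlist_add_single i J.exps).trans (List.perm_append_singleton _ _).symm
  have h2 := pderivs_perm d h1 (h := h) (x := x) (hh.of_le (by
    rw [length_mlist]
    exact_mod_cast (MIdx.add i J).sum_exps_le))
  rw [pderivs_append] at h2
  exact h2.eq_of_nhds

theorem fderiv_jetOf (d : Fin p → X) (k : ℕ) {h : X → V} {x : X} (i : Fin p)
    (hh : ContDiffAt ℝ ∞ h x) :
    fderiv ℝ (jetOf d k h) x (d i) = shift i (jetOf d (k + 1) h x) := by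
  funext J
  have h0 : DifferentiableAt ℝ (jetOf d k h) x :=
    (contDiffAt_jetOf d k hh).differentiableAt (by simp)
  have h1 : fderiv ℝ (jetOf d k h) x (d i) J = fderiv ℝ (fun z => jetOf d k h z J) x (d i) := by
    rw [fderiv_apply h0]
    rfl
  rw [h1]
  have h2 := pderivs_perm d (mlist_add_single i J.exps) (h := h) (x := x) (contDiffAt_infty.1 hh _)
  exact h2.symm.eq_of_nhds

end IteratedPartials

section TaylorPoly

variable {p q : ℕ}

/-- The monomial `y^J / J!`. -/
def mono (J : Fin p → ℕ) (y : Vec p) : ℝ := ∏ i, y i ^ J i / ((J i).factorial : ℝ)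

theorem taylorPoly_eq {k : ℕ} (u : MIdx p k → Vec q) (y : Vec p) :
    taylorPoly u y = ∑ J : MIdx p k, mono J.exps y • u J := rfl

theorem contDiff_mono (J : Fin p → ℕ) : ContDiff ℝ ∞ (mono J) := by
  unfold mono
  fun_prop

/-- The standard basis of `ℝ^p`. -/
abbrev stdVec (p : ℕ) (i : Fin p) : Vec p := EuclideanSpace.single i (1 : ℝ)

theorem vec_eq_sum (y : Vec p) : y = ∑ i, y i • stdVec p i := by
  have := (EuclideanSpace.basisFun (Fin p) ℝ).sum_repr y
  simpa using this.symm

theorem mono_add_smul (J : Fin p → ℕ) (i : Fin p) (y : Vec p) (t : ℝ) :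
    mono J (y + t • stdVec p i) = (y i + t) ^ J i / ((J i).factorial : ℝ) *
      ∏ j ∈ Finset.univ.erase i, y j ^ J j / ((J j).factorial : ℝ) := by
  unfold mono
  rw [← Finset.mul_prod_erase _ _ (Finset.mem_univ i)]
  congr 1
  · simp
  · refine Finset.prod_congr rfl fun j hj => ?_
    have := Finset.ne_of_mem_erase hj
    simp [this]

theorem fderiv_mono (J : Fin p → ℕ) (i : Fin p) (y : Vec p) :
    fderiv ℝ (mono J) y (stdVec p i) = ((J i : ℝ) * y i ^ (J i - 1) / ((J i).factorial : ℝ)) *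
      ∏ j ∈ Finset.univ.erase i, y j ^ J j / ((J j).factorial : ℝ) := by
  have h1 : HasFDerivAt (mono J) (fderiv ℝ (mono J) y) y :=
    ((contDiff_mono J).differentiable (by simp) y).hasFDerivAt
  have h2 := (h1.hasLineDerivAt (stdVec p i)).lineDeriv
  rw [← h2, lineDeriv]
  simp only [mono_add_smul]
  have h3 : HasDerivAt (fun t : ℝ => (y i + t) ^ J i) ((J i : ℝ) * (y i + 0) ^ (J i - 1)) 0 := by
    have := ((hasDerivAt_id (0 : ℝ)).const_add (y i)).fun_pow (J i)
    simpa only [id, mul_one] using this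
  have h4 := (h3.div_const ((J i).factorial : ℝ)).mul_const
    (∏ j ∈ Finset.univ.erase i, y j ^ J j / ((J j).factorial : ℝ))
  rw [h4.deriv, add_zero]

theorem fderiv_mono_add_single (J : Fin p → ℕ) (i : Fin p) (y : Vec p) :
    fderiv ℝ (mono (J + Pi.single i 1)) y (stdVec p i) = mono J y := by
  rw [fderiv_mono, mono, ← Finset.mul_prod_erase _ _ (Finset.mem_univ i)]
  congr 1
  · simp only [Pi.add_apply, Pi.single_eq_same, Nat.factorial_succ, Nat.add_sub_cancel]
    push_cast
    have : (J i : ℝ) + 1 ≠ 0 := by positivity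
    field_simp
  · refine Finset.prod_congr rfl fun j hj => ?_
    have := Finset.ne_of_mem_erase hj
    simp [this]

theorem fderiv_mono_of_eq_zero {J : Fin p → ℕ} {i : Fin p} (h : J i = 0) (y : Vec p) :
    fderiv ℝ (mono J) y (stdVec p i) = 0 := by
  rw [fderiv_mono, h]
  simp

theorem MIdx.add_injective {k : ℕ} (i : Fin p) :
    Function.Injective (MIdx.add i : MIdx p k → MIdx p (k + 1)) := by
  intro J J' h
  have := congrArg MIdx.exps h
  simp only [MIdx.exps_add, add_left_inj] at this
  exact MIdx.exps_injective this

theorem fderiv_taylorPoly {k : ℕ} (u : MIdx p (k + 1) → Vec q) (i : Fin p) (y : Vec p) :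
    fderiv ℝ (taylorPoly u) y (stdVec p i) = taylorPoly (shift i u) y := by
  have h1 : fderiv ℝ (taylorPoly u) y
      = ∑ J : MIdx p (k + 1), (fderiv ℝ (mono J.exps) y).smulRight (u J) := by
    have : HasFDerivAt (taylorPoly u)
        (∑ J : MIdx p (k + 1), (fderiv ℝ (mono J.exps) y).smulRight (u J)) y := by
      have h2 : taylorPoly u = fun y => ∑ J : MIdx p (k + 1), mono J.exps y • u J := rfl
      rw [h2]
      refine HasFDerivAt.fun_sum fun J _ => ?_
      exact (((contDiff_mono J.exps).differentiable (by simp) y).hasFDerivAt).smul_const (u J)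
    exact this.fderiv
  rw [h1, taylorPoly_eq]
  simp only [sum_apply, ContinuousLinearMap.smulRight_apply]
  symm
  refine Finset.sum_of_injOn (MIdx.add i) (MIdx.add_injective i).injOn (by simp) ?_ ?_
  · intro J _ hJ
    rw [fderiv_mono_of_eq_zero, zero_smul]
    by_contra h0
    obtain ⟨J', hJ'⟩ := MIdx.exists_eq_add h0
    exact hJ ⟨J', by simp, hJ'.symm⟩
  · intro J _
    rw [MIdx.exps_add, fderiv_mono_add_single]
    rfl

theorem taylorPoly_zero {k : ℕ} (u : MIdx p k → Vec q) : taylorPoly u 0 = u MIdx.zero := by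
  rw [taylorPoly_eq, Finset.sum_eq_single MIdx.zero]
  · have : (MIdx.zero : MIdx p k).exps = 0 := rfl
    simp [mono, this]
  · intro J _ hJ
    have : J.exps ≠ 0 := fun h => hJ (MIdx.exps_injective h)
    obtain ⟨i, hi⟩ := Function.ne_iff.1 this
    rw [mono, Finset.prod_eq_zero (Finset.mem_univ i), zero_smul]
    have hi' : J.exps i ≠ 0 := hi
    simp [hi']
  · simp

theorem taylorPoly_eq_zero {k : ℕ} {u : MIdx p k → Vec q} (h : ∀ y, taylorPoly u y = 0) :
    u = 0 := by
  induction k with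
  | zero =>
    funext J
    have hJ : J = MIdx.zero := by
      apply MIdx.exps_injective
      funext i
      have h1 := J.sum_exps_le
      have h2 := Finset.single_le_sum (f := J.exps) (fun _ _ => Nat.zero_le _) (Finset.mem_univ i)
      have h3 : (MIdx.zero : MIdx p 0).exps i = 0 := rfl
      omega
    rw [hJ, ← taylorPoly_zero u, h]
    rfl
  | succ k ih =>
    have h0 : taylorPoly u = fun _ => 0 := funext h
    have h1 : ∀ i, shift i u = 0 := by
      intro i
      refine ih fun y => ?_
      rw [← fderiv_taylorPoly, h0]
      simp
    funext J
    rcases J.eq_zero_or_add with hJ | ⟨i, J', hJ⟩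
    · rw [hJ, ← taylorPoly_zero u, h]
      rfl
    · rw [hJ]
      exact congrFun (h1 i) J'

theorem coeffs_eq_zero_of_isLittleO {V : Type*} [NormedAddCommGroup V] [NormedSpace ℝ V] (k : ℕ)
    (a : ℕ → V)
    (h : (fun t : ℝ => ∑ j ∈ Finset.range (k + 1), t ^ j • a j) =o[𝓝[≠] 0] fun t => t ^ k) :
    ∀ j ≤ k, a j = 0 := by
  have hz : ∀ (k : ℕ) (a : ℕ → V),
      ((fun t : ℝ => ∑ j ∈ Finset.range (k + 1), t ^ j • a j) =o[𝓝[≠] 0] fun t => t ^ k) →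
      a 0 = 0 := by
    intro k a h
    have h1 : Tendsto (fun t : ℝ => ∑ j ∈ Finset.range (k + 1), t ^ j • a j) (𝓝[≠] 0)
        (𝓝 (a 0)) := by
      have hc : Continuous fun t : ℝ => ∑ j ∈ Finset.range (k + 1), t ^ j • a j := by fun_prop
      have h2 := hc.tendsto 0
      rw [Finset.sum_range_succ'] at h2
      simp at h2
      exact h2.mono_left nhdsWithin_le_nhds
    have h2 : (fun t : ℝ => t ^ k) =O[𝓝[≠] 0] fun _ => (1 : ℝ) := by
      have : Continuous fun t : ℝ => t ^ k := by fun_prop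
      exact ((this.tendsto 0).mono_left nhdsWithin_le_nhds).isBigO_one ℝ
    have h3 := (isLittleO_one_iff ℝ).1 (h.trans_isBigO h2)
    exact tendsto_nhds_unique h1 h3
  induction k generalizing a with
  | zero =>
    intro j hj
    rw [Nat.le_zero.1 hj]
    exact hz 0 a h
  | succ k ih =>
    have h0 := hz _ a h
    have h1 : (fun t : ℝ => ∑ j ∈ Finset.range (k + 1), t ^ j • a (j + 1)) =o[𝓝[≠] 0]
        fun t => t ^ k := by
      have h2 : (fun t : ℝ => t⁻¹) =O[𝓝[≠] 0] fun t => t⁻¹ := isBigO_refl _ _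
      refine (h2.smul_isLittleO h).congr' ?_ ?_
      · filter_upwards [self_mem_nhdsWithin] with t ht
        rw [Finset.sum_range_succ', h0, smul_zero, add_zero, Finset.smul_sum]
        refine Finset.sum_congr rfl fun j _ => ?_
        have ht' : t ≠ 0 := ht
        rw [smul_smul, pow_succ, mul_comm, mul_assoc, mul_inv_cancel₀ ht', mul_one]
      · filter_upwards [self_mem_nhdsWithin] with t ht
        have ht' : t ≠ 0 := ht
        rw [smul_eq_mul, pow_succ, mul_comm, mul_assoc, mul_inv_cancel₀ ht', mul_one]
    intro j hj
    cases j with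
    | zero => exact h0
    | succ j => exact ih (fun j => a (j + 1)) h1 j (by omega)

theorem mono_smul (J : Fin p → ℕ) (t : ℝ) (z : Vec p) :
    mono J (t • z) = t ^ (∑ i, J i) * mono J z := by
  unfold mono
  rw [← Finset.prod_pow_eq_pow_sum, ← Finset.prod_mul_distrib]
  refine Finset.prod_congr rfl fun i _ => ?_
  simp only [PiLp.smul_apply, smul_eq_mul, mul_pow]
  ring

theorem eq_zero_of_taylorPoly_isLittleO {k : ℕ} {u : MIdx p k → Vec q}
    (h : taylorPoly u =o[𝓝 0] fun y => ‖y‖ ^ k) : u = 0 := by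
  refine taylorPoly_eq_zero fun z => ?_
  have h1 : Tendsto (fun t : ℝ => t • z) (𝓝[≠] 0) (𝓝 0) := by
    have : Continuous fun t : ℝ => t • z := by fun_prop
    have h2 := this.tendsto 0
    rw [zero_smul] at h2
    exact h2.mono_left nhdsWithin_le_nhds
  have h2 : (fun t : ℝ => ‖t • z‖ ^ k) =O[𝓝[≠] 0] fun t => t ^ k := by
    refine IsBigO.of_bound (‖z‖ ^ k) (Eventually.of_forall fun t => ?_)
    simp [norm_smul, mul_pow, mul_comm]
  have h3 := (h.comp_tendsto h1).trans_isBigO h2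
  set a : ℕ → Vec q := fun j =>
    ∑ J ∈ Finset.univ.filter (fun J : MIdx p k => ∑ i, J.exps i = j), mono J.exps z • u J with ha
  have h4 : ∀ t : ℝ, taylorPoly u (t • z) = ∑ j ∈ Finset.range (k + 1), t ^ j • a j := by
    intro t
    rw [taylorPoly_eq, ← Finset.sum_fiberwise_of_maps_to (t := Finset.range (k + 1))
      (g := fun J : MIdx p k => ∑ i, J.exps i)
      (fun J _ => Finset.mem_range.2 (Nat.lt_succ_of_le J.sum_exps_le))]
    refine Finset.sum_congr rfl fun j _ => ?_
    rw [ha, Finset.smul_sum]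
    refine Finset.sum_congr rfl fun J hJ => ?_
    rw [mono_smul, (Finset.mem_filter.1 hJ).2, mul_smul]
  have h5 := coeffs_eq_zero_of_isLittleO k a (h3.congr_left h4)
  have h6 := h4 1
  rw [one_smul] at h6
  rw [h6]
  refine Finset.sum_eq_zero fun j hj => ?_
  rw [h5 j (Nat.lt_succ_iff.1 (Finset.mem_range.1 hj)), smul_zero]

theorem isLittleO_pow_succ_of_fderiv {V : Type*} [NormedAddCommGroup V] [NormedSpace ℝ V]
    {E : Type*} [NormedAddCommGroup E] [NormedSpace ℝ E] {g : E → V} {k : ℕ}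
    (hd : ∀ᶠ y in 𝓝 (0 : E), DifferentiableAt ℝ g y) (h0 : g 0 = 0)
    (h : (fun y => fderiv ℝ g y) =o[𝓝 0] fun y => ‖y‖ ^ k) :
    g =o[𝓝 0] fun y => ‖y‖ ^ (k + 1) := by
  refine IsLittleO.of_bound fun c hc => ?_
  obtain ⟨ε, hε, hb⟩ := Metric.eventually_nhds_iff_ball.1 (hd.and (h.bound hc))
  filter_upwards [Metric.ball_mem_nhds (0 : E) hε] with y hy
  have hy' : ‖y‖ < ε := by simpa using hy
  have hsub : ∀ z ∈ Metric.closedBall (0 : E) ‖y‖, ‖z‖ ≤ ‖y‖ ∧ z ∈ Metric.ball (0 : E) ε := by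
    intro z hz
    have : ‖z‖ ≤ ‖y‖ := by simpa using hz
    exact ⟨this, by simpa using this.trans_lt hy'⟩
  have h1 := Convex.norm_image_sub_le_of_norm_fderiv_le (𝕜 := ℝ) (f := g)
    (s := Metric.closedBall (0 : E) ‖y‖) (C := c * ‖y‖ ^ k) (x := 0) (y := y)
    (fun z hz => (hb z (hsub z hz).2).1)
    (fun z hz => by
      refine (hb z (hsub z hz).2).2.trans ?_
      rw [Real.norm_of_nonneg (by positivity)]
      have := (hsub z hz).1
      gcongr)
    (convex_closedBall _ _) (by simp) (by simp)
  rw [h0, sub_zero, sub_zero] at h1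
  rw [Real.norm_of_nonneg (by positivity), pow_succ, ← mul_assoc]
  exact h1

theorem norm_le_sum_stdVec {V : Type*} [NormedAddCommGroup V] [NormedSpace ℝ V]
    (L : Vec p →L[ℝ] V) : ‖L‖ ≤ ∑ i, ‖L (stdVec p i)‖ := by
  refine L.opNorm_le_bound (Finset.sum_nonneg fun _ _ => norm_nonneg _) fun y => ?_
  conv_lhs => rw [vec_eq_sum y]
  rw [map_sum, Finset.sum_mul]
  refine (norm_sum_le _ _).trans (Finset.sum_le_sum fun i _ => ?_)
  rw [map_smul, norm_smul, mul_comm]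
  gcongr
  exact PiLp.norm_apply_le y i

/-- Taylor's theorem with Peano's remainder, along the directions `d i = δ e_i`. -/
theorem taylor_isLittleO {X : Type*} [NormedAddCommGroup X] [NormedSpace ℝ X]
    (δ : Vec p →L[ℝ] X) (k : ℕ) {h : X → Vec q} {x : X} (hh : ContDiffAt ℝ k h x) :
    (fun y => h (x + δ y) - taylorPoly (jetOf (fun i => δ (stdVec p i)) k h x) y)
      =o[𝓝 0] fun y => ‖y‖ ^ k := by
  set d : Fin p → X := fun i => δ (stdVec p i) with hd
  have hc : Tendsto (fun y => x + δ y) (𝓝 0) (𝓝 x) := by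
    have : Continuous fun y => x + δ y := by fun_prop
    simpa using this.tendsto 0
  induction k generalizing h with
  | zero =>
    simp only [pow_zero]
    rw [isLittleO_one_iff]
    have h1 : Tendsto (fun y => h (x + δ y)) (𝓝 0) (𝓝 (h x)) :=
      hh.continuousAt.tendsto.comp hc
    have h2 := ((contDiff_taylorPoly (jetOf d 0 h x)).continuous.tendsto 0)
    rw [taylorPoly_zero, jetOf_zero] at h2
    simpa using h1.sub h2
  | succ k ih =>
    have hcast : ((k + 1 : ℕ) : WithTop ℕ∞) = (k : WithTop ℕ∞) + 1 := by norm_cast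
    have hdiff : ∀ᶠ z in 𝓝 x, DifferentiableAt ℝ h z := by
      filter_upwards [hh.eventually (by simp)] with z hz
      exact hz.differentiableAt (by simp)
    have hT : ∀ y, DifferentiableAt ℝ (taylorPoly (jetOf d (k + 1) h x)) y :=
      fun y => (contDiff_taylorPoly _).differentiable (by simp) y
    have hδ : ∀ y, HasFDerivAt (fun y => x + δ y) δ y := fun y => δ.hasFDerivAt.const_add x
    have hg : ∀ᶠ y in 𝓝 (0 : Vec p),
        HasFDerivAt (fun y => h (x + δ y) - taylorPoly (jetOf d (k + 1) h x) y)
        ((fderiv ℝ h (x + δ y)).comp δ - fderiv ℝ (taylorPoly (jetOf d (k + 1) h x)) y) y := by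
      filter_upwards [hc.eventually hdiff] with y hy
      exact (hy.hasFDerivAt.comp y (hδ y)).sub (hT y).hasFDerivAt
    refine isLittleO_pow_succ_of_fderiv (hg.mono fun y hy => hy.differentiableAt) ?_ ?_
    · simp [taylorPoly_zero, jetOf_zero]
    · have h1 : ∀ i, (fun y => fderiv ℝ h (x + δ y) (d i)
          - taylorPoly (shift i (jetOf d (k + 1) h x)) y) =o[𝓝 0] fun y => ‖y‖ ^ k := by
        intro i
        rw [shift_jetOf d k i hh]
        exact ih ((hh.fderiv_right (by rw [hcast])).clm_apply contDiffAt_const)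
      have h2 : (fun y => ∑ i, ‖fderiv ℝ h (x + δ y) (d i)
          - taylorPoly (shift i (jetOf d (k + 1) h x)) y‖) =o[𝓝 0] fun y => ‖y‖ ^ k :=
        IsLittleO.fun_sum fun i _ => (h1 i).norm_left
      refine IsBigO.trans_isLittleO (IsBigO.of_bound 1 ?_) h2
      filter_upwards [hg] with y hy
      rw [hy.fderiv, one_mul]
      refine (norm_le_sum_stdVec _).trans ?_
      rw [Real.norm_of_nonneg (Finset.sum_nonneg fun _ _ => norm_nonneg _)]
      simp [fderiv_taylorPoly, hd]

theorem abs_mono_le (J : Fin p → ℕ) (y : Vec p) : |mono J y| ≤ ‖y‖ ^ (∑ i, J i) := by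
  unfold mono
  rw [← Finset.prod_pow_eq_pow_sum, Finset.abs_prod]
  refine Finset.prod_le_prod (fun _ _ => abs_nonneg _) fun i _ => ?_
  rw [abs_div, abs_pow, Nat.abs_cast]
  have h1 : |y i| ≤ ‖y‖ := by simpa using PiLp.norm_apply_le y i
  have h2 : (1 : ℝ) ≤ ((J i).factorial : ℝ) := by exact_mod_cast Nat.one_le_iff_ne_zero.2 (Nat.factorial_ne_zero _)
  calc |y i| ^ J i / ((J i).factorial : ℝ) ≤ |y i| ^ J i := div_le_self (by positivity) h2
    _ ≤ ‖y‖ ^ J i := by gcongr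

/-- Truncation of a family of Taylor coefficients. -/
def truncCoeff {j k : ℕ} (hjk : j ≤ k) (u : MIdx p k → Vec q) : MIdx p j → Vec q :=
  fun J => u (MIdx.castLE hjk J)

theorem taylorPoly_truncCoeff_isLittleO {j k : ℕ} (hjk : j ≤ k) (u : MIdx p k → Vec q) :
    (fun y => taylorPoly u y - taylorPoly (truncCoeff hjk u) y) =o[𝓝 0] fun y => ‖y‖ ^ j := by
  have h1 : ∀ y, taylorPoly (truncCoeff hjk u) y
      = ∑ J ∈ Finset.univ.filter (fun J : MIdx p k => ∑ i, J.exps i ≤ j), mono J.exps y • u J := by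
    intro y
    rw [taylorPoly_eq]
    refine Finset.sum_of_injOn (MIdx.castLE hjk) ?_ ?_ ?_ ?_
    · intro J _ J' _ h
      exact MIdx.exps_injective (congrArg (MIdx.exps (k := k)) h)
    · intro J _
      simpa using J.sum_exps_le
    · intro J hJ hJ'
      exact absurd ⟨MIdx.ofExps J.exps (Finset.mem_filter.1 hJ).2, by simp,
        MIdx.exps_injective (by simp)⟩ hJ'
    · intro J _
      rfl
  have h2 : ∀ y, taylorPoly u y - taylorPoly (truncCoeff hjk u) y
      = ∑ J ∈ Finset.univ.filter (fun J : MIdx p k => ¬ ∑ i, J.exps i ≤ j),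
        mono J.exps y • u J := by
    intro y
    rw [h1, taylorPoly_eq, ← Finset.sum_filter_add_sum_filter_not Finset.univ
      (fun J : MIdx p k => ∑ i, J.exps i ≤ j), add_sub_cancel_left]
  simp only [h2]
  refine IsLittleO.fun_sum fun J hJ => ?_
  have hJ' : j + 1 ≤ ∑ i, J.exps i := by
    have := (Finset.mem_filter.1 hJ).2
    omega
  have h3 : (fun y : Vec p => ‖y‖ ^ (∑ i, J.exps i)) =o[𝓝 0] fun y => ‖y‖ ^ j := by
    have h4 : (fun y : Vec p => ‖y‖ ^ (∑ i, J.exps i)) =O[𝓝 0] fun y => ‖y‖ ^ (j + 1) := by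
      refine IsBigO.of_bound 1 ?_
      filter_upwards [Metric.closedBall_mem_nhds (0 : Vec p) one_pos] with y hy
      have hy' : ‖y‖ ≤ 1 := by simpa using hy
      simp only [norm_pow, norm_norm, one_mul]
      exact pow_le_pow_of_le_one (norm_nonneg _) hy' hJ'
    refine h4.trans_isLittleO ?_
    have h5 : (fun y : Vec p => ‖y‖) =o[𝓝 0] fun _ => (1 : ℝ) :=
      (isLittleO_one_iff ℝ).2 (by simpa using (continuous_norm (E := Vec p)).tendsto 0)
    have := (isBigO_refl (fun y : Vec p => ‖y‖ ^ j) (𝓝 0)).mul_isLittleO h5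
    simpa [pow_succ] using this
  refine IsBigO.trans_isLittleO (IsBigO.of_bound ‖u J‖ (Eventually.of_forall fun y => ?_)) h3
  rw [norm_smul, mul_comm, norm_pow, norm_norm]
  gcongr
  exact abs_mono_le _ _

end TaylorPoly

section LocalInverse

variable {X Y : Type*} [NormedAddCommGroup X] [NormedSpace ℝ X] [CompleteSpace X]
  [NormedAddCommGroup Y] [NormedSpace ℝ Y] [CompleteSpace Y]

theorem exists_equiv_of_bijective {L : X →L[ℝ] Y} (h : Function.Bijective L) :
    ∃ e : X ≃L[ℝ] Y, (e : X →L[ℝ] Y) = L :=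
  ⟨ContinuousLinearEquiv.ofBijective L (LinearMap.ker_eq_bot.2 h.1) (LinearMap.range_eq_top.2 h.2),
    ContinuousLinearEquiv.coe_ofBijective _ _ _⟩

/-- The inverse function theorem, for a map which is smooth near a point. -/
theorem exists_smooth_localInverse {Θ : X → Y} {z₀ : X}
    (h : ∀ᶠ z in 𝓝 z₀, ContDiffAt ℝ ∞ Θ z) (hb : Function.Bijective (fderiv ℝ Θ z₀)) :
    ∃ P : OpenPartialHomeomorph X Y, (P : X → Y) = Θ ∧ z₀ ∈ P.source ∧
      ∀ z ∈ P.source, ContDiffAt ℝ ∞ Θ z ∧ ContDiffAt ℝ ∞ P.symm (Θ z) ∧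
        Function.Bijective (fderiv ℝ Θ z) := by
  obtain ⟨e, he⟩ := exists_equiv_of_bijective hb
  have h0 : ContDiffAt ℝ ∞ Θ z₀ := h.self_of_nhds
  have hd : HasFDerivAt Θ (e : X →L[ℝ] Y) z₀ := by
    rw [he]
    exact (h0.differentiableAt (by simp)).hasFDerivAt
  set Q := h0.toOpenPartialHomeomorph Θ hd (by simp) with hQ
  have h1 : ∀ᶠ z in 𝓝 z₀, fderiv ℝ Θ z ∈ range ((↑) : (X ≃L[ℝ] Y) → X →L[ℝ] Y) := by
    have hc : ContinuousAt (fderiv ℝ Θ) z₀ :=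
      (h0.fderiv_right (m := 0) (by simp)).continuousAt
    have := ContinuousLinearEquiv.nhds e
    rw [he] at this
    exact hc this
  obtain ⟨U, hU, hUo, hzU⟩ := eventually_nhds_iff.1 (h.and h1)
  refine ⟨Q.restrOpen U hUo, ?_, ⟨h0.mem_toOpenPartialHomeomorph_source hd (by simp), hzU⟩, ?_⟩
  · exact h0.toOpenPartialHomeomorph_coe hd (by simp)
  · rintro z ⟨hz, hzU'⟩
    obtain ⟨hs, e', he'⟩ := hU z hzU'
    have hQz : Q z = Θ z := congrFun (h0.toOpenPartialHomeomorph_coe hd (by simp)) z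
    have hinv : Q.symm (Θ z) = z := by rw [← hQz]; exact Q.left_inv hz
    refine ⟨hs, ?_, ?_⟩
    · refine Q.contDiffAt_symm (f₀' := e') (by rw [← hQz]; exact Q.map_source hz) ?_ ?_
      · rw [hinv, he']
        exact (hs.differentiableAt (by simp)).hasFDerivAt
      · rw [hinv]
        exact hs
    · rw [← he']
      exact e'.bijective

end LocalInverse

section Coordinates

variable {p q k : ℕ} {M : Type*} [TopologicalSpace M] [ChartedSpace (Vec p × Vec q) M]

theorem eq_zero_of_isLittleO_nhds_zero {E V : Type*} [NormedAddCommGroup E] [NormedAddCommGroup V]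
    {g : E → V} {k : ℕ} (h : g =o[𝓝 0] fun y => ‖y‖ ^ k) : g 0 = 0 := by
  by_contra h0
  have h1 : 0 < ‖g 0‖ := norm_pos_iff.2 h0
  have h2 := (h.bound (half_pos h1)).self_of_nhds
  simp only [norm_zero, norm_pow] at h2
  have h3 : (0 : ℝ) ^ k ≤ 1 := pow_le_one₀ le_rfl zero_le_one
  nlinarith

theorem taylorPoly_sub (u v : MIdx p k → Vec q) (y : Vec p) :
    taylorPoly (u - v) y = taylorPoly u y - taylorPoly v y := by
  simp only [taylorPoly_eq, Pi.sub_apply, smul_sub, Finset.sum_sub_distrib]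

theorem germ_jet_eq {k : ℕ} {f g : Germ p q M} : f.jet k = g.jet k ↔ Contact k f g :=
  Quotient.eq (r := contactSetoid p q M k)

variable [IsManifold (Mdl p q) ∞ M]

theorem contDiffAt_coordChange (φ φ' : SmoothChart p q M) {z : Vec p × Vec q}
    (hz : z ∈ φ'.1.target) (hz' : φ'.1.symm z ∈ φ.1.source) :
    ContDiffAt ℝ ∞ (fun z => φ.1 (φ'.1.symm z)) z := by
  have h1 := contMDiffAt_symm_of_mem_maximalAtlas φ'.2 hz
  have h2 := contMDiffAt_of_mem_maximalAtlas φ.2 hz'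
  exact contMDiffAt_iff_contDiffAt.1 (ContMDiffAt.comp (x := z) h2 h1)

theorem contDiffAt_chart_germ (φ : SmoothChart p q M) (f : Germ p q M)
    (hf : f.toFun 0 ∈ φ.1.source) : ContDiffAt ℝ ∞ (fun y => φ.1 (f.toFun y)) 0 :=
  contMDiffAt_iff_contDiffAt.1
    (ContMDiffAt.comp (x := (0 : Vec p)) (contMDiffAt_of_mem_maximalAtlas φ.2 hf) f.smooth)

theorem isLittleO_coordChange (φ φ' : SmoothChart p q M) {k : ℕ} {f g : Vec p → M} {a : M}
    (ha : a ∈ φ.1.source) (ha' : a ∈ φ'.1.source)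
    (hf : Tendsto f (𝓝 0) (𝓝 a)) (hg : Tendsto g (𝓝 0) (𝓝 a))
    (h : (fun y => φ.1 (f y) - φ.1 (g y)) =o[𝓝 0] fun y => ‖y‖ ^ k) :
    (fun y => φ'.1 (f y) - φ'.1 (g y)) =o[𝓝 0] fun y => ‖y‖ ^ k := by
  have hea : φ.1.symm (φ.1 a) = a := φ.1.left_inv ha
  have h4 := contDiffAt_coordChange φ' φ (φ.1.map_source ha) (by rwa [hea])
  have h5 := (h4.hasStrictFDerivAt (by simp)).isBigO_sub
  have hc : Tendsto φ.1 (𝓝 a) (𝓝 (φ.1 a)) := φ.1.continuousAt ha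
  have h6 := h5.comp_tendsto ((hc.comp hf).prodMk_nhds (hc.comp hg))
  refine (h6.trans_isLittleO h).congr' ?_ EventuallyEq.rfl
  filter_upwards [hf (φ.1.open_source.mem_nhds ha), hg (φ.1.open_source.mem_nhds ha)] with y hy hy'
  have h7 := φ.1.left_inv hy
  have h8 := φ.1.left_inv hy'
  simp [h7, h8]

/-- The preferred chart at a point, as a smooth chart. -/
def smoothChartAt (p q : ℕ) {M : Type*} [TopologicalSpace M] [ChartedSpace (Vec p × Vec q) M]
    [IsManifold (Mdl p q) ∞ M] (a : M) : SmoothChart p q M :=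
  ⟨chartAt (Vec p × Vec q) a, IsManifold.chart_mem_maximalAtlas a⟩

theorem contact_iff_chart (φ : SmoothChart p q M) {k : ℕ} {f g : Germ p q M}
    (hf : f.toFun 0 ∈ φ.1.source) :
    Contact k f g ↔ f.toFun 0 = g.toFun 0 ∧ ∃ ψ : OpenPartialHomeomorph (Vec p) (Vec p),
      IsReparam ψ ∧ (fun y => φ.1 (f.toFun y) - φ.1 (g.toFun (ψ y))) =o[𝓝 0] fun y => ‖y‖ ^ k := by
  have hs : f.toFun 0 ∈ (smoothChartAt p q (f.toFun 0)).1.source := mem_chart_source _ _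
  refine and_congr_right fun h0 => exists_congr fun ψ => and_congr_right fun hψ => ?_
  have hg : Tendsto (fun y => g.toFun (ψ y)) (𝓝 0) (𝓝 (f.toFun 0)) := by
    rw [h0]
    exact g.smooth.continuousAt.tendsto.comp hψ.tendsto
  exact ⟨isLittleO_coordChange (smoothChartAt p q (f.toFun 0)) φ hs hf f.smooth.continuousAt hg,
    isLittleO_coordChange φ (smoothChartAt p q (f.toFun 0)) hf hs f.smooth.continuousAt hg⟩

theorem coordDomain_mem {k : ℕ} {φ : SmoothChart p q M} (c : coordDomain k φ) :
    (c.1.1, taylorPoly c.1.2 0) ∈ φ.1.target := c.2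

theorem graphGerm_zero {k : ℕ} (φ : SmoothChart p q M) (c : coordDomain k φ) :
    (graphGerm φ c).toFun 0 = φ.1.symm (c.1.1, taylorPoly c.1.2 0) := by
  simp [graphGerm]

theorem graphGerm_mem {k : ℕ} (φ : SmoothChart p q M) (c : coordDomain k φ) :
    (graphGerm φ c).toFun 0 ∈ φ.1.source := by
  rw [graphGerm_zero]
  exact φ.1.map_target (coordDomain_mem c)

theorem eventually_chart_graphGerm {k : ℕ} (φ : SmoothChart p q M) (c : coordDomain k φ) :
    ∀ᶠ y in 𝓝 (0 : Vec p), (graphGerm φ c).toFun y ∈ φ.1.source ∧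
      φ.1 ((graphGerm φ c).toFun y) = (c.1.1 + y, taylorPoly c.1.2 y) := by
  have h2 : Continuous (fun y : Vec p => (c.1.1 + y, taylorPoly c.1.2 y)) :=
    (continuous_const.add continuous_id).prodMk (contDiff_taylorPoly _).continuous
  have h0 : (c.1.1 + 0, taylorPoly c.1.2 0) ∈ φ.1.target := by
    rw [add_zero]
    exact coordDomain_mem c
  filter_upwards [h2.continuousAt.preimage_mem_nhds (φ.1.open_target.mem_nhds h0)] with y hy
  exact ⟨φ.1.map_target hy, φ.1.right_inv hy⟩

theorem isReparam_refl : IsReparam (OpenPartialHomeomorph.refl (Vec p)) :=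
  ⟨by simp, by simp, contDiffAt_id, contDiffAt_id⟩

/-- Recognition of the jet with coordinates `c` in the chart `φ`. -/
theorem jet_eq_ofCoord (φ : SmoothChart p q M) (f : Germ p q M) (c : coordDomain k φ)
    (hf : f.toFun 0 ∈ φ.1.source) (hx : (φ.1 (f.toFun 0)).1 = c.1.1)
    (h : (fun y => (φ.1 (f.toFun y)).2 - taylorPoly c.1.2 ((φ.1 (f.toFun y)).1 - c.1.1))
      =o[𝓝 0] fun y => ‖y‖ ^ k)
    (ht : k = 0 ∨ Function.Bijective (fderiv ℝ (fun y => (φ.1 (f.toFun y)).1) 0)) :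
    f.jet k = Jet.ofCoord φ c := by
  have h0 := eq_zero_of_isLittleO_nhds_zero h
  rw [hx, sub_self, sub_eq_zero] at h0
  have hb : φ.1 (f.toFun 0) = (c.1.1, taylorPoly c.1.2 0) := Prod.ext hx h0
  have hfg : f.toFun 0 = (graphGerm φ c).toFun 0 := by
    rw [graphGerm_zero, ← hb, φ.1.left_inv hf]
  have hs := contDiffAt_chart_germ φ f hf
  refine germ_jet_eq.2 ((contact_iff_chart φ hf).2 ⟨hfg, ?_⟩)
  rcases ht with rfl | ht
  · refine ⟨_, isReparam_refl, ?_⟩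
    simp only [pow_zero, isLittleO_one_iff]
    have h1 := hs.continuousAt.tendsto
    have h2 := (contDiffAt_chart_germ φ _ (graphGerm_mem φ c)).continuousAt.tendsto
    have := h1.sub h2
    rw [hfg, sub_self] at this
    exact this
  · have hs1 : ContDiffAt ℝ ∞ (fun y => (φ.1 (f.toFun y)).1) 0 := contDiffAt_fst.comp 0 hs
    set Θ : Vec p → Vec p := fun y => (φ.1 (f.toFun y)).1 - c.1.1 with hΘ
    have hΘs : ContDiffAt ℝ ∞ Θ 0 := hs1.sub contDiffAt_const
    have hd : fderiv ℝ Θ 0 = fderiv ℝ (fun y => (φ.1 (f.toFun y)).1) 0 := fderiv_sub_const _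
    obtain ⟨e, he⟩ := exists_equiv_of_bijective ht
    have hD : HasFDerivAt Θ (e : Vec p →L[ℝ] Vec p) 0 := by
      rw [he, ← hd]
      exact (hΘs.differentiableAt (by simp)).hasFDerivAt
    have hΘ0 : Θ 0 = 0 := by simp [hΘ, hx]
    have hcoe := hΘs.toOpenPartialHomeomorph_coe hD (by simp)
    have hmem := hΘs.mem_toOpenPartialHomeomorph_source hD (by simp)
    have hinv := hΘs.to_localInverse hD (by simp)
    rw [hΘ0] at hinv
    set ψ := hΘs.toOpenPartialHomeomorph Θ hD (by simp) with hψ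
    have hψr : IsReparam ψ := ⟨hmem, by rw [hcoe, hΘ0], by rw [hcoe]; exact hΘs, hinv⟩
    refine ⟨ψ, hψr, ?_⟩
    have h3 := hψr.tendsto.eventually (eventually_chart_graphGerm φ c)
    have h4 : (fun y => ((0 : Vec p), (φ.1 (f.toFun y)).2
        - taylorPoly c.1.2 ((φ.1 (f.toFun y)).1 - c.1.1))) =o[𝓝 0] fun y => ‖y‖ ^ k :=
      (isLittleO_zero _ _).prod_left h
    refine h4.congr' ?_ EventuallyEq.rfl
    filter_upwards [h3] with y hy
    rw [hy.2, hcoe]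
    ext1 <;> simp [hΘ]

/-- What it means for a germ to have the jet with coordinates `c`. -/
theorem of_jet_eq_ofCoord (φ : SmoothChart p q M) {f : Germ p q M} {c : coordDomain k φ}
    (h : f.jet k = Jet.ofCoord φ c) :
    f.toFun 0 ∈ φ.1.source ∧ φ.1 (f.toFun 0) = (c.1.1, taylorPoly c.1.2 0) ∧
      ∃ ψ : OpenPartialHomeomorph (Vec p) (Vec p), IsReparam ψ ∧
        (fun y => (φ.1 (f.toFun y)).1 - (c.1.1 + ψ y)) =o[𝓝 0] (fun y => ‖y‖ ^ k) ∧
        (fun y => (φ.1 (f.toFun y)).2 - taylorPoly c.1.2 (ψ y)) =o[𝓝 0] fun y => ‖y‖ ^ k := by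
  have h1 : Contact k f (graphGerm φ c) := germ_jet_eq.1 h
  have hf : f.toFun 0 ∈ φ.1.source := by
    rw [h1.1]
    exact graphGerm_mem φ c
  obtain ⟨h0, ψ, hψ, hc⟩ := (contact_iff_chart φ hf).1 h1
  refine ⟨hf, ?_, ψ, hψ, ?_⟩
  · rw [h0, graphGerm_zero, φ.1.right_inv (coordDomain_mem c)]
  · refine isLittleO_prod_left.1 (hc.congr' ?_ EventuallyEq.rfl)
    filter_upwards [hψ.tendsto.eventually (eventually_chart_graphGerm φ c)] with y hy
    rw [hy.2]
    rfl

theorem taylorPoly_isBigO_sub (u : MIdx p k → Vec q) {a b : Vec p → Vec p}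
    (ha : Tendsto a (𝓝 0) (𝓝 0)) (hb : Tendsto b (𝓝 0) (𝓝 0)) :
    (fun y => taylorPoly u (a y) - taylorPoly u (b y)) =O[𝓝 0] fun y => a y - b y := by
  have h1 : HasStrictFDerivAt (taylorPoly u) (fderiv ℝ (taylorPoly u) 0) 0 :=
    (contDiff_taylorPoly u).contDiffAt.hasStrictFDerivAt (by simp)
  have h2 := h1.isBigO_sub.comp_tendsto (ha.prodMk_nhds hb)
  simpa only [Function.comp_def] using h2

theorem Jet.ofCoord_injective (φ : SmoothChart p q M) :
    Function.Injective (Jet.ofCoord φ : coordDomain k φ → Jet p q M k) := by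
  intro c' c h
  obtain ⟨_, h1, ψ, hψ, h2, h3⟩ := of_jet_eq_ofCoord φ (f := graphGerm φ c') (c := c) h
  have he := eventually_chart_graphGerm φ c'
  have hx : c'.1.1 = c.1.1 := by
    have := congrArg Prod.fst h1
    rw [he.self_of_nhds.2] at this
    simpa using this
  have h4 : (fun y => y - ψ y) =o[𝓝 0] fun y => ‖y‖ ^ k := by
    refine h2.congr' ?_ EventuallyEq.rfl
    filter_upwards [he] with y hy
    rw [hy.2, hx]
    simp
  have h5 : taylorPoly (c'.1.2 - c.1.2) =o[𝓝 0] fun y => ‖y‖ ^ k := by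
    have h6 := (taylorPoly_isBigO_sub c.1.2 tendsto_id hψ.tendsto).trans_isLittleO h4
    refine (h3.sub h6).congr' ?_ EventuallyEq.rfl
    filter_upwards [he] with y hy
    rw [hy.2, taylorPoly_sub]
    simp
  have h7 := sub_eq_zero.1 (eq_zero_of_taylorPoly_isLittleO h5)
  exact Subtype.ext (Prod.ext hx h7)

theorem fderiv_eq_zero_of_isLittleO {E V : Type*} [NormedAddCommGroup E] [NormedSpace ℝ E]
    [NormedAddCommGroup V] [NormedSpace ℝ V] {g : E → V} {k : ℕ} (hk : k ≠ 0)
    (h : g =o[𝓝 0] fun y => ‖y‖ ^ k) : HasFDerivAt g (0 : E →L[ℝ] V) 0 := by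
  rw [hasFDerivAt_iff_isLittleO]
  have h0 := eq_zero_of_isLittleO_nhds_zero h
  simp only [h0, sub_zero, zero_apply]
  refine h.trans_isBigO (IsBigO.of_bound 1 ?_)
  filter_upwards [Metric.closedBall_mem_nhds (0 : E) one_pos] with y hy
  have hy' : ‖y‖ ≤ 1 := by simpa using hy
  rw [norm_pow, norm_norm, one_mul]
  exact pow_le_of_le_one (norm_nonneg _) hy' hk

/-- A germ whose jet has coordinates in the chart `φ` is transverse to `x = const`. -/
theorem bijective_of_jet_eq_ofCoord (φ : SmoothChart p q M) {f : Germ p q M}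
    {c : coordDomain k φ} (h : f.jet k = Jet.ofCoord φ c) :
    k = 0 ∨ Function.Bijective (fderiv ℝ (fun y => (φ.1 (f.toFun y)).1) 0) := by
  refine or_iff_not_imp_left.2 fun hk => ?_
  obtain ⟨hf, _, ψ, hψ, h2, _⟩ := of_jet_eq_ofCoord φ h
  have h3 := fderiv_eq_zero_of_isLittleO hk h2
  have h4 : DifferentiableAt ℝ ψ 0 := hψ.2.2.1.differentiableAt (by simp)
  have h5 := h3.fun_add (h4.hasFDerivAt.const_add c.1.1)
  simp only [sub_add_cancel, zero_add] at h5
  rw [h5.fderiv]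
  have h6 : DifferentiableAt ℝ ψ.symm 0 := hψ.2.2.2.differentiableAt (by simp)
  have hs := hψ.symm
  have e1 : (fderiv ℝ ψ.symm 0).comp (fderiv ℝ ψ 0) = ContinuousLinearMap.id ℝ _ := by
    have h7 : HasFDerivAt (fun y => ψ.symm (ψ y)) ((fderiv ℝ ψ.symm 0).comp (fderiv ℝ ψ 0)) 0 := by
      refine HasFDerivAt.comp (0 : Vec p) ?_ h4.hasFDerivAt
      rw [hψ.2.1]
      exact h6.hasFDerivAt
    refine h7.unique ((hasFDerivAt_id _).congr_of_eventuallyEq ?_)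
    filter_upwards [ψ.open_source.mem_nhds hψ.1] with y hy
    exact ψ.left_inv hy
  have e2 : (fderiv ℝ ψ 0).comp (fderiv ℝ ψ.symm 0) = ContinuousLinearMap.id ℝ _ := by
    have h7 : HasFDerivAt (fun y => ψ (ψ.symm y)) ((fderiv ℝ ψ 0).comp (fderiv ℝ ψ.symm 0)) 0 := by
      refine HasFDerivAt.comp (0 : Vec p) ?_ h6.hasFDerivAt
      rw [hs.2.1]
      exact h4.hasFDerivAt
    refine h7.unique ((hasFDerivAt_id _).congr_of_eventuallyEq ?_)
    filter_upwards [ψ.symm.open_source.mem_nhds hs.1] with y hy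
    exact ψ.right_inv hy
  exact ⟨Function.LeftInverse.injective (g := fderiv ℝ ψ.symm 0) fun v => DFunLike.congr_fun e1 v,
    Function.RightInverse.surjective (g := fderiv ℝ ψ.symm 0) fun v => DFunLike.congr_fun e2 v⟩

/-- The coordinates of the jets of a smooth family of germs depend smoothly on the parameter. -/
theorem exists_smooth_coord {E : Type*} [NormedAddCommGroup E] [NormedSpace ℝ E] [CompleteSpace E]
    (φ : SmoothChart p q M) (k : ℕ) {γ : E × Vec p → Vec p × Vec q} {a : E}
    (hγ : ∀ᶠ z in 𝓝 (a, (0 : Vec p)), ContDiffAt ℝ ∞ γ z) (h0 : γ (a, 0) ∈ φ.1.target)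
    (ht : k = 0 ∨ Function.Bijective (fderiv ℝ (fun y => (γ (a, y)).1) 0)) :
    ∃ C : E → JetCoord p q k, (∀ᶠ b in 𝓝 a, ContDiffAt ℝ ∞ C b) ∧
      ∀ᶠ b in 𝓝 a, ∃ hc : C b ∈ coordDomain k φ, ∀ f : Germ p q M,
        (∀ᶠ y in 𝓝 0, f.toFun y ∈ φ.1.source ∧ φ.1 (f.toFun y) = γ (b, y)) →
          f.jet k = Jet.ofCoord φ ⟨C b, hc⟩ := by
  have hι : ∀ b : E, Tendsto (fun b : E => (b, (0 : Vec p))) (𝓝 b) (𝓝 (b, 0)) := fun b =>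
    (Continuous.prodMk_left (0 : Vec p)).tendsto b
  have hγ0 : ∀ᶠ b in 𝓝 a, ContDiffAt ℝ ∞ γ (b, 0) := (hι a).eventually hγ
  have htgt : ∀ᶠ b in 𝓝 a, γ (b, 0) ∈ φ.1.target :=
    (hγ.self_of_nhds.continuousAt.tendsto.comp (hι a)).eventually (φ.1.open_target.mem_nhds h0)
  have hb0 : ∀ b, ContDiffAt ℝ ∞ (fun b : E => (b, (0 : Vec p))) b := fun b =>
    contDiffAt_id.prodMk contDiffAt_const
  rcases ht with rfl | ht
  · refine ⟨fun b => ((γ (b, 0)).1, fun _ => (γ (b, 0)).2), ?_, ?_⟩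
    · filter_upwards [hγ0] with b hb
      have h1 : ContDiffAt ℝ ∞ (fun b => γ (b, 0)) b := ContDiffAt.comp b hb (hb0 b)
      exact (contDiffAt_fst.comp b h1).prodMk
        (contDiffAt_pi.2 fun _ => contDiffAt_snd.comp b h1)
    · filter_upwards [htgt] with b hb
      have hc : ((γ (b, 0)).1, fun _ : MIdx p 0 => (γ (b, 0)).2) ∈ coordDomain 0 φ := by
        change (_, taylorPoly _ 0) ∈ φ.1.target
        rw [taylorPoly_zero]
        exact hb
      refine ⟨hc, fun f hf => ?_⟩
      have hf0 := hf.self_of_nhds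
      refine jet_eq_ofCoord φ f ⟨_, hc⟩ hf0.1 (by rw [hf0.2]) ?_ (Or.inl rfl)
      simp only [pow_zero, isLittleO_one_iff]
      have h1 := (contDiffAt_chart_germ φ f hf0.1).continuousAt
      have h2 : ContinuousAt (fun y => (φ.1 (f.toFun y)).2 - taylorPoly
        (fun _ : MIdx p 0 => (γ (b, 0)).2) ((φ.1 (f.toFun y)).1 - (γ (b, 0)).1)) 0 := by
        have h3 := (contDiff_taylorPoly (fun _ : MIdx p 0 => (γ (b, 0)).2)).continuous
        exact (continuousAt_snd.comp h1).sub
          (h3.continuousAt.comp ((continuousAt_fst.comp h1).sub continuousAt_const))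
      have h4 := h2.tendsto
      rw [hf0.2, sub_self, taylorPoly_zero, sub_self] at h4
      exact h4
  · set Θ : E × Vec p → E × Vec p := fun z => (z.1, (γ z).1) with hΘ
    have hΘs : ∀ z, ContDiffAt ℝ ∞ γ z → ContDiffAt ℝ ∞ Θ z := fun z hz =>
      contDiffAt_fst.prodMk (contDiffAt_fst.comp z hz)
    have hΘd : ∀ b, ContDiffAt ℝ ∞ γ (b, 0) → ∀ v w, fderiv ℝ Θ (b, 0) (v, w) =
        (v, fderiv ℝ (fun z => (γ z).1) (b, 0) (v, w)) := by
      intro b hb v w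
      have h1 : HasFDerivAt (fun z => (γ z).1) (fderiv ℝ (fun z => (γ z).1) (b, 0)) (b, 0) :=
        ((contDiffAt_fst.comp _ hb).differentiableAt (by simp)).hasFDerivAt
      have h2 : HasFDerivAt Θ _ (b, 0) := hasFDerivAt_fst.prodMk h1
      rw [h2.fderiv]
      rfl
    have hpd : ∀ b, ContDiffAt ℝ ∞ γ (b, 0) → ∀ w,
        fderiv ℝ (fun y => (γ (b, y)).1) 0 w = fderiv ℝ (fun z => (γ z).1) (b, 0) (0, w) := by
      intro b hb w
      have h1 : HasFDerivAt (fun z => (γ z).1) (fderiv ℝ (fun z => (γ z).1) (b, 0)) (b, 0) :=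
        ((contDiffAt_fst.comp _ hb).differentiableAt (by simp)).hasFDerivAt
      have h2 : HasFDerivAt (fun y : Vec p => (b, y)) (ContinuousLinearMap.inr ℝ E (Vec p)) 0 :=
        hasFDerivAt_prodMk_right b 0
      have h3 : HasFDerivAt (fun y => (γ (b, y)).1) _ 0 := HasFDerivAt.comp (0 : Vec p) (g := fun z => (γ z).1) h1 h2
      rw [h3.fderiv]
      rfl
    have hbij : ∀ b, ContDiffAt ℝ ∞ γ (b, 0) → (Function.Bijective (fderiv ℝ Θ (b, 0)) ↔
        Function.Bijective (fderiv ℝ (fun y => (γ (b, y)).1) 0)) := by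
      intro b hb
      constructor
      · intro h
        constructor
        · intro w w' hw
          have h1 : fderiv ℝ Θ (b, 0) (0, w) = fderiv ℝ Θ (b, 0) (0, w') := by
            rw [hΘd b hb, hΘd b hb, ← hpd b hb, ← hpd b hb, hw]
          exact (Prod.ext_iff.1 (h.1 h1)).2
        · intro w
          obtain ⟨⟨v, w'⟩, hw⟩ := h.2 (0, w)
          rw [hΘd b hb] at hw
          obtain ⟨rfl, h2⟩ := Prod.ext_iff.1 hw
          exact ⟨w', by rw [hpd b hb]; exact h2⟩
      · intro h
        constructor
        · rintro ⟨v, w⟩ ⟨v', w'⟩ hw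
          rw [hΘd b hb, hΘd b hb] at hw
          obtain ⟨rfl, h2⟩ := Prod.ext_iff.1 hw
          have h3 : fderiv ℝ (fun z => (γ z).1) (b, 0) (0, w)
              = fderiv ℝ (fun z => (γ z).1) (b, 0) (0, w') := by
            have e : ∀ w : Vec p, ((0 : E), w) = (v, w) - (v, 0) := by intro w; simp
            rw [e w, e w', map_sub, map_sub]
            exact congrArg (· - _) h2
          rw [← hpd b hb, ← hpd b hb] at h3
          rw [h.1 h3]
        · rintro ⟨v, w⟩
          obtain ⟨w', hw'⟩ := h.2 (w - fderiv ℝ (fun z => (γ z).1) (b, 0) (v, 0))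
          refine ⟨(v, w'), ?_⟩
          rw [hΘd b hb]
          rw [hpd b hb] at hw'
          have e : (v, w') = ((0 : E), w') + (v, 0) := by simp
          rw [e, map_add, hw', sub_add_cancel]
    obtain ⟨P, hP, hmem, hPs⟩ := exists_smooth_localInverse (Θ := Θ) (z₀ := (a, 0))
      (hγ.mono hΘs) ((hbij a hγ0.self_of_nhds).2 ht)
    set h : E × Vec p → Vec q := fun z => (γ (P.symm z)).2 with hh
    set d : Fin p → E × Vec p := fun i => ContinuousLinearMap.inr ℝ E (Vec p) (stdVec p i) with hd
    have hPa : ∀ᶠ b in 𝓝 a, (b, (0 : Vec p)) ∈ P.source :=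
      (hι a).eventually (P.open_source.mem_nhds hmem)
    have hhs : ∀ b, ContDiffAt ℝ ∞ γ (b, 0) → (b, (0 : Vec p)) ∈ P.source →
        ContDiffAt ℝ ∞ h (Θ (b, 0)) := by
      intro b hb hbP
      have h1 : P.symm (Θ (b, 0)) = (b, 0) := by
        rw [← hP]
        exact P.left_inv hbP
      have h2 : ContDiffAt ℝ ∞ (fun z => γ (P.symm z)) (Θ (b, 0)) :=
        ContDiffAt.comp _ (by rw [h1]; exact hb) (hPs _ hbP).2.1
      exact contDiffAt_snd.comp _ h2
    have hinv : ∀ b, (b, (0 : Vec p)) ∈ P.source →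
        ∀ᶠ y in 𝓝 (0 : Vec p), h (Θ (b, y)) = (γ (b, y)).2 := by
      intro b hb
      have h1 : Tendsto (fun y : Vec p => (b, y)) (𝓝 0) (𝓝 (b, 0)) :=
        (Continuous.prodMk_right b).tendsto 0
      filter_upwards [h1.eventually (P.open_source.mem_nhds hb)] with y hy
      have h1 : P.symm (Θ (b, y)) = (b, y) := by
        rw [← hP]
        exact P.left_inv hy
      rw [hh]
      simp only [h1]
    refine ⟨fun b => ((γ (b, 0)).1, jetOf d k h (Θ (b, 0))), ?_, ?_⟩
    · filter_upwards [hγ0, hPa] with b hb hbP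
      have h1 : ContDiffAt ℝ ∞ (fun b => γ (b, 0)) b := ContDiffAt.comp b hb (hb0 b)
      have h2 : ContDiffAt ℝ ∞ (fun b => Θ (b, 0)) b := ContDiffAt.comp b (hΘs _ hb) (hb0 b)
      exact (contDiffAt_fst.comp b h1).prodMk
        (ContDiffAt.comp b (contDiffAt_jetOf d k (hhs b hb hbP)) h2)
    · filter_upwards [hγ0, hPa, htgt] with b hb hbP hbt
      have hc : ((γ (b, 0)).1, jetOf d k h (Θ (b, 0))) ∈ coordDomain k φ := by
        change (_, taylorPoly _ 0) ∈ φ.1.target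
        rw [taylorPoly_zero]
        change ((γ (b, 0)).1, jetOf d k h (Θ (b, 0)) MIdx.zero) ∈ φ.1.target
        rw [jetOf_zero, (hinv b hbP).self_of_nhds]
        exact hbt
      refine ⟨hc, fun f hf => ?_⟩
      have hf0 := hf.self_of_nhds
      have hfe : (fun y => (φ.1 (f.toFun y)).1) =ᶠ[𝓝 0] fun y => (γ (b, y)).1 := by
        filter_upwards [hf] with y hy
        rw [hy.2]
      refine jet_eq_ofCoord φ f ⟨_, hc⟩ hf0.1 (by rw [hf0.2]) ?_ (Or.inr ?_)
      · have hT := taylor_isLittleO (ContinuousLinearMap.inr ℝ E (Vec p)) k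
          (contDiffAt_infty.1 (hhs b hb hbP) k)
        have ha1 : ContDiffAt ℝ ∞ (fun y => (φ.1 (f.toFun y)).1 - (γ (b, 0)).1) 0 :=
          (contDiffAt_fst.comp 0 (contDiffAt_chart_germ φ f hf0.1)).sub contDiffAt_const
        have ha0 : (φ.1 (f.toFun 0)).1 - (γ (b, 0)).1 = 0 := by rw [hf0.2, sub_self]
        have ha2 : Tendsto (fun y => (φ.1 (f.toFun y)).1 - (γ (b, 0)).1) (𝓝 0) (𝓝 0) := by
          have := ha1.continuousAt.tendsto
          rwa [ha0] at this
        have ha3 : (fun y => ‖(φ.1 (f.toFun y)).1 - (γ (b, 0)).1‖ ^ k) =O[𝓝 0]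
            fun y => ‖y‖ ^ k := by
          have h1 := (ha1.differentiableAt (by simp)).isBigO_sub
          simp only [ha0, sub_zero] at h1
          exact h1.norm_norm.pow k
        refine ((hT.comp_tendsto ha2).trans_isBigO ha3).congr' ?_ EventuallyEq.rfl
        filter_upwards [hf, hinv b hbP] with y hy hy'
        simp only [Function.comp]
        have e : Θ (b, 0) + ContinuousLinearMap.inr ℝ E (Vec p)
            ((φ.1 (f.toFun y)).1 - (γ (b, 0)).1) = Θ (b, y) := by
          rw [hy.2]
          simp [hΘ]
        rw [e, hy', hy.2]
      · rw [hfe.fderiv_eq]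
        exact (hbij b hb).1 (hPs _ hbP).2.2

end Coordinates

section JetTopology

variable {p q k : ℕ} {M : Type*} [TopologicalSpace M] [ChartedSpace (Vec p × Vec q) M]
  [IsManifold (Mdl p q) ∞ M]

theorem eventually_mem_coordDomain {φ : SmoothChart p q M} {x : JetCoord p q k}
    (hx : x ∈ coordDomain k φ) : ∀ᶠ x' in 𝓝 x, x' ∈ coordDomain k φ :=
  (coordDomain k φ).isOpen.mem_nhds hx

theorem contDiff_graphMap : ContDiff ℝ ∞ fun z : JetCoord p q k × Vec p =>
    (z.1.1 + z.2, taylorPoly z.1.2 z.2) := by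
  have h1 : ContDiff ℝ ∞ fun z : JetCoord p q k × Vec p => z.1.1 + z.2 := by fun_prop
  have h2 : ContDiff ℝ ∞ fun z : JetCoord p q k × Vec p => taylorPoly z.1.2 z.2 := by
    unfold taylorPoly
    fun_prop
  exact ContDiff.prodMk h1 h2

/-- Changes of coordinates on `J^k` are smooth. -/
theorem exists_jet_transition (φ φ' : SmoothChart p q M) (c' : coordDomain k φ')
    (c : coordDomain k φ) (h : Jet.ofCoord φ' c' = Jet.ofCoord φ c) :
    ∃ T : JetCoord p q k → JetCoord p q k, ContDiffAt ℝ ∞ T c'.1 ∧ T c'.1 = c.1 ∧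
      ∀ᶠ x in 𝓝 c'.1, ∃ (hx' : x ∈ coordDomain k φ') (hx : T x ∈ coordDomain k φ),
        Jet.ofCoord φ' ⟨x, hx'⟩ = Jet.ofCoord φ ⟨T x, hx⟩ := by
  obtain ⟨hf, hb, -⟩ := of_jet_eq_ofCoord φ (f := graphGerm φ' c') (c := c) h
  have ht := bijective_of_jet_eq_ofCoord φ (f := graphGerm φ' c') (c := c) h
  have hg0 : (graphGerm φ' c').toFun 0 = φ'.1.symm (c'.1.1, taylorPoly c'.1.2 0) :=
    graphGerm_zero φ' c'
  set P : JetCoord p q k × Vec p → Vec p × Vec q :=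
    fun z => (z.1.1 + z.2, taylorPoly z.1.2 z.2) with hP
  have hPs : ContDiff ℝ ∞ P := contDiff_graphMap
  have hP0 : P (c'.1, 0) = (c'.1.1, taylorPoly c'.1.2 0) := by simp [hP]
  have hev : ∀ᶠ z in 𝓝 (c'.1, (0 : Vec p)), P z ∈ φ'.1.target ∧ φ'.1.symm (P z) ∈ φ.1.source := by
    have h1 : P (c'.1, 0) ∈ φ'.1.target := by rw [hP0]; exact coordDomain_mem c'
    have h2 := hPs.continuous.continuousAt.eventually (φ'.1.open_target.mem_nhds h1)
    have h3 : ContinuousAt (fun z => φ'.1.symm (P z)) (c'.1, (0 : Vec p)) :=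
      (φ'.1.continuousAt_symm h1).comp (f := P) hPs.continuous.continuousAt
    have h4 : φ'.1.symm (P (c'.1, 0)) ∈ φ.1.source := by rw [hP0, ← hg0]; exact hf
    exact h2.and (h3.eventually (φ.1.open_source.mem_nhds h4))
  obtain ⟨C, hC, hCj⟩ := exists_smooth_coord φ k (a := c'.1) (γ := fun z => φ.1 (φ'.1.symm (P z)))
    (by
      filter_upwards [hev] with z hz
      exact ContDiffAt.comp (g := fun w => φ.1 (φ'.1.symm w)) z
        (contDiffAt_coordChange φ φ' hz.1 hz.2) hPs.contDiffAt)
    (φ.1.map_source hev.self_of_nhds.2)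
    ht
  have hj : ∀ᶠ x in 𝓝 c'.1, ∃ (hx' : x ∈ coordDomain k φ') (hx : C x ∈ coordDomain k φ),
        Jet.ofCoord φ' ⟨x, hx'⟩ = Jet.ofCoord φ ⟨C x, hx⟩ := by
    have hev' := (Continuous.prodMk_left (0 : Vec p)).continuousAt.eventually
      hev.eventually_nhds
    filter_upwards [hCj, eventually_mem_coordDomain c'.2, hev'] with x hx hx' hex
    obtain ⟨hc, hx⟩ := hx
    refine ⟨hx', hc, hx (graphGerm φ' ⟨x, hx'⟩) ?_⟩
    have h1 := (Continuous.prodMk_right x).continuousAt.eventually hex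
    filter_upwards [h1] with y hy
    exact ⟨hy.2, rfl⟩
  refine ⟨C, hC.self_of_nhds, ?_, hj⟩
  obtain ⟨_, hx, he⟩ := hj.self_of_nhds
  have h1 : Jet.ofCoord φ ⟨C c'.1, hx⟩ = Jet.ofCoord φ c := by rw [← he, ← h]
  exact congrArg Subtype.val (Jet.ofCoord_injective φ h1)

theorem Jet.continuous_ofCoord (φ : SmoothChart p q M) :
    Continuous (Jet.ofCoord φ : coordDomain k φ → Jet p q M k) := by
  rw [continuous_iff_coinduced_le]
  exact le_iSup (fun φ : SmoothChart p q M =>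
    TopologicalSpace.coinduced (Jet.ofCoord φ : coordDomain k φ → Jet p q M k) inferInstance) φ

theorem Jet.isOpenMap_ofCoord (φ : SmoothChart p q M) :
    IsOpenMap (Jet.ofCoord φ : coordDomain k φ → Jet p q M k) := by
  intro O hO
  refine isOpen_iSup_iff.2 fun φ' => isOpen_coinduced.2 (isOpen_iff_mem_nhds.2 ?_)
  rintro c' ⟨c, hc, hcc⟩
  obtain ⟨T, hT, hTc, hj⟩ := exists_jet_transition φ φ' c' c hcc.symm
  have hO' : ∃ U : Set (JetCoord p q k), IsOpen U ∧ Subtype.val ⁻¹' U = O := isOpen_induced_iff.1 hO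
  obtain ⟨U, hU, rfl⟩ := hO'
  have h1 : ∀ᶠ x in 𝓝 c'.1, T x ∈ U := hT.continuousAt.eventually
    (by rw [hTc]; exact hU.mem_nhds hc)
  have h2 := (continuous_subtype_val.tendsto c').eventually (h1.and hj)
  filter_upwards [h2] with x hx
  obtain ⟨hxU, hx', hxc, he⟩ := hx
  exact ⟨⟨T x.1, hxc⟩, hxU, he.symm⟩

theorem nhds_ofCoord (φ : SmoothChart p q M) (c : coordDomain k φ) :
    𝓝 (Jet.ofCoord φ c) = map (Jet.ofCoord φ) (𝓝 c) :=
  le_antisymm ((Jet.isOpenMap_ofCoord φ).nhds_le c) (Jet.continuous_ofCoord φ).continuousAt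

theorem eventually_nhds_ofCoord (φ : SmoothChart p q M) (c : coordDomain k φ)
    {P : Jet p q M k → Prop} :
    (∀ᶠ ζ in 𝓝 (Jet.ofCoord φ c), P ζ) ↔
      ∀ᶠ x in 𝓝 c.1, ∀ hx : x ∈ coordDomain k φ, P (Jet.ofCoord φ ⟨x, hx⟩) := by
  rw [nhds_ofCoord, eventually_map]
  rw [show 𝓝 c.1 = map Subtype.val (𝓝 c) from
    ((coordDomain k φ).isOpen.isOpenEmbedding_subtypeVal.map_nhds_eq c).symm, eventually_map]
  exact eventually_congr (Eventually.of_forall fun x => ⟨fun h _ => h, fun h => h x.2⟩)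

open Classical in
/-- A function on `J^k` in the coordinates of the chart `φ`, extended by zero. -/
def inCoord {V : Type*} [Zero V] (φ : SmoothChart p q M) (F : Jet p q M k → V)
    (x : JetCoord p q k) : V :=
  if hx : x ∈ coordDomain k φ then F (Jet.ofCoord φ ⟨x, hx⟩) else 0

theorem inCoord_of_mem {V : Type*} [Zero V] (φ : SmoothChart p q M) (F : Jet p q M k → V)
    {x : JetCoord p q k} (hx : x ∈ coordDomain k φ) :
    inCoord φ F x = F (Jet.ofCoord φ ⟨x, hx⟩) := dif_pos hx

theorem smoothAtJet_iff (φ : SmoothChart p q M) (c : coordDomain k φ) (F : Jet p q M k → ℝ) :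
    SmoothAtJet F (Jet.ofCoord φ c) ↔ ContDiffAt ℝ ∞ (inCoord φ F) c.1 := by
  have key : ∀ (φ : SmoothChart p q M) (c : coordDomain k φ),
      ContMDiffAt 𝓘(ℝ, JetCoord p q k) 𝓘(ℝ, ℝ) ∞ (fun c' => F (Jet.ofCoord φ c')) c ↔
        ContDiffAt ℝ ∞ (inCoord φ F) c.1 := by
    intro φ c
    rw [← contMDiffAt_iff_contDiffAt, ← contMDiffAt_subtype_iff (U := coordDomain k φ)]
    have : (fun x : coordDomain k φ => inCoord φ F x.1) = fun c' => F (Jet.ofCoord φ c') :=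
      funext fun x => inCoord_of_mem φ F x.2
    rw [this]
  constructor
  · intro h
    exact (key φ c).1 (h φ c rfl)
  · intro h φ' c' hc
    rw [key]
    obtain ⟨T, hT, hTc, hj⟩ := exists_jet_transition φ φ' c' c hc
    have h1 : ContDiffAt ℝ ∞ (fun x => inCoord φ F (T x)) c'.1 :=
      ContDiffAt.comp (g := inCoord φ F) _ (by rw [hTc]; exact h) hT
    refine h1.congr_of_eventuallyEq ?_
    filter_upwards [hj] with x hx
    obtain ⟨hx', hx, he⟩ := hx
    rw [inCoord_of_mem φ' F hx', inCoord_of_mem φ F hx, he]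

theorem eventually_smoothAtJet_iff (φ : SmoothChart p q M) (c : coordDomain k φ)
    (F : Jet p q M k → ℝ) :
    (∀ᶠ ζ in 𝓝 (Jet.ofCoord φ c), SmoothAtJet F ζ) ↔
      ∀ᶠ x in 𝓝 c.1, ContDiffAt ℝ ∞ (inCoord φ F) x := by
  rw [eventually_nhds_ofCoord]
  constructor
  · intro h
    filter_upwards [h, eventually_mem_coordDomain c.2] with x hx hxd
    exact (smoothAtJet_iff φ ⟨x, hxd⟩ F).1 (hx hxd)
  · intro h
    filter_upwards [h] with x hx hxd
    exact (smoothAtJet_iff φ ⟨x, hxd⟩ F).2 hx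

open Classical in
/-- The coordinates of a jet in the chart `φ`. -/
def Jet.coord (φ : SmoothChart p q M) (ζ : Jet p q M k) : JetCoord p q k :=
  if h : ∃ c : coordDomain k φ, Jet.ofCoord φ c = ζ then h.choose.1 else 0

theorem Jet.coord_ofCoord (φ : SmoothChart p q M) (c : coordDomain k φ) :
    Jet.coord φ (Jet.ofCoord φ c) = c.1 := by
  have h : ∃ c' : coordDomain k φ, Jet.ofCoord φ c' = Jet.ofCoord φ c := ⟨c, rfl⟩
  rw [Jet.coord, dif_pos h]
  exact congrArg Subtype.val (Jet.ofCoord_injective φ h.choose_spec)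

theorem contact_of_le {j k : ℕ} (hjk : j ≤ k) {f g : Germ p q M} (h : Contact k f g) :
    Contact j f g := by
  obtain ⟨h0, ψ, hψ, hc⟩ := h
  refine ⟨h0, ψ, hψ, hc.trans_isBigO (IsBigO.of_bound 1 ?_)⟩
  filter_upwards [Metric.closedBall_mem_nhds (0 : Vec p) one_pos] with y hy
  have hy' : ‖y‖ ≤ 1 := by simpa using hy
  simp only [norm_pow, norm_norm, one_mul]
  exact pow_le_pow_of_le_one (norm_nonneg _) hy' hjk

/-- The projection `J^k → J^j` for `j ≤ k`. -/
def Jet.proj {j k : ℕ} (hjk : j ≤ k) : Jet p q M k → Jet p q M j :=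
  Quotient.map id fun _ _ h => contact_of_le hjk h

/-- The projection `J^k → J^j` in coordinates. -/
def truncCoord (p q : ℕ) {j k : ℕ} (hjk : j ≤ k) : JetCoord p q k →L[ℝ] JetCoord p q j :=
  (ContinuousLinearMap.fst ℝ _ _).prod
    ((ContinuousLinearMap.pi fun J => ContinuousLinearMap.proj (MIdx.castLE hjk J)).comp
      (ContinuousLinearMap.snd ℝ _ _))

theorem truncCoord_apply {j k : ℕ} (hjk : j ≤ k) (x : JetCoord p q k) :
    truncCoord p q hjk x = (x.1, truncCoeff hjk x.2) := rfl

theorem truncCoord_truncCoord {i j k : ℕ} (hij : i ≤ j) (hjk : j ≤ k) (x : JetCoord p q k) :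
    truncCoord p q hij (truncCoord p q hjk x) = truncCoord p q (hij.trans hjk) x := rfl

theorem truncCoord_mem_iff {j k : ℕ} (hjk : j ≤ k) {φ : SmoothChart p q M} {x : JetCoord p q k} :
    truncCoord p q hjk x ∈ coordDomain j φ ↔ x ∈ coordDomain k φ := by
  change (_, taylorPoly _ 0) ∈ φ.1.target ↔ (_, taylorPoly _ 0) ∈ φ.1.target
  rw [taylorPoly_zero, taylorPoly_zero]
  rfl

theorem Jet.proj_ofCoord {j k : ℕ} (hjk : j ≤ k) (φ : SmoothChart p q M) (c : coordDomain k φ) :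
    Jet.proj hjk (Jet.ofCoord φ c) =
      Jet.ofCoord φ ⟨truncCoord p q hjk c.1, (truncCoord_mem_iff hjk).2 c.2⟩ := by
  have he := eventually_chart_graphGerm φ c
  refine jet_eq_ofCoord φ (graphGerm φ c) _ he.self_of_nhds.1 (by rw [he.self_of_nhds.2]; simp [truncCoord_apply]) ?_
    (Or.inr ?_)
  · refine (taylorPoly_truncCoeff_isLittleO hjk c.1.2).congr' ?_ EventuallyEq.rfl
    filter_upwards [he] with y hy
    rw [hy.2]
    simp [truncCoord_apply]
  · have h1 : (fun y => (φ.1 ((graphGerm φ c).toFun y)).1) =ᶠ[𝓝 0] fun y => c.1.1 + y := by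
      filter_upwards [he] with y hy
      rw [hy.2]
    rw [h1.fderiv_eq, fderiv_const_add]
    simp only [fderiv_fun_id]
    exact Function.bijective_id

end JetTopology

section ChartPoint

variable {d : ℕ} {N : Type*} [TopologicalSpace N] [ChartedSpace (Vec d) N]

/-- The parametrization of a neighbourhood of `x` by the preferred chart, centred at `0`. -/
def chartPt (x : N) (v : Vec d) : N := (chartAt (Vec d) x).symm (chartAt (Vec d) x x + v)

/-- The centred preferred chart at `x`. -/
def chartVec (x z : N) : Vec d := chartAt (Vec d) x z - chartAt (Vec d) x x

@[simp] theorem chartPt_zero (x : N) : chartPt x (0 : Vec d) = x := by simp [chartPt]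

@[simp] theorem chartVec_self (x : N) : (chartVec x x : Vec d) = 0 := sub_self _

theorem eventually_mem_chart_target (x : N) :
    ∀ᶠ v in 𝓝 (0 : Vec d), chartAt (Vec d) x x + v ∈ (chartAt (Vec d) x).target := by
  have h1 : Continuous fun v : Vec d => chartAt (Vec d) x x + v := by fun_prop
  have h2 := h1.tendsto 0
  rw [add_zero] at h2
  exact h2.eventually ((chartAt (Vec d) x).open_target.mem_nhds (mem_chart_target _ x))

theorem chartVec_chartPt {x : N} {v : Vec d}
    (h : chartAt (Vec d) x x + v ∈ (chartAt (Vec d) x).target) : chartVec x (chartPt x v) = v := by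
  simp [chartVec, chartPt, (chartAt (Vec d) x).right_inv h]

theorem chartPt_chartVec {x z : N} (h : z ∈ (chartAt (Vec d) x).source) :
    chartPt x (chartVec x z : Vec d) = z := by
  simp [chartVec, chartPt, (chartAt (Vec d) x).left_inv h]

variable [IsManifold 𝓘(ℝ, Vec d) ∞ N]

theorem contMDiffAt_chartPt {x : N} {v : Vec d}
    (h : chartAt (Vec d) x x + v ∈ (chartAt (Vec d) x).target) :
    ContMDiffAt 𝓘(ℝ, Vec d) 𝓘(ℝ, Vec d) ∞ (chartPt x) v := by
  have h1 := contMDiffAt_symm_of_mem_maximalAtlas (n := ∞) (I := 𝓘(ℝ, Vec d))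
    (IsManifold.chart_mem_maximalAtlas x) h
  have h2 : ContDiffAt ℝ ∞ (fun v : Vec d => chartAt (Vec d) x x + v) v :=
    (contDiff_const.add contDiff_id).contDiffAt
  exact ContMDiffAt.comp (x := v) h1 h2.contMDiffAt

theorem contMDiffAt_chartVec {x z : N} (h : z ∈ (chartAt (Vec d) x).source) :
    ContMDiffAt 𝓘(ℝ, Vec d) 𝓘(ℝ, Vec d) ∞ (chartVec x : N → Vec d) z := by
  have h1 := contMDiffAt_of_mem_maximalAtlas (n := ∞) (I := 𝓘(ℝ, Vec d))
    (IsManifold.chart_mem_maximalAtlas x) h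
  have h2 : ContDiffAt ℝ ∞ (fun v : Vec d => v - chartAt (Vec d) x x) (chartAt (Vec d) x z) :=
    (contDiff_id.sub contDiff_const).contDiffAt
  exact ContMDiffAt.comp (x := z) (g := fun v : Vec d => v - chartAt (Vec d) x x)
    (f := chartAt (Vec d) x) h2.contMDiffAt h1

theorem continuousAt_chartPt_zero (x : N) : ContinuousAt (chartPt x : Vec d → N) 0 :=
  (contMDiffAt_chartPt (by simp : chartAt (Vec d) x x + 0 ∈ (chartAt (Vec d) x).target)).continuousAt

theorem mfderiv_eq_fderiv_chartPt {V : Type*} [NormedAddCommGroup V] [NormedSpace ℝ V]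
    {f : N → V} {x : N} (hf : DifferentiableAt ℝ (fun v : Vec d => f (chartPt x v)) 0) :
    mfderiv 𝓘(ℝ, Vec d) 𝓘(ℝ, V) f x = fderiv ℝ (fun v : Vec d => f (chartPt x v)) 0 := by
  have h1 : MDifferentiableAt 𝓘(ℝ, Vec d) 𝓘(ℝ, V) f x := by
    have h2 : MDifferentiableAt 𝓘(ℝ, Vec d) 𝓘(ℝ, Vec d) (chartVec x : N → Vec d) x :=
      (contMDiffAt_chartVec (mem_chart_source _ x)).mdifferentiableAt (by simp)
    have h3 : MDifferentiableAt 𝓘(ℝ, Vec d) 𝓘(ℝ, V) (fun v : Vec d => f (chartPt x v))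
        (chartVec x x) := by
      rw [chartVec_self]
      exact hf.mdifferentiableAt
    refine (h3.comp x h2).congr_of_eventuallyEq ?_
    filter_upwards [(chartAt (Vec d) x).open_source.mem_nhds (mem_chart_source _ x)] with z hz
    simp [chartPt_chartVec hz]
  have h4 : (fun v : Vec d => f (chartPt x v)) =
    fun v => (f ∘ (chartAt (Vec d) x).symm) (chartAt (Vec d) x x + v) := rfl
  have h5 : fderivWithin ℝ (writtenInExtChartAt 𝓘(ℝ, Vec d) 𝓘(ℝ, V) x f)
      (range 𝓘(ℝ, Vec d)) (extChartAt 𝓘(ℝ, Vec d) x x) =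
      fderiv ℝ (fun v : Vec d => f (chartPt x v)) 0 := by
    simp only [writtenInExtChartAt, extChartAt_model_space_eq_id, PartialEquiv.refl_coe,
      modelWithCornersSelf_coe, range_id, fderivWithin_univ]
    rw [h4, fderiv_comp_add_left, add_zero]
    simp [extChartAt, OpenPartialHomeomorph.extend, Function.comp_def]
  exact h1.mfderiv.trans h5

end ChartPoint

section GroupCoordinates

variable {r : ℕ} (G : Type*) [Group G] [TopologicalSpace G] [ChartedSpace (Vec r) G]

/-- Multiplication in the preferred chart at the identity. -/
def mulCoord (z : Vec r × Vec r) : Vec r :=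
  chartVec (1 : G) (chartPt (1 : G) z.1 * chartPt (1 : G) z.2)

/-- Inversion in the preferred chart at the identity. -/
def invCoord (v : Vec r) : Vec r := chartVec (1 : G) (chartPt (1 : G) v)⁻¹

variable [LieGroup 𝓘(ℝ, Vec r) ∞ G]

omit [LieGroup 𝓘(ℝ, Vec r) ∞ G] in
@[simp] theorem mulCoord_zero : mulCoord G (0 : Vec r × Vec r) = 0 := by simp [mulCoord]

omit [LieGroup 𝓘(ℝ, Vec r) ∞ G] in
@[simp] theorem invCoord_zero : invCoord G (0 : Vec r) = 0 := by simp [invCoord]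

theorem eventually_mulCoord : ∀ᶠ z in 𝓝 (0 : Vec r × Vec r),
    ContDiffAt ℝ ∞ (mulCoord G) z ∧
      chartPt (1 : G) (mulCoord G z) = chartPt (1 : G) z.1 * chartPt (1 : G) z.2 := by
  have : IsManifold 𝓘(ℝ, Vec r) ∞ G := LieGroup.toContMDiffMul.toIsManifold
  have h1 := (continuous_fst.tendsto (0 : Vec r × Vec r)).eventually
    (eventually_mem_chart_target (1 : G))
  have h2 := (continuous_snd.tendsto (0 : Vec r × Vec r)).eventually
    (eventually_mem_chart_target (1 : G))
  have hs : ∀ z : Vec r × Vec r,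
      chartAt (Vec r) (1 : G) 1 + z.1 ∈ (chartAt (Vec r) (1 : G)).target →
      chartAt (Vec r) (1 : G) 1 + z.2 ∈ (chartAt (Vec r) (1 : G)).target →
      ContMDiffAt 𝓘(ℝ, Vec r × Vec r) 𝓘(ℝ, Vec r) ∞
        (fun z : Vec r × Vec r => chartPt (1 : G) z.1 * chartPt (1 : G) z.2) z := by
    intro z h1 h2
    have h3 : ContMDiffAt 𝓘(ℝ, Vec r × Vec r) 𝓘(ℝ, Vec r) ∞
        (fun z : Vec r × Vec r => chartPt (1 : G) z.1) z :=
      ContMDiffAt.comp (x := z) (g := chartPt (1 : G)) (f := Prod.fst) (contMDiffAt_chartPt h1)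
        contDiffAt_fst.contMDiffAt
    have h4 : ContMDiffAt 𝓘(ℝ, Vec r × Vec r) 𝓘(ℝ, Vec r) ∞
        (fun z : Vec r × Vec r => chartPt (1 : G) z.2) z :=
      ContMDiffAt.comp (x := z) (g := chartPt (1 : G)) (f := Prod.snd) (contMDiffAt_chartPt h2)
        contDiffAt_snd.contMDiffAt
    exact h3.mul h4
  have h3 := (hs 0 h1.self_of_nhds h2.self_of_nhds).continuousAt.eventually
    ((chartAt (Vec r) (1 : G)).open_source.mem_nhds (by simp))
  filter_upwards [h1, h2, h3] with z hz1 hz2 hz3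
  refine ⟨?_, chartPt_chartVec hz3⟩
  exact contMDiffAt_iff_contDiffAt.1
    (ContMDiffAt.comp (x := z) (contMDiffAt_chartVec hz3) (hs z hz1 hz2))

theorem eventually_invCoord : ∀ᶠ v in 𝓝 (0 : Vec r),
    ContDiffAt ℝ ∞ (invCoord G) v ∧
      chartPt (1 : G) (invCoord G v) = (chartPt (1 : G) v)⁻¹ := by
  have : IsManifold 𝓘(ℝ, Vec r) ∞ G := LieGroup.toContMDiffMul.toIsManifold
  have h1 := eventually_mem_chart_target (d := r) (1 : G)
  have hs : ∀ v : Vec r,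
      chartAt (Vec r) (1 : G) 1 + v ∈ (chartAt (Vec r) (1 : G)).target →
      ContMDiffAt 𝓘(ℝ, Vec r) 𝓘(ℝ, Vec r) ∞ (fun v : Vec r => (chartPt (1 : G) v)⁻¹) v :=
    fun v h1 => (contMDiffAt_chartPt h1).inv
  have h3 := (hs 0 h1.self_of_nhds).continuousAt.eventually
    ((chartAt (Vec r) (1 : G)).open_source.mem_nhds (by simp))
  filter_upwards [h1, h3] with z hz1 hz3
  refine ⟨?_, chartPt_chartVec hz3⟩
  exact contMDiffAt_iff_contDiffAt.1
    (ContMDiffAt.comp (x := z) (contMDiffAt_chartVec hz3) (hs z hz1))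

end GroupCoordinates

section GermLemmas

variable {p q : ℕ} {M : Type*} [TopologicalSpace M] [ChartedSpace (Vec p × Vec q) M]
  [IsManifold (Mdl p q) ∞ M]

/-- Germs which differ by a smooth reparametrization have the same jets. -/
theorem jet_eq_of_reparam {f g : Germ p q M} {θ : Vec p → Vec p} (hθ : ContDiffAt ℝ ∞ θ 0)
    (h0 : θ 0 = 0) (h : f.toFun =ᶠ[𝓝 0] fun y => g.toFun (θ y)) (k : ℕ) : f.jet k = g.jet k := by
  have hinj : Function.Injective (fderiv ℝ θ 0) := by
    have h1 : MDifferentiableAt 𝓘(ℝ, Vec p) 𝓘(ℝ, Vec p) θ 0 :=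
      hθ.contMDiffAt.mdifferentiableAt (by simp)
    have h2 := injective_mfderiv_of_comp (I₁ := 𝓘(ℝ, Vec p)) (I₂ := 𝓘(ℝ, Vec p)) (I₃ := Mdl p q)
      (f := θ) (u := g.toFun) (h := f.toFun) (x := 0) h0 h1 (g.smooth.mdifferentiableAt (by simp))
      h.symm f.immersive
    rwa [mfderiv_eq_fderiv] at h2
  have hbij : Function.Bijective (fderiv ℝ θ 0) :=
    ⟨hinj, LinearMap.surjective_of_injective (f := (fderiv ℝ θ 0).toLinearMap) hinj⟩
  obtain ⟨e, he⟩ := exists_equiv_of_bijective hbij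
  have hD : HasFDerivAt θ (e : Vec p →L[ℝ] Vec p) 0 := by
    rw [he]
    exact (hθ.differentiableAt (by simp)).hasFDerivAt
  have hcoe := hθ.toOpenPartialHomeomorph_coe hD (by simp)
  have hinv := hθ.to_localInverse hD (by simp)
  rw [h0] at hinv
  refine germ_jet_eq.2 ⟨h.self_of_nhds.trans (congrArg g.toFun h0),
    hθ.toOpenPartialHomeomorph θ hD (by simp),
    ⟨hθ.mem_toOpenPartialHomeomorph_source hD (by simp), by rw [hcoe, h0], by rwa [hcoe], hinv⟩, ?_⟩
  refine (isLittleO_zero _ _).congr' ?_ EventuallyEq.rfl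
  filter_upwards [h] with y hy
  rw [hcoe, hy, sub_self]

theorem jet_eq_of_eventuallyEq {f g : Germ p q M} (h : f.toFun =ᶠ[𝓝 0] g.toFun) (k : ℕ) :
    f.jet k = g.jet k :=
  jet_eq_of_reparam (θ := id) contDiffAt_id rfl h k

end GermLemmas

section ActionCoordinates

variable {r p q : ℕ} {G M : Type*} [Group G] [TopologicalSpace G] [ChartedSpace (Vec r) G]
  [LieGroup 𝓘(ℝ, Vec r) ∞ G] [TopologicalSpace M] [ChartedSpace (Vec p × Vec q) M]
  [IsManifold (Mdl p q) ∞ M]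

/-- The local action in a chart of `M` and in the preferred chart of `G` at `1`. -/
def LocalAction.moved (A : LocalAction r p q G M) (φ : SmoothChart p q M)
    (z : Vec r × (Vec p × Vec q)) : Vec p × Vec q :=
  φ.1 (A.act (chartPt (1 : G) z.1) (φ.1.symm z.2))

theorem LocalAction.moved_zero (A : LocalAction r p q G M) (φ : SmoothChart p q M)
    {w : Vec p × Vec q} (hw : w ∈ φ.1.target) : A.moved φ (0, w) = w := by
  simp [moved, A.one_act, φ.1.right_inv hw]

theorem LocalAction.eventually_moved (A : LocalAction r p q G M) (φ : SmoothChart p q M)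
    {w : Vec p × Vec q} (hw : w ∈ φ.1.target) :
    ∀ᶠ z in 𝓝 ((0 : Vec r), w), z.2 ∈ φ.1.target ∧
      (chartPt (1 : G) z.1, φ.1.symm z.2) ∈ A.domain ∧
      A.act (chartPt (1 : G) z.1) (φ.1.symm z.2) ∈ φ.1.source ∧
      ContDiffAt ℝ ∞ (A.moved φ) z := by
  have : IsManifold 𝓘(ℝ, Vec r) ∞ G := LieGroup.toContMDiffMul.toIsManifold
  have h1 : ∀ᶠ z in 𝓝 ((0 : Vec r), w), chartAt (Vec r) (1 : G) 1 + z.1 ∈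
      (chartAt (Vec r) (1 : G)).target :=
    (continuous_fst.tendsto ((0 : Vec r), w)).eventually (eventually_mem_chart_target (1 : G))
  have h2 : ∀ᶠ z in 𝓝 ((0 : Vec r), w), z.2 ∈ φ.1.target :=
    (continuous_snd.tendsto ((0 : Vec r), w)).eventually (φ.1.open_target.mem_nhds hw)
  have hs : ∀ z : Vec r × (Vec p × Vec q),
      chartAt (Vec r) (1 : G) 1 + z.1 ∈ (chartAt (Vec r) (1 : G)).target → z.2 ∈ φ.1.target →
      ContMDiffAt 𝓘(ℝ, Vec r × (Vec p × Vec q)) (𝓘(ℝ, Vec r).prod (Mdl p q)) ∞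
        (fun z : Vec r × (Vec p × Vec q) => (chartPt (1 : G) z.1, φ.1.symm z.2)) z := by
    intro z h1 h2
    have h3 : ContMDiffAt 𝓘(ℝ, Vec r × (Vec p × Vec q)) 𝓘(ℝ, Vec r) ∞
        (fun z : Vec r × (Vec p × Vec q) => chartPt (1 : G) z.1) z :=
      ContMDiffAt.comp (x := z) (g := chartPt (1 : G)) (f := Prod.fst) (contMDiffAt_chartPt h1)
        contDiffAt_fst.contMDiffAt
    have h4 : ContMDiffAt 𝓘(ℝ, Vec r × (Vec p × Vec q)) (Mdl p q) ∞
        (fun z : Vec r × (Vec p × Vec q) => φ.1.symm z.2) z :=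
      ContMDiffAt.comp (x := z) (g := φ.1.symm) (f := Prod.snd)
        (contMDiffAt_symm_of_mem_maximalAtlas φ.2 h2) contDiffAt_snd.contMDiffAt
    exact h3.prodMk h4
  have hd0 : (chartPt (1 : G) (0 : Vec r), φ.1.symm w) ∈ A.domain := by
    rw [chartPt_zero]
    exact A.one_mem _
  have h3 : ∀ᶠ z in 𝓝 ((0 : Vec r), w), (chartPt (1 : G) z.1, φ.1.symm z.2) ∈ A.domain :=
    (hs _ h1.self_of_nhds h2.self_of_nhds).continuousAt.eventually
      (A.isOpen_domain.mem_nhds hd0)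
  have ha : ∀ z : Vec r × (Vec p × Vec q),
      chartAt (Vec r) (1 : G) 1 + z.1 ∈ (chartAt (Vec r) (1 : G)).target → z.2 ∈ φ.1.target →
      (chartPt (1 : G) z.1, φ.1.symm z.2) ∈ A.domain →
      ContMDiffAt 𝓘(ℝ, Vec r × (Vec p × Vec q)) (Mdl p q) ∞
        (fun z => A.act (chartPt (1 : G) z.1) (φ.1.symm z.2)) z := fun z h1 h2 h3 =>
    ContMDiffAt.comp (x := z) (g := fun w : G × M => A.act w.1 w.2)
      (A.smooth.contMDiffAt (A.isOpen_domain.mem_nhds h3)) (hs z h1 h2)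
  have h4 : ∀ᶠ z in 𝓝 ((0 : Vec r), w),
      A.act (chartPt (1 : G) z.1) (φ.1.symm z.2) ∈ φ.1.source := by
    refine (ha _ h1.self_of_nhds h2.self_of_nhds hd0).continuousAt.eventually
      (φ.1.open_source.mem_nhds ?_)
    simp only [chartPt_zero, A.one_act]
    exact φ.1.map_target hw
  filter_upwards [h1, h2, h3, h4] with z hz1 hz2 hz3 hz4
  refine ⟨hz2, hz3, hz4, contMDiffAt_iff_contDiffAt.1 ?_⟩
  exact ContMDiffAt.comp (x := z) (contMDiffAt_of_mem_maximalAtlas φ.2 hz4) (ha z hz1 hz2 hz3)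

theorem LocalAction.actGerm_toFun (A : LocalAction r p q G M) {g : G} {f : Germ p q M}
    (h : (g, f.toFun 0) ∈ A.domain) : (A.actGerm g f).toFun = fun y => A.act g (f.toFun y) := by
  rw [actGerm, dif_pos h]

theorem LocalAction.prolong_jet (A : LocalAction r p q G M) (k : ℕ) (g : G) (f : Germ p q M) :
    A.prolong k g (f.jet k) = (A.actGerm g f).jet k := rfl

theorem LocalAction.prolong_one (A : LocalAction r p q G M) (k : ℕ) (ζ : Jet p q M k) :
    A.prolong k 1 ζ = ζ := by
  obtain ⟨f, rfl⟩ := Quotient.exists_rep ζ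
  change A.prolong k 1 (f.jet k) = f.jet k
  rw [A.prolong_jet]
  refine jet_eq_of_eventuallyEq ?_ k
  rw [A.actGerm_toFun (A.one_mem _)]
  simp only [A.one_act]
  exact EventuallyEq.rfl

theorem LocalAction.prolong_mul (A : LocalAction r p q G M) (k : ℕ) {a b : G} (f : Germ p q M)
    (hb : (b, f.toFun 0) ∈ A.domain) (ha : (a, A.act b (f.toFun 0)) ∈ A.domain)
    (hab : (a * b, f.toFun 0) ∈ A.domain) :
    A.prolong k a (A.prolong k b (f.jet k)) = A.prolong k (a * b) (f.jet k) := by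
  rw [A.prolong_jet, A.prolong_jet, A.prolong_jet]
  refine jet_eq_of_eventuallyEq ?_ k
  have hb' := A.actGerm_toFun hb
  rw [A.actGerm_toFun hab, A.actGerm_toFun (by rw [hb']; exact ha), hb']
  have hc : ∀ g : G, ContinuousAt (fun y => (g, f.toFun y)) 0 := fun g =>
    continuousAt_const.prodMk f.smooth.continuousAt
  have hc' : ContinuousAt (fun y => (a, A.act b (f.toFun y))) 0 :=
    continuousAt_const.prodMk
      ((A.contMDiffAt hb).continuousAt.comp (f := f.toFun) f.smooth.continuousAt)
  filter_upwards [(hc b).eventually (A.isOpen_domain.mem_nhds hb),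
    (hc (a * b)).eventually (A.isOpen_domain.mem_nhds hab),
    hc'.eventually (A.isOpen_domain.mem_nhds ha)] with y h1 h2 h3
  exact A.mul_act _ _ _ h1 h3 h2

theorem LocalAction.proj_prolong (A : LocalAction r p q G M) {j k : ℕ} (hjk : j ≤ k) (g : G)
    (ζ : Jet p q M k) : Jet.proj hjk (A.prolong k g ζ) = A.prolong j g (Jet.proj hjk ζ) := by
  obtain ⟨f, rfl⟩ := Quotient.exists_rep ζ
  rfl

open Classical in
/-- The prolonged action in coordinates. -/
def LocalAction.actCoord (A : LocalAction r p q G M) (φ : SmoothChart p q M) (k : ℕ)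
    (z : Vec r × JetCoord p q k) : JetCoord p q k :=
  if h : z.2 ∈ coordDomain k φ then
    Jet.coord φ (A.prolong k (chartPt (1 : G) z.1) (Jet.ofCoord φ ⟨z.2, h⟩)) else 0

variable (A : LocalAction r p q G M) (φ : SmoothChart p q M) {k : ℕ}

theorem LocalAction.eventually_actCoord {x : JetCoord p q k} (hx : x ∈ coordDomain k φ) :
    ∀ᶠ z in 𝓝 ((0 : Vec r), x), ContDiffAt ℝ ∞ (A.actCoord φ k) z ∧
      ∃ (h : z.2 ∈ coordDomain k φ) (h' : A.actCoord φ k z ∈ coordDomain k φ),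
        A.prolong k (chartPt (1 : G) z.1) (Jet.ofCoord φ ⟨z.2, h⟩) =
          Jet.ofCoord φ ⟨A.actCoord φ k z, h'⟩ := by
  set P : (Vec r × JetCoord p q k) × Vec p → Vec r × (Vec p × Vec q) :=
    fun z => (z.1.1, (z.1.2.1 + z.2, taylorPoly z.1.2.2 z.2)) with hP
  have hPs : ContDiff ℝ ∞ P := by
    have h1 : ContDiff ℝ ∞ fun z : (Vec r × JetCoord p q k) × Vec p => z.1.1 := by fun_prop
    have h2 : ContDiff ℝ ∞ fun z : (Vec r × JetCoord p q k) × Vec p => (z.1.2, z.2) := by fun_prop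
    exact ContDiff.prodMk h1 (contDiff_graphMap.comp h2)
  have hP0 : P (((0 : Vec r), x), 0) = (0, (x.1, taylorPoly x.2 0)) := by simp [hP]
  have hw : (x.1, taylorPoly x.2 0) ∈ φ.1.target := hx
  have hev : ∀ᶠ z in 𝓝 (((0 : Vec r), x), (0 : Vec p)), (P z).2 ∈ φ.1.target ∧
      (chartPt (1 : G) (P z).1, φ.1.symm (P z).2) ∈ A.domain ∧
      A.act (chartPt (1 : G) (P z).1) (φ.1.symm (P z).2) ∈ φ.1.source ∧
      ContDiffAt ℝ ∞ (A.moved φ) (P z) := by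
    have h1 := hPs.continuous.tendsto (((0 : Vec r), x), (0 : Vec p))
    rw [hP0] at h1
    exact h1.eventually (A.eventually_moved φ hw)
  obtain ⟨C, hC, hCj⟩ := exists_smooth_coord φ k (a := ((0 : Vec r), x))
    (γ := fun z => A.moved φ (P z))
    (by
      filter_upwards [hev] with z hz
      exact ContDiffAt.comp (g := A.moved φ) z hz.2.2.2 hPs.contDiffAt)
    (φ.1.map_source hev.self_of_nhds.2.2.1)
    (by
      right
      have h1 : Tendsto (fun y : Vec p => (x.1 + y, taylorPoly x.2 y)) (𝓝 0)
          (𝓝 (x.1, taylorPoly x.2 0)) := by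
        have h2 : Continuous fun y : Vec p => (x.1 + y, taylorPoly x.2 y) :=
          (continuous_const.add continuous_id).prodMk (contDiff_taylorPoly _).continuous
        simpa using h2.tendsto 0
      have h3 : (fun y => (A.moved φ (P (((0 : Vec r), x), y))).1) =ᶠ[𝓝 0]
          fun y => x.1 + y := by
        filter_upwards [h1.eventually (φ.1.open_target.mem_nhds hw)] with y hy
        rw [show P (((0 : Vec r), x), y) = (0, (x.1 + y, taylorPoly x.2 y)) from rfl,
          A.moved_zero φ hy]
      rw [h3.fderiv_eq, fderiv_const_add]
      simp only [fderiv_fun_id]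
      exact Function.bijective_id)
  have hx' : ∀ᶠ z in 𝓝 ((0 : Vec r), x), z.2 ∈ coordDomain k φ :=
    (continuous_snd.tendsto ((0 : Vec r), x)).eventually (eventually_mem_coordDomain hx)
  have hev' := ((Continuous.prodMk_left (0 : Vec p)).continuousAt
    (x := ((0 : Vec r), x))).eventually hev.eventually_nhds
  have hj : ∀ᶠ z in 𝓝 ((0 : Vec r), x), ∃ (h : z.2 ∈ coordDomain k φ)
      (h' : C z ∈ coordDomain k φ), A.prolong k (chartPt (1 : G) z.1) (Jet.ofCoord φ ⟨z.2, h⟩) =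
          Jet.ofCoord φ ⟨C z, h'⟩ := by
    filter_upwards [hCj, hx', hev'] with z hz hzd hze
    obtain ⟨hc, hz⟩ := hz
    refine ⟨hzd, hc, hz (A.actGerm (chartPt (1 : G) z.1) (graphGerm φ ⟨z.2, hzd⟩)) ?_⟩
    have hdom : (chartPt (1 : G) z.1, (graphGerm φ ⟨z.2, hzd⟩).toFun 0) ∈ A.domain :=
      hze.self_of_nhds.2.1
    rw [A.actGerm_toFun hdom]
    have h1 := (Continuous.prodMk_right z).continuousAt.eventually hze
    filter_upwards [h1] with y hy
    exact ⟨hy.2.2.1, rfl⟩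
  have he : ∀ᶠ z in 𝓝 ((0 : Vec r), x), A.actCoord φ k z = C z := by
    filter_upwards [hj] with z hz
    obtain ⟨h, h', hz⟩ := hz
    rw [actCoord, dif_pos h, hz, Jet.coord_ofCoord]
  filter_upwards [hC, hj, he.eventually_nhds] with z hz1 hz2 hz3
  refine ⟨hz1.congr_of_eventuallyEq hz3, ?_⟩
  rw [hz3.self_of_nhds]
  exact hz2

theorem LocalAction.actCoord_zero {x : JetCoord p q k} (hx : x ∈ coordDomain k φ) :
    A.actCoord φ k (0, x) = x := by
  rw [actCoord, dif_pos hx]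
  simp only [chartPt_zero, A.prolong_one]
  rw [Jet.coord_ofCoord]

theorem LocalAction.eventually_actCoord_mul {x : JetCoord p q k} (hx : x ∈ coordDomain k φ) :
    ∀ᶠ z in 𝓝 (((0 : Vec r), (0 : Vec r)), x),
      A.actCoord φ k (z.1.1, A.actCoord φ k (z.1.2, z.2)) =
        A.actCoord φ k (mulCoord G z.1, z.2) := by
  have hc2 : Tendsto (fun z : (Vec r × Vec r) × JetCoord p q k => (z.1.2, z.2))
      (𝓝 ((0, 0), x)) (𝓝 (0, x)) :=
    (by fun_prop : Continuous fun z : (Vec r × Vec r) × JetCoord p q k => (z.1.2, z.2)).tendsto _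
  have hact := A.eventually_actCoord φ hx
  have hc3 : Tendsto (fun z : (Vec r × Vec r) × JetCoord p q k =>
      (z.1.1, A.actCoord φ k (z.1.2, z.2))) (𝓝 ((0, 0), x)) (𝓝 (0, x)) := by
    refine ((by fun_prop : Continuous fun z : (Vec r × Vec r) × JetCoord p q k =>
      z.1.1).tendsto ((0, 0), x)).prodMk_nhds ?_
    have h1 := hact.self_of_nhds.1.continuousAt.tendsto
    rw [A.actCoord_zero φ hx] at h1
    exact h1.comp hc2
  have hmul := (continuous_fst.tendsto (((0 : Vec r), (0 : Vec r)), x)).eventually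
    (eventually_mulCoord (r := r) G)
  have hmc : Tendsto (fun z : (Vec r × Vec r) × JetCoord p q k => (mulCoord G z.1, z.2))
      (𝓝 ((0, 0), x)) (𝓝 (0, x)) := by
    have h1 : Tendsto (mulCoord G) (𝓝 ((0 : Vec r), (0 : Vec r))) (𝓝 0) := by
      have := (eventually_mulCoord (r := r) G).self_of_nhds.1.continuousAt.tendsto
      rwa [mulCoord_zero] at this
    exact (h1.comp (continuous_fst.tendsto _)).prodMk_nhds (continuous_snd.tendsto _)
  have hbase : Tendsto (fun z : Vec r × JetCoord p q k => (z.1, (z.2.1, taylorPoly z.2.2 0)))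
      (𝓝 (0, x)) (𝓝 (0, (x.1, taylorPoly x.2 0))) := by
    have h1 : Continuous fun z : Vec r × JetCoord p q k => (z.1, (z.2.1, taylorPoly z.2.2 0)) := by
      simp only [taylorPoly_zero]
      fun_prop
    exact h1.tendsto (0, x)
  have hm := hbase.eventually (A.eventually_moved φ (w := (x.1, taylorPoly x.2 0)) hx)
  filter_upwards [hc2.eventually hact, hc3.eventually hact, hmul, hmc.eventually hact,
    hc2.eventually hm, hc3.eventually hm, hmc.eventually hm] with z h1 h2 h3 h4 h5 h6 h7
  obtain ⟨-, hd1, hd1', e1⟩ := h1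
  obtain ⟨-, hd2, hd2', e2⟩ := h2
  obtain ⟨-, hd4, hd4', e4⟩ := h4
  rw [h3.2] at e4
  have hbt : A.act (chartPt (1 : G) z.1.2) ((graphGerm φ ⟨z.2, hd1⟩).toFun 0) =
      (graphGerm φ ⟨A.actCoord φ k (z.1.2, z.2), hd1'⟩).toFun 0 := by
    have h8 : (A.actGerm (chartPt (1 : G) z.1.2) (graphGerm φ ⟨z.2, hd1⟩)).jet k =
      (graphGerm φ ⟨A.actCoord φ k (z.1.2, z.2), hd1'⟩).jet k := e1
    have h9 := (germ_jet_eq.1 h8).1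
    rw [A.actGerm_toFun (by rw [graphGerm_zero]; exact h5.2.1)] at h9
    exact h9
  have key := A.prolong_mul k (a := chartPt (1 : G) z.1.1) (b := chartPt (1 : G) z.1.2)
    (graphGerm φ ⟨z.2, hd1⟩) (by rw [graphGerm_zero]; exact h5.2.1)
    (by rw [hbt, graphGerm_zero]; exact h6.2.1)
    (by rw [← h3.2, graphGerm_zero]; exact h7.2.1)
  change A.prolong k _ (A.prolong k _ (Jet.ofCoord φ ⟨z.2, hd1⟩)) =
    A.prolong k _ (Jet.ofCoord φ ⟨z.2, hd1⟩) at key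
  rw [e1, e2, e4] at key
  exact congrArg Subtype.val (Jet.ofCoord_injective φ key)

theorem LocalAction.eventually_truncCoord_actCoord {j : ℕ} (hjk : j ≤ k) {x : JetCoord p q k}
    (hx : x ∈ coordDomain k φ) :
    ∀ᶠ z in 𝓝 ((0 : Vec r), x), truncCoord p q hjk (A.actCoord φ k z) =
      A.actCoord φ j (z.1, truncCoord p q hjk z.2) := by
  filter_upwards [A.eventually_actCoord φ hx] with z hz
  obtain ⟨-, h, h', e⟩ := hz
  have h2 := congrArg (Jet.proj hjk) e
  rw [A.proj_prolong, Jet.proj_ofCoord, Jet.proj_ofCoord] at h2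
  rw [actCoord.eq_1 A φ j, dif_pos ((truncCoord_mem_iff hjk).2 h), h2, Jet.coord_ofCoord]

end ActionCoordinates

section OrbitDim

variable {r p q k : ℕ} {G M : Type*} [Group G] [TopologicalSpace G] [ChartedSpace (Vec r) G]
  [LieGroup 𝓘(ℝ, Vec r) ∞ G] [TopologicalSpace M] [ChartedSpace (Vec p × Vec q) M]
  [IsManifold (Mdl p q) ∞ M]

theorem finrank_span_comp {V W : Type*} [NormedAddCommGroup V] [NormedSpace ℝ V]
    [FiniteDimensional ℝ V] [NormedAddCommGroup W] [NormedSpace ℝ W] [FiniteDimensional ℝ W]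
    (L : V →L[ℝ] W) :
    Module.finrank ℝ (Submodule.span ℝ {η : V →L[ℝ] ℝ | ∃ l : W →L[ℝ] ℝ, η = l.comp L}) =
      Module.finrank ℝ (LinearMap.range L.toLinearMap) := by
  rw [← LinearMap.finrank_range_dualMap_eq_finrank_range]
  set e : (V →L[ℝ] ℝ) ≃ₗ[ℝ] (V →ₗ[ℝ] ℝ) := LinearMap.toContinuousLinearMap.symm with he
  have h1 : {η : V →L[ℝ] ℝ | ∃ l : W →L[ℝ] ℝ, η = l.comp L} =
      ((LinearMap.range L.toLinearMap.dualMap).comap e.toLinearMap : Submodule ℝ (V →L[ℝ] ℝ)) := by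
    ext η
    change (∃ l : W →L[ℝ] ℝ, η = l.comp L) ↔ e η ∈ LinearMap.range L.toLinearMap.dualMap
    constructor
    · rintro ⟨l, rfl⟩
      exact ⟨l.toLinearMap, rfl⟩
    · rintro ⟨l, hl⟩
      refine ⟨LinearMap.toContinuousLinearMap l, ?_⟩
      ext v
      exact (LinearMap.congr_fun hl v).symm
  rw [h1, Submodule.span_eq, Submodule.comap_equiv_eq_map_symm]
  exact LinearEquiv.finrank_map_eq e.symm _

variable (A : LocalAction r p q G M) (φ : SmoothChart p q M)

theorem orbitDim_ofCoord (c : coordDomain k φ) :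
    orbitDim A (Jet.ofCoord φ c) = Module.finrank ℝ (LinearMap.range
      (fderiv ℝ (fun v : Vec r => A.actCoord φ k (v, c.1)) 0).toLinearMap) := by
  have : IsManifold 𝓘(ℝ, Vec r) ∞ G := LieGroup.toContMDiffMul.toIsManifold
  have hact := A.eventually_actCoord φ c.2
  have hc : Tendsto (fun v : Vec r => (v, c.1)) (𝓝 0) (𝓝 (0, c.1)) :=
    (Continuous.prodMk_left c.1).tendsto 0
  have hL : DifferentiableAt ℝ (fun v : Vec r => A.actCoord φ k (v, c.1)) 0 := by
    have h1 : ContDiffAt ℝ ∞ (fun v : Vec r => A.actCoord φ k (v, c.1)) 0 :=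
      ContDiffAt.comp (g := A.actCoord φ k) _ hact.self_of_nhds.1
        (contDiffAt_id.prodMk contDiffAt_const)
    exact h1.differentiableAt (by simp)
  have h0 := A.actCoord_zero φ c.2
  have key : ∀ F : Jet p q M k → ℝ, (∀ᶠ ζ' in 𝓝 (Jet.ofCoord φ c), SmoothAtJet F ζ') →
      (mfderiv 𝓘(ℝ, Vec r) 𝓘(ℝ, ℝ) (fun g : G => F (A.prolong k g (Jet.ofCoord φ c))) 1 :
        Vec r →L[ℝ] ℝ) =
      (fderiv ℝ (inCoord φ F) c.1).comp
        (fderiv ℝ (fun v : Vec r => A.actCoord φ k (v, c.1)) 0) := by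
    intro F hF
    have hs := ((eventually_smoothAtJet_iff φ c F).1 hF).self_of_nhds
    have h1 : HasFDerivAt (inCoord φ F) (fderiv ℝ (inCoord φ F) c.1)
        (A.actCoord φ k (0, c.1)) := by
      rw [h0]
      exact (hs.differentiableAt (by simp)).hasFDerivAt
    have h2 : HasFDerivAt (fun v : Vec r => F (A.prolong k (chartPt (1 : G) v) (Jet.ofCoord φ c)))
        ((fderiv ℝ (inCoord φ F) c.1).comp
        (fderiv ℝ (fun v : Vec r => A.actCoord φ k (v, c.1)) 0)) 0 := by
      refine (HasFDerivAt.comp (0 : Vec r) h1 hL.hasFDerivAt).congr_of_eventuallyEq ?_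
      filter_upwards [hc.eventually hact] with v hv
      obtain ⟨-, h, h', e⟩ := hv
      rw [Function.comp, inCoord_of_mem φ F h', ← e]
    rw [← h2.fderiv]
    exact mfderiv_eq_fderiv_chartPt
      (f := fun g : G => F (A.prolong k g (Jet.ofCoord φ c))) h2.differentiableAt
  rw [← finrank_span_comp]
  suffices hset : {η : Vec r →L[ℝ] ℝ | ∃ F : Jet p q M k → ℝ,
      (∀ᶠ ζ' in 𝓝 (Jet.ofCoord φ c), SmoothAtJet F ζ') ∧
      η = mfderiv 𝓘(ℝ, Vec r) 𝓘(ℝ, ℝ) (fun g : G => F (A.prolong k g (Jet.ofCoord φ c))) 1} =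
      {η : Vec r →L[ℝ] ℝ | ∃ l : JetCoord p q k →L[ℝ] ℝ,
        η = l.comp (fderiv ℝ (fun v : Vec r => A.actCoord φ k (v, c.1)) 0)} by
    exact congrArg (fun s : Set (Vec r →L[ℝ] ℝ) => Module.finrank ℝ (Submodule.span ℝ s)) hset
  refine Set.ext fun η => ⟨?_, ?_⟩
  · rintro ⟨F, hF, rfl⟩
    exact ⟨_, key F hF⟩
  · rintro ⟨l, rfl⟩
    have he : ∀ x ∈ coordDomain k φ, inCoord φ (fun ζ => l (Jet.coord φ ζ)) =ᶠ[𝓝 x] l := by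
      intro x hx
      filter_upwards [eventually_mem_coordDomain hx] with y hy
      rw [inCoord_of_mem φ _ hy, Jet.coord_ofCoord]
    have hF : ∀ᶠ ζ' in 𝓝 (Jet.ofCoord φ c), SmoothAtJet (fun ζ => l (Jet.coord φ ζ)) ζ' := by
      rw [eventually_smoothAtJet_iff]
      filter_upwards [eventually_mem_coordDomain c.2] with x hx
      exact l.contDiff.contDiffAt.congr_of_eventuallyEq (he x hx)
    refine ⟨fun ζ => l (Jet.coord φ ζ), hF, ?_⟩
    refine Eq.trans ?_ (key _ hF).symm
    rw [(he c.1 c.2).fderiv_eq, l.fderiv]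

end OrbitDim

section Horizontal

variable {p q k : ℕ}

/-- The horizontal lift at a `(k+1)`-jet: the total derivatives of the coordinates on `J^k`. -/
def horizontal (c : JetCoord p q (k + 1)) : Vec p →L[ℝ] JetCoord p q k :=
  (ContinuousLinearMap.id ℝ (Vec p)).prod
    (∑ i, (EuclideanSpace.proj i : Vec p →L[ℝ] ℝ).smulRight (shift i c.2))

theorem horizontal_apply (c : JetCoord p q (k + 1)) (z : Vec p) :
    horizontal c z = (z, ∑ i, z i • shift i c.2) := by
  simp [horizontal]

theorem truncCoord_horizontal {j k : ℕ} (hjk : j ≤ k) (c : JetCoord p q (k + 1)) (z : Vec p) :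
    truncCoord p q hjk (horizontal c z) =
      horizontal (truncCoord p q (Nat.succ_le_succ hjk) c) z := by
  rw [horizontal_apply, horizontal_apply, truncCoord_apply]
  refine Prod.ext rfl ?_
  funext J
  simp only [truncCoeff, Finset.sum_apply, Pi.smul_apply]
  rfl

variable {M : Type*} [TopologicalSpace M] [ChartedSpace (Vec p × Vec q) M]
  [IsManifold (Mdl p q) ∞ M]

/-- The jet of a germ which is the graph of `h` in the chart `φ`. -/
theorem jet_eq_ofCoord_jetOf (φ : SmoothChart p q M) (k : ℕ) (f : Germ p q M) {a : Vec p → Vec p}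
    {h : Vec p → Vec q} (hh : ContDiffAt ℝ ∞ h (a 0)) (hb : Function.Bijective (fderiv ℝ a 0))
    (hf : ∀ᶠ y in 𝓝 0, f.toFun y ∈ φ.1.source ∧ φ.1 (f.toFun y) = (a y, h (a y))) :
    ∃ hc : (a 0, jetOf (stdVec p) k h (a 0)) ∈ coordDomain k φ,
      f.jet k = Jet.ofCoord φ ⟨_, hc⟩ := by
  have hf0 := hf.self_of_nhds
  have hfe : (fun y => (φ.1 (f.toFun y)).1) =ᶠ[𝓝 0] a := by
    filter_upwards [hf] with y hy
    rw [hy.2]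
  have hc : (a 0, jetOf (stdVec p) k h (a 0)) ∈ coordDomain k φ := by
    change (_, taylorPoly _ 0) ∈ φ.1.target
    rw [taylorPoly_zero]
    change (a 0, jetOf (stdVec p) k h (a 0) MIdx.zero) ∈ φ.1.target
    rw [jetOf_zero, ← hf0.2]
    exact φ.1.map_source hf0.1
  refine ⟨hc, jet_eq_ofCoord φ f ⟨_, hc⟩ hf0.1 (by rw [hf0.2]) ?_ (Or.inr ?_)⟩
  · have hT := taylor_isLittleO (ContinuousLinearMap.id ℝ (Vec p)) k (contDiffAt_infty.1 hh k)
    have ha1 : ContDiffAt ℝ ∞ (fun y => (φ.1 (f.toFun y)).1 - a 0) 0 :=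
      (contDiffAt_fst.comp 0 (contDiffAt_chart_germ φ f hf0.1)).sub contDiffAt_const
    have ha0 : (φ.1 (f.toFun 0)).1 - a 0 = 0 := by rw [hf0.2, sub_self]
    have ha2 : Tendsto (fun y => (φ.1 (f.toFun y)).1 - a 0) (𝓝 0) (𝓝 0) := by
      have := ha1.continuousAt.tendsto
      rwa [ha0] at this
    have ha3 : (fun y => ‖(φ.1 (f.toFun y)).1 - a 0‖ ^ k) =O[𝓝 0] fun y => ‖y‖ ^ k := by
      have h1 := (ha1.differentiableAt (by simp)).isBigO_sub
      simp only [ha0, sub_zero] at h1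
      exact h1.norm_norm.pow k
    refine ((hT.comp_tendsto ha2).trans_isBigO ha3).congr' ?_ EventuallyEq.rfl
    filter_upwards [hf] with y hy
    simp only [Function.comp, hy.2]
    simp
  · rw [hfe.fderiv_eq]
    exact hb

/-- The derivative of the prolongation of a fixed submanifold, along the submanifold. -/
theorem hasFDerivAt_coord_of_curve (φ : SmoothChart p q M) {γ : Vec p → Vec p × Vec q} {s : Vec p}
    (hγ : ∀ᶠ σ in 𝓝 s, ContDiffAt ℝ ∞ γ σ)
    (hb : Function.Bijective (fderiv ℝ (fun σ => (γ σ).1) s))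
    {C : Vec p → JetCoord p q k} {C' : Vec p → JetCoord p q (k + 1)}
    (h : ∀ᶠ σ in 𝓝 s, ∃ (f : Germ p q M) (hc : C σ ∈ coordDomain k φ)
      (hc' : C' σ ∈ coordDomain (k + 1) φ),
      (∀ᶠ y in 𝓝 0, f.toFun y ∈ φ.1.source ∧ φ.1 (f.toFun y) = γ (σ + y)) ∧
      f.jet k = Jet.ofCoord φ ⟨C σ, hc⟩ ∧ f.jet (k + 1) = Jet.ofCoord φ ⟨C' σ, hc'⟩) :
    HasFDerivAt C ((horizontal (C' s)).comp (fderiv ℝ (fun σ => (γ σ).1) s)) s := by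
  set a : Vec p → Vec p := fun σ => (γ σ).1 with ha
  have has : ∀ᶠ σ in 𝓝 s, ContDiffAt ℝ ∞ a σ := by
    filter_upwards [hγ] with σ hσ
    exact contDiffAt_fst.comp σ hσ
  obtain ⟨P, hP, hmem, hPs⟩ := exists_smooth_localInverse has hb
  set g : Vec p → Vec q := fun x => (γ (P.symm x)).2 with hg
  have hPm : ∀ᶠ σ in 𝓝 s, σ ∈ P.source := P.open_source.mem_nhds hmem
  have hinv : ∀ σ ∈ P.source, P.symm (a σ) = σ := by
    intro σ hσ
    rw [← hP]
    exact P.left_inv hσ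
  have hgs : ∀ σ ∈ P.source, ContDiffAt ℝ ∞ γ σ → ContDiffAt ℝ ∞ g (a σ) := by
    intro σ hσ h1
    have h2 : ContDiffAt ℝ ∞ (fun x => γ (P.symm x)) (a σ) :=
      ContDiffAt.comp _ (by rw [hinv σ hσ]; exact h1) (hPs σ hσ).2.1
    exact contDiffAt_snd.comp _ h2
  have key : ∀ᶠ σ in 𝓝 s, C σ = (a σ, jetOf (stdVec p) k g (a σ)) ∧
      C' σ = (a σ, jetOf (stdVec p) (k + 1) g (a σ)) := by
    filter_upwards [h, hγ, hPm] with σ hσ hγσ hσP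
    obtain ⟨f, hc, hc', hf, e, e'⟩ := hσ
    have ht : Tendsto (fun y => σ + y) (𝓝 0) (𝓝 σ) := by
      have : Continuous fun y => σ + y := by fun_prop
      simpa using this.tendsto 0
    have hf' : ∀ᶠ y in 𝓝 0, f.toFun y ∈ φ.1.source ∧
        φ.1 (f.toFun y) = (a (σ + y), g (a (σ + y))) := by
      filter_upwards [hf, ht.eventually (P.open_source.mem_nhds hσP)] with y hy hyP
      refine ⟨hy.1, ?_⟩
      rw [hy.2, hg]
      simp only [hinv _ hyP]
      rfl
    have h1 : ContDiffAt ℝ ∞ g (a (σ + 0)) := by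
      rw [add_zero]
      exact hgs σ hσP hγσ
    have h2 : Function.Bijective (fderiv ℝ (fun y => a (σ + y)) 0) := by
      rw [fderiv_comp_add_left, add_zero]
      exact (hPs σ hσP).2.2
    obtain ⟨hd, e1⟩ := jet_eq_ofCoord_jetOf φ k f (a := fun y => a (σ + y)) h1 h2 hf'
    obtain ⟨hd', e2⟩ := jet_eq_ofCoord_jetOf φ (k + 1) f (a := fun y => a (σ + y)) h1 h2 hf'
    rw [e1] at e
    rw [e2] at e'
    have e3 := congrArg Subtype.val (Jet.ofCoord_injective φ e)
    have e4 := congrArg Subtype.val (Jet.ofCoord_injective φ e')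
    simp only [add_zero] at e3 e4
    exact ⟨e3.symm, e4.symm⟩
  have hgs0 := hgs s hmem hγ.self_of_nhds
  have hj : HasFDerivAt (jetOf (stdVec p) k g) (fderiv ℝ (jetOf (stdVec p) k g) (a s)) (a s) :=
    ((contDiffAt_jetOf _ k hgs0).differentiableAt (by simp)).hasFDerivAt
  have had : HasFDerivAt a (fderiv ℝ a s) s :=
    (has.self_of_nhds.differentiableAt (by simp)).hasFDerivAt
  have h1 := (had.prodMk (HasFDerivAt.comp s hj had)).congr_of_eventuallyEq
    (key.mono fun σ hσ => hσ.1)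
  refine h1.congr_fderiv (ContinuousLinearMap.ext fun v => ?_)
  symm
  rw [ContinuousLinearMap.comp_apply, horizontal_apply, key.self_of_nhds.2]
  refine Prod.ext rfl ?_
  simp only [ContinuousLinearMap.prod_apply, ContinuousLinearMap.comp_apply]
  conv_rhs => rw [vec_eq_sum (fderiv ℝ a s v)]
  rw [map_sum]
  simp only [map_smul]
  refine Finset.sum_congr rfl fun i _ => ?_
  rw [fderiv_jetOf _ k i hgs0]

end Horizontal

section TransverseChart

variable {p q : ℕ} {M : Type*} [TopologicalSpace M] [ChartedSpace (Vec p × Vec q) M]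
  [IsManifold (Mdl p q) ∞ M]

theorem injective_fderiv_chart_germ (φ : SmoothChart p q M) (f : Germ p q M)
    (hf : f.toFun 0 ∈ φ.1.source) :
    Function.Injective (fderiv ℝ (fun y => φ.1 (f.toFun y)) 0) := by
  have h1 := contDiffAt_chart_germ φ f hf
  have h2 : MDifferentiableAt (Mdl p q) (Mdl p q) φ.1.symm (φ.1 (f.toFun 0)) :=
    (contMDiffAt_symm_of_mem_maximalAtlas φ.2 (φ.1.map_source hf)).mdifferentiableAt (by simp)
  have h3 := injective_mfderiv_of_comp (I₁ := 𝓘(ℝ, Vec p)) (I₂ := Mdl p q) (I₃ := Mdl p q)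
    (f := fun y => φ.1 (f.toFun y)) (u := φ.1.symm) (h := f.toFun) (x := 0) rfl
    (h1.contMDiffAt.mdifferentiableAt (by simp)) h2
    (by
      filter_upwards [f.smooth.continuousAt.eventually (φ.1.open_source.mem_nhds hf)] with y hy
      exact φ.1.left_inv hy) f.immersive
  rwa [mfderiv_eq_fderiv] at h3

theorem exists_equiv_fst_comp (T : Vec p →L[ℝ] Vec p × Vec q) (hT : Function.Injective T) :
    ∃ L : (Vec p × Vec q) ≃L[ℝ] (Vec p × Vec q), ∀ y, (L (T y)).1 = y := by
  obtain ⟨g, hg⟩ := LinearMap.exists_leftInverse_of_injective T.toLinearMap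
    (LinearMap.ker_eq_bot.2 hT)
  have hg' : ∀ y, g (T y) = y := fun y => LinearMap.congr_fun hg y
  have hr : LinearMap.range g = ⊤ := LinearMap.range_eq_top.2 fun y => ⟨T y, hg' y⟩
  have hk : Module.finrank ℝ (LinearMap.ker g) = Module.finrank ℝ (Vec q) := by
    have h1 := LinearMap.finrank_range_add_finrank_ker g
    rw [hr, finrank_top, Module.finrank_prod] at h1
    omega
  let e : LinearMap.ker g ≃ₗ[ℝ] Vec q := LinearEquiv.ofFinrankEq _ _ hk
  let π : Vec p × Vec q →ₗ[ℝ] LinearMap.ker g :=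
    (LinearMap.id - T.toLinearMap.comp g).codRestrict (LinearMap.ker g) fun w => by
      simp [hg']
  let L : Vec p × Vec q →ₗ[ℝ] Vec p × Vec q := g.prod (e.toLinearMap.comp π)
  have hL : Function.Injective L := by
    rw [← LinearMap.ker_eq_bot, LinearMap.ker_eq_bot']
    intro w hw
    obtain ⟨h1, h2⟩ := Prod.ext_iff.1 hw
    have h1' : g w = 0 := h1
    have h3 : π w = 0 := e.map_eq_zero_iff.1 h2
    have h4 : w - T (g w) = 0 := congrArg Subtype.val h3
    simpa [h1'] using h4
  refine ⟨(LinearEquiv.ofInjectiveEndo L hL).toContinuousLinearEquiv, fun y => hg' y⟩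

/-- A linear change of the values of a chart. -/
def SmoothChart.transLinear (φ : SmoothChart p q M) (L : (Vec p × Vec q) ≃L[ℝ] (Vec p × Vec q)) :
    SmoothChart p q M :=
  ⟨φ.1.transHomeomorph L.toHomeomorph, by
    refine OpenPartialHomeomorph.mem_maximalAtlas_of_contMDiffOn _ ?_ ?_
    · have h1 := contMDiffOn_of_mem_maximalAtlas φ.2
      exact L.contDiff.contMDiff.comp_contMDiffOn h1
    · have h1 := contMDiffOn_symm_of_mem_maximalAtlas φ.2
      exact h1.comp L.symm.contDiff.contMDiff.contMDiffOn fun x hx => hx⟩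

theorem exists_transverse_chart (f : Germ p q M) : ∃ φ : SmoothChart p q M,
    f.toFun 0 ∈ φ.1.source ∧ Function.Bijective (fderiv ℝ (fun y => (φ.1 (f.toFun y)).1) 0) := by
  set e := smoothChartAt p q (f.toFun 0) with he
  have hf : f.toFun 0 ∈ e.1.source := mem_chart_source _ _
  obtain ⟨L, hL⟩ := exists_equiv_fst_comp _ (injective_fderiv_chart_germ e f hf)
  refine ⟨e.transLinear L, hf, ?_⟩
  have h1 : HasFDerivAt (fun y => e.1 (f.toFun y)) _ 0 :=
    ((contDiffAt_chart_germ e f hf).differentiableAt (by simp)).hasFDerivAt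
  have h2 : HasFDerivAt (fun y => (L (e.1 (f.toFun y))).1) (ContinuousLinearMap.id ℝ (Vec p)) 0 := by
    have h3 := ((ContinuousLinearMap.fst ℝ (Vec p) (Vec q)).comp
      (L : (Vec p × Vec q) →L[ℝ] (Vec p × Vec q))).hasFDerivAt.comp (0 : Vec p) h1
    refine h3.congr_fderiv (ContinuousLinearMap.ext fun y => ?_)
    exact hL y
  have h4 : fderiv ℝ (fun y => ((e.transLinear L).1 (f.toFun y)).1) 0
    = ContinuousLinearMap.id ℝ (Vec p) := h2.fderiv
  rw [h4]
  exact Function.bijective_id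

end TransverseChart

section Prolongation

variable {r p q : ℕ} {G M S : Type*} [Group G] [TopologicalSpace G] [ChartedSpace (Vec r) G]
  [LieGroup 𝓘(ℝ, Vec r) ∞ G] [TopologicalSpace M] [ChartedSpace (Vec p × Vec q) M]
  [IsManifold (Mdl p q) ∞ M] [TopologicalSpace S] [ChartedSpace (Vec p) S]
  [IsManifold 𝓘(ℝ, Vec p) ∞ S] {ι : S → M}

theorem injective_mfderiv_chartPt {s : S} {σ : Vec p}
    (hσ : chartAt (Vec p) s s + σ ∈ (chartAt (Vec p) s).target) :
    Function.Injective (mfderiv 𝓘(ℝ, Vec p) 𝓘(ℝ, Vec p) (fun y : Vec p => chartPt s (σ + y)) 0) := by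
  have h0 : chartAt (Vec p) s s + (σ + 0) ∈ (chartAt (Vec p) s).target := by rwa [add_zero]
  have hc : Tendsto (fun y : Vec p => chartAt (Vec p) s s + (σ + y)) (𝓝 0)
      (𝓝 (chartAt (Vec p) s s + (σ + 0))) :=
    (by fun_prop : Continuous fun y : Vec p => chartAt (Vec p) s s + (σ + y)).tendsto 0
  have h1 : ContMDiffAt 𝓘(ℝ, Vec p) 𝓘(ℝ, Vec p) ∞ (fun y : Vec p => chartPt s (σ + y)) 0 := by
    have h2 : ContDiffAt ℝ ∞ (fun y : Vec p => σ + y) 0 := contDiffAt_const.add contDiffAt_id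
    exact ContMDiffAt.comp (x := (0 : Vec p)) (g := chartPt s) (contMDiffAt_chartPt h0)
      h2.contMDiffAt
  refine injective_mfderiv_of_comp (I₃ := 𝓘(ℝ, Vec p))
    (u := fun z => chartVec s z - σ) (h := id) rfl (h1.mdifferentiableAt (by simp)) ?_ ?_ ?_
  · have h3 : chartPt s (σ + 0) ∈ (chartAt (Vec p) s).source := (chartAt (Vec p) s).map_target h0
    have h4 : ContDiffAt ℝ ∞ (fun v : Vec p => v - σ) (chartVec s (chartPt s (σ + 0))) :=
      contDiffAt_id.sub contDiffAt_const
    exact (ContMDiffAt.comp (x := chartPt s (σ + 0)) (g := fun v : Vec p => v - σ)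
      h4.contMDiffAt (contMDiffAt_chartVec h3)).mdifferentiableAt (by simp)
  · filter_upwards [hc.eventually ((chartAt (Vec p) s).open_target.mem_nhds h0)] with y hy
    simp [Function.comp, chartVec_chartPt hy]
  · rw [mfderiv_id]
    exact Function.injective_id

/-- The germ of `S` at the point with coordinates `σ` in the preferred chart at `s`, parametrized
by this chart. -/
def chartGerm (hι : IsSmoothImmersion p q ι) (s : S) (σ : Vec p)
    (hσ : chartAt (Vec p) s s + σ ∈ (chartAt (Vec p) s).target) : Germ p q M where
  toFun y := ι (chartPt s (σ + y))
  smooth := by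
    have h0 : chartAt (Vec p) s s + (σ + 0) ∈ (chartAt (Vec p) s).target := by rwa [add_zero]
    have h2 : ContDiffAt ℝ ∞ (fun y : Vec p => σ + y) 0 := contDiffAt_const.add contDiffAt_id
    have h3 := ContMDiffAt.comp (x := (0 : Vec p)) (g := chartPt s) (contMDiffAt_chartPt h0)
      h2.contMDiffAt
    exact ContMDiffAt.comp (x := (0 : Vec p)) hι.1.contMDiffAt h3
  immersive := by
    have h0 : chartAt (Vec p) s s + (σ + 0) ∈ (chartAt (Vec p) s).target := by rwa [add_zero]
    have h2 : ContDiffAt ℝ ∞ (fun y : Vec p => σ + y) 0 := contDiffAt_const.add contDiffAt_id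
    have h3 := ContMDiffAt.comp (x := (0 : Vec p)) (g := chartPt s) (contMDiffAt_chartPt h0)
      h2.contMDiffAt
    have h8 : mfderiv 𝓘(ℝ, Vec p) (Mdl p q) (ι ∘ fun y : Vec p => chartPt s (σ + y)) 0 = _ :=
      mfderiv_comp (0 : Vec p) ((hι.1 (chartPt s (σ + 0))).mdifferentiableAt (by simp))
        (h3.mdifferentiableAt (by simp))
    change Function.Injective
      (mfderiv 𝓘(ℝ, Vec p) (Mdl p q) (ι ∘ fun y : Vec p => chartPt s (σ + y)) 0)
    rw [h8]
    exact (hι.2 _).comp (injective_mfderiv_chartPt hσ)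

theorem chartGerm_jet (hι : IsSmoothImmersion p q ι) (k : ℕ) (s : S) (σ : Vec p)
    (hσ : chartAt (Vec p) s s + σ ∈ (chartAt (Vec p) s).target) :
    (chartGerm (M := M) hι s σ hσ).jet k = prolongSubmanifold k hι (chartPt s σ) := by
  have h0 : chartAt (Vec p) s s + (σ + 0) ∈ (chartAt (Vec p) s).target := by rwa [add_zero]
  have h2 : ContDiffAt ℝ ∞ (fun y : Vec p => σ + y) 0 := contDiffAt_const.add contDiffAt_id
  have h3 : ContMDiffAt 𝓘(ℝ, Vec p) 𝓘(ℝ, Vec p) ∞ (fun y : Vec p => chartPt s (σ + y)) 0 :=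
    ContMDiffAt.comp (x := (0 : Vec p)) (g := chartPt s) (contMDiffAt_chartPt h0) h2.contMDiffAt
  have hmem : chartPt s (σ + 0) ∈ (chartAt (Vec p) (chartPt s σ)).source := by
    rw [add_zero]
    exact mem_chart_source _ _
  refine jet_eq_of_reparam (θ := fun y => chartVec (chartPt s σ) (chartPt s (σ + y))) ?_ ?_ ?_ k
  · exact contMDiffAt_iff_contDiffAt.1
      (ContMDiffAt.comp (x := (0 : Vec p)) (g := chartVec (chartPt s σ))
        (contMDiffAt_chartVec hmem) h3)
  · simp
  · filter_upwards [h3.continuousAt.eventually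
      ((chartAt (Vec p) (chartPt s σ)).open_source.mem_nhds hmem)] with y hy
    exact (congrArg ι (chartPt_chartVec hy)).symm

/-- The prolongation of `S` in coordinates. -/
def prolongCoord (hι : IsSmoothImmersion p q ι) (φ : SmoothChart p q M) (k : ℕ) (s : S) (σ : Vec p) : JetCoord p q k :=
  Jet.coord φ (prolongSubmanifold k hι (chartPt s σ))

/-- The chart `φ` is transverse to `S` at `s`. -/
def IsTransverse (φ : SmoothChart p q M) (ι : S → M) (s : S) : Prop :=
  ι s ∈ φ.1.source ∧ Function.Bijective (fderiv ℝ (fun y => (φ.1 (ι (chartPt s y))).1) (0 : Vec p))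

theorem exists_isTransverse (hι : IsSmoothImmersion p q ι) (s : S) : ∃ φ : SmoothChart p q M, IsTransverse φ ι s := by
  obtain ⟨φ, h1, h2⟩ := exists_transverse_chart (submanifoldGerm hι s)
  refine ⟨φ, ?_, h2⟩
  have h3 : (submanifoldGerm hι s).toFun 0 = ι s := congrArg ι (chartPt_zero s)
  rwa [h3] at h1

variable {φ : SmoothChart p q M} {s : S}

theorem eventually_contDiffAt_chart_chartPt (hι : IsSmoothImmersion p q ι) (hφ : ι s ∈ φ.1.source) :
    ∀ᶠ σ in 𝓝 (0 : Vec p), chartAt (Vec p) s s + σ ∈ (chartAt (Vec p) s).target ∧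
      ι (chartPt s σ) ∈ φ.1.source ∧ ContDiffAt ℝ ∞ (fun σ => φ.1 (ι (chartPt s σ))) σ := by
  have h1 : ∀ᶠ σ in 𝓝 (0 : Vec p), ι (chartPt s σ) ∈ φ.1.source :=
    (hι.1.continuous.continuousAt.comp (continuousAt_chartPt_zero s)).eventually
      (φ.1.open_source.mem_nhds (by simpa using hφ))
  filter_upwards [eventually_mem_chart_target s, h1] with σ h2 h3
  refine ⟨h2, h3, contMDiffAt_iff_contDiffAt.1 ?_⟩
  have h4 : ContMDiffAt 𝓘(ℝ, Vec p) (Mdl p q) ∞ (fun σ => ι (chartPt s σ)) σ :=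
    ContMDiffAt.comp (x := σ) hι.1.contMDiffAt (contMDiffAt_chartPt h2)
  exact ContMDiffAt.comp (x := σ) (contMDiffAt_of_mem_maximalAtlas φ.2 h3) h4

theorem eventually_prolongCoord (hι : IsSmoothImmersion p q ι) (hφ : IsTransverse φ ι s) (k : ℕ) :
    ∀ᶠ σ in 𝓝 (0 : Vec p), ContDiffAt ℝ ∞ (prolongCoord hι φ k s) σ ∧
      ∃ h : prolongCoord hι φ k s σ ∈ coordDomain k φ,
        prolongSubmanifold k hι (chartPt s σ) = Jet.ofCoord φ ⟨prolongCoord hι φ k s σ, h⟩ := by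
  have hev := eventually_contDiffAt_chart_chartPt hι hφ.1
  have hc : Continuous fun z : Vec p × Vec p => z.1 + z.2 := by fun_prop
  have hc0 := hc.tendsto ((0 : Vec p), (0 : Vec p))
  simp only [add_zero] at hc0
  obtain ⟨C, hC, hCj⟩ := exists_smooth_coord φ k (a := (0 : Vec p))
    (γ := fun z => φ.1 (ι (chartPt s (z.1 + z.2))))
    (by
      filter_upwards [hc0.eventually hev] with z hz
      exact ContDiffAt.comp (g := fun σ => φ.1 (ι (chartPt s σ))) z hz.2.2
        (contDiffAt_fst.add contDiffAt_snd))
    (by simpa using φ.1.map_source hφ.1)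
    (by
      right
      simpa only [zero_add] using hφ.2)
  have hj : ∀ᶠ σ in 𝓝 (0 : Vec p), ∃ h : C σ ∈ coordDomain k φ,
      prolongSubmanifold k hι (chartPt s σ) = Jet.ofCoord φ ⟨C σ, h⟩ := by
    filter_upwards [hCj, hev, hev.eventually_nhds] with σ hσ hσ' hσe
    obtain ⟨h, hσ⟩ := hσ
    refine ⟨h, ?_⟩
    rw [← chartGerm_jet hι k s σ hσ'.1]
    refine hσ _ ?_
    have ht : Tendsto (fun y => σ + y) (𝓝 0) (𝓝 σ) := by
      have : Continuous fun y => σ + y := by fun_prop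
      simpa using this.tendsto 0
    filter_upwards [ht.eventually hσe] with y hy
    exact ⟨hy.2.1, rfl⟩
  have he : ∀ᶠ σ in 𝓝 (0 : Vec p), prolongCoord hι φ k s σ = C σ := by
    filter_upwards [hj] with σ hσ
    obtain ⟨h, e⟩ := hσ
    rw [prolongCoord, e, Jet.coord_ofCoord]
  filter_upwards [hC, hj, he.eventually_nhds] with σ h1 h2 h3
  refine ⟨h1.congr_of_eventuallyEq h3, ?_⟩
  rw [h3.self_of_nhds]
  exact h2

theorem truncCoord_prolongCoord (hι : IsSmoothImmersion p q ι) (hφ : IsTransverse φ ι s) {j k : ℕ} (hjk : j ≤ k) :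
    ∀ᶠ σ in 𝓝 (0 : Vec p), truncCoord p q hjk (prolongCoord hι φ k s σ) =
      prolongCoord hι φ j s σ := by
  filter_upwards [eventually_prolongCoord hι hφ k] with σ hσ
  obtain ⟨-, h, e⟩ := hσ
  have h1 := congrArg (Jet.proj hjk) e
  rw [Jet.proj_ofCoord] at h1
  have h2 : Jet.proj hjk (prolongSubmanifold k hι (chartPt s σ)) =
    prolongSubmanifold j hι (chartPt s σ) := rfl
  rw [prolongCoord.eq_1 hι φ j, ← h2, h1, Jet.coord_ofCoord]

/-- Derivative of the prolongation of a translate of `S`, along `S`. -/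
theorem eventually_hasFDerivAt_actCoord_prolongCoord (hι : IsSmoothImmersion p q ι)
    (A : LocalAction r p q G M) (hφ : IsTransverse φ ι s) (k : ℕ) :
    ∀ᶠ z in 𝓝 ((0 : Vec r), (0 : Vec p)),
      Function.Bijective
        (fderiv ℝ (fun σ => (A.moved φ (z.1, φ.1 (ι (chartPt s σ)))).1) z.2) ∧
      HasFDerivAt (fun σ => A.actCoord φ k (z.1, prolongCoord hι φ k s σ))
        ((horizontal (A.actCoord φ (k + 1) (z.1, prolongCoord hι φ (k + 1) s z.2))).comp
          (fderiv ℝ (fun σ => (A.moved φ (z.1, φ.1 (ι (chartPt s σ)))).1) z.2)) z.2 := by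
  have hev := eventually_contDiffAt_chart_chartPt hι hφ.1
  have hsnd := continuous_snd.tendsto ((0 : Vec r), (0 : Vec p))
  have hbase : Tendsto (fun z : Vec r × Vec p => (z.1, φ.1 (ι (chartPt s z.2))))
      (𝓝 (0, 0)) (𝓝 (0, φ.1 (ι s))) := by
    have h1 := hev.self_of_nhds.2.2.continuousAt.tendsto
    simp only [chartPt_zero] at h1
    exact (continuous_fst.tendsto _).prodMk_nhds (h1.comp hsnd)
  have hmv := hbase.eventually (A.eventually_moved φ (φ.1.map_source hφ.1))
  set Γ : Vec r × Vec p → Vec p × Vec q := fun z => A.moved φ (z.1, φ.1 (ι (chartPt s z.2))) with hΓ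
  have hΓs : ∀ᶠ z in 𝓝 ((0 : Vec r), (0 : Vec p)), ContDiffAt ℝ ∞ Γ z := by
    filter_upwards [hmv, hsnd.eventually hev] with z h1 h2
    have h3 : ContDiffAt ℝ ∞ (fun z : Vec r × Vec p => φ.1 (ι (chartPt s z.2))) z :=
      ContDiffAt.comp (g := fun σ => φ.1 (ι (chartPt s σ))) z h2.2.2 contDiffAt_snd
    exact ContDiffAt.comp (g := A.moved φ) z h1.2.2.2 (contDiffAt_fst.prodMk h3)
  have hpart : ∀ z : Vec r × Vec p, ContDiffAt ℝ ∞ Γ z →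
      fderiv ℝ (fun σ => (Γ (z.1, σ)).1) z.2 =
        (fderiv ℝ (fun z => (Γ z).1) z).comp (ContinuousLinearMap.inr ℝ (Vec r) (Vec p)) := by
    intro z hz
    have h1 : HasFDerivAt (fun z => (Γ z).1) (fderiv ℝ (fun z => (Γ z).1) z) (z.1, z.2) :=
      ((contDiffAt_fst.comp _ hz).differentiableAt (by simp)).hasFDerivAt
    have h2 : HasFDerivAt (fun y : Vec p => (z.1, y)) (ContinuousLinearMap.inr ℝ (Vec r) (Vec p))
      z.2 := hasFDerivAt_prodMk_right z.1 z.2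
    exact (HasFDerivAt.comp z.2 (g := fun z => (Γ z).1) h1 h2).fderiv
  have hbij : ∀ᶠ z in 𝓝 ((0 : Vec r), (0 : Vec p)),
      Function.Bijective (fderiv ℝ (fun σ => (Γ (z.1, σ)).1) z.2) := by
    have h1 : ContDiffAt ℝ ∞ (fun z => (Γ z).1) ((0 : Vec r), (0 : Vec p)) :=
      contDiffAt_fst.comp _ hΓs.self_of_nhds
    have h2 : ContinuousAt (fun z => (fderiv ℝ (fun z => (Γ z).1) z).comp
        (ContinuousLinearMap.inr ℝ (Vec r) (Vec p))) ((0 : Vec r), (0 : Vec p)) :=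
      (h1.fderiv_right (m := 0) (by simp)).continuousAt.clm_comp continuousAt_const
    have h3 : (fun σ => (Γ ((0 : Vec r), σ)).1) =ᶠ[𝓝 0] fun σ => (φ.1 (ι (chartPt s σ))).1 := by
      filter_upwards [hev] with σ hσ
      rw [hΓ]
      simp only [A.moved_zero φ (φ.1.map_source hσ.2.1)]
    obtain ⟨e, he⟩ := exists_equiv_of_bijective hφ.2
    have h4 : (fderiv ℝ (fun z => (Γ z).1) ((0 : Vec r), (0 : Vec p))).comp
        (ContinuousLinearMap.inr ℝ (Vec r) (Vec p)) = e := by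
      rw [← hpart _ hΓs.self_of_nhds, he]
      exact h3.fderiv_eq
    have h5 := ContinuousLinearEquiv.nhds e
    rw [← h4] at h5
    filter_upwards [h2.eventually h5, hΓs] with z hz hz'
    obtain ⟨e', he'⟩ := hz
    rw [hpart z hz', ← he']
    exact e'.bijective
  have hjets : ∀ k, ∀ᶠ z in 𝓝 ((0 : Vec r), (0 : Vec p)), ∀ f : Germ p q M,
      (∃ hσ, f = A.actGerm (chartPt (1 : G) z.1) (chartGerm hι s z.2 hσ)) →
      ∃ h : A.actCoord φ k (z.1, prolongCoord hι φ k s z.2) ∈ coordDomain k φ,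
        f.jet k = Jet.ofCoord φ ⟨_, h⟩ := by
    intro k
    have hp := eventually_prolongCoord hι hφ k
    have h1 : Tendsto (fun z : Vec r × Vec p => (z.1, prolongCoord hι φ k s z.2))
        (𝓝 (0, 0)) (𝓝 (0, prolongCoord hι φ k s 0)) :=
      (continuous_fst.tendsto _).prodMk_nhds
        (hp.self_of_nhds.1.continuousAt.tendsto.comp hsnd)
    filter_upwards [hsnd.eventually hp,
      h1.eventually (A.eventually_actCoord φ hp.self_of_nhds.2.choose)] with z h2 h3
    rintro f ⟨hσ, rfl⟩
    obtain ⟨-, hd, e⟩ := h2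
    obtain ⟨-, hd', h, e'⟩ := h3
    refine ⟨h, ?_⟩
    rw [← A.prolong_jet, chartGerm_jet, e, e']
  filter_upwards [hbij, hΓs.eventually_nhds, (hjets k).eventually_nhds,
    (hjets (k + 1)).eventually_nhds, hmv.eventually_nhds, (hsnd.eventually hev).eventually_nhds]
    with z h1 h2 h3 h4 h5 h6
  refine ⟨h1, ?_⟩
  have hz : Tendsto (fun σ => (z.1, σ)) (𝓝 z.2) (𝓝 z) := (Continuous.prodMk_right z.1).tendsto z.2
  refine hasFDerivAt_coord_of_curve φ (γ := fun σ => Γ (z.1, σ))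
    (C := fun σ => A.actCoord φ k (z.1, prolongCoord hι φ k s σ))
    (C' := fun σ => A.actCoord φ (k + 1) (z.1, prolongCoord hι φ (k + 1) s σ)) ?_ h1 ?_
  · filter_upwards [hz.eventually h2] with σ hσ
    exact ContDiffAt.comp (g := Γ) σ hσ (contDiffAt_const.prodMk contDiffAt_id)
  · filter_upwards [hz.eventually h3, hz.eventually h4, hz.eventually h6, hz.eventually h5,
      hz.eventually h5.eventually_nhds, hz.eventually h6.eventually_nhds] with σ h7 h8 h9 h10 h11 h12
    obtain ⟨hd, e⟩ := h7 _ ⟨h9.1, rfl⟩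
    obtain ⟨hd', e'⟩ := h8 _ ⟨h9.1, rfl⟩
    refine ⟨_, hd, hd', ?_, e, e'⟩
    have hl : φ.1.symm (φ.1 (ι (chartPt s σ))) = ι (chartPt s σ) := φ.1.left_inv h9.2.1
    have hdom : (chartPt (1 : G) z.1, (chartGerm hι s σ h9.1 : Germ p q M).toFun 0) ∈ A.domain := by
      have h13 := h10.2.1
      rw [hl] at h13
      change (_, ι (chartPt s (σ + 0))) ∈ _
      rwa [add_zero]
    rw [A.actGerm_toFun hdom]
    have ht : Tendsto (fun y => (z.1, σ + y)) (𝓝 0) (𝓝 (z.1, σ)) := by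
      have : Continuous fun y => (z.1, σ + y) := by fun_prop
      simpa using this.tendsto 0
    filter_upwards [ht.eventually h11, ht.eventually h12] with y h13 h14
    have hl : φ.1.symm (φ.1 (ι (chartPt s (σ + y)))) = ι (chartPt s (σ + y)) :=
      φ.1.left_inv h14.2.1
    have h15 := h13.2.2.1
    rw [hl] at h15
    refine ⟨h15, ?_⟩
    simp only [hΓ, LocalAction.moved, hl]
    rfl

end Prolongation

section Calculus

theorem eventually_eq_of_fderiv_eq_zero {V W X : Type*} [NormedAddCommGroup V] [NormedSpace ℝ V]
    [NormedAddCommGroup W] [NormedAddCommGroup X] [NormedSpace ℝ X]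
    {Φ : V × W → X} {a : V} {b : W}
    (h : ∀ᶠ z in 𝓝 (a, b), HasFDerivAt (fun v => Φ (v, z.2)) (0 : V →L[ℝ] X) z.1) :
    ∀ᶠ z in 𝓝 (a, b), Φ z = Φ (a, z.2) := by
  obtain ⟨ε, hε, hb⟩ := Metric.eventually_nhds_iff_ball.1 h
  filter_upwards [Metric.ball_mem_nhds (a, b) hε] with z hz
  rw [← ball_prod_same] at hz hb
  have h1 := (convex_ball a ε).norm_image_sub_le_of_norm_hasFDerivWithin_le
    (f := fun v => Φ (v, z.2)) (f' := fun _ => (0 : V →L[ℝ] X)) (C := 0) (x := a) (y := z.1)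
    (fun v hv => (hb (v, z.2) ⟨hv, hz.2⟩).hasFDerivWithinAt) (fun _ _ => by simp)
    (Metric.mem_ball_self hε) hz.1
  rw [zero_mul, norm_le_zero_iff, sub_eq_zero] at h1
  exact h1

theorem finrank_range_add_finrank_ker' {V W : Type*} [NormedAddCommGroup V] [NormedSpace ℝ V]
    [FiniteDimensional ℝ V] [NormedAddCommGroup W] [NormedSpace ℝ W] (L : V →L[ℝ] W) :
    Module.finrank ℝ (LinearMap.range L.toLinearMap) +
      Module.finrank ℝ (LinearMap.ker L.toLinearMap) = Module.finrank ℝ V :=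
  LinearMap.finrank_range_add_finrank_ker L.toLinearMap

/-- A continuous projection onto a finite-dimensional subspace. -/
theorem exists_projection {Y : Type*} [NormedAddCommGroup Y] [NormedSpace ℝ Y]
    [FiniteDimensional ℝ Y] (R : Submodule ℝ Y) : ∃ π : Y →L[ℝ] R, ∀ x : R, π x = x := by
  obtain ⟨g, hg⟩ := R.subtype.exists_leftInverse_of_injective (R.ker_subtype)
  exact ⟨LinearMap.toContinuousLinearMap g, fun x => LinearMap.congr_fun hg x⟩

/-- A consequence of the constant rank theorem: if `f` has constant rank and the differential of
`g` vanishes where that of `f` does, then `g` is locally a smooth function of `f`. -/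
theorem exists_factor {V Y Z : Type*} [NormedAddCommGroup V] [NormedSpace ℝ V]
    [FiniteDimensional ℝ V] [NormedAddCommGroup Y] [NormedSpace ℝ Y] [FiniteDimensional ℝ Y]
    [NormedAddCommGroup Z] [NormedSpace ℝ Z] {f : V → Y} {g : V → Z} {x₀ : V}
    (hf : ∀ᶠ x in 𝓝 x₀, ContDiffAt ℝ ∞ f x) (hg : ∀ᶠ x in 𝓝 x₀, ContDiffAt ℝ ∞ g x)
    (hr : ∀ᶠ x in 𝓝 x₀, Module.finrank ℝ (LinearMap.range (fderiv ℝ f x).toLinearMap) ≤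
      Module.finrank ℝ (LinearMap.range (fderiv ℝ f x₀).toLinearMap))
    (hk : ∀ᶠ x in 𝓝 x₀, ∀ v, fderiv ℝ f x v = 0 → fderiv ℝ g x v = 0) :
    ∃ Ψ : Y → Z, (∀ᶠ y in 𝓝 (f x₀), ContDiffAt ℝ ∞ Ψ y) ∧ ∀ᶠ x in 𝓝 x₀, g x = Ψ (f x) := by
  set D₀ := fderiv ℝ f x₀ with hD₀
  set R := LinearMap.range D₀.toLinearMap with hR
  set N := LinearMap.ker D₀.toLinearMap with hN
  obtain ⟨πR, hπR⟩ := exists_projection R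
  obtain ⟨πN, hπN⟩ := exists_projection N
  have hdim := finrank_range_add_finrank_ker' D₀
  set Θ : V → R × N := fun x => (πR (f x), πN x) with hΘ
  have hΘd : ∀ x, ContDiffAt ℝ ∞ f x → ∀ v, fderiv ℝ Θ x v = (πR (fderiv ℝ f x v), πN v) := by
    intro x hx v
    have h1 : HasFDerivAt f (fderiv ℝ f x) x := (hx.differentiableAt (by simp)).hasFDerivAt
    have h2 : HasFDerivAt Θ _ x := (πR.hasFDerivAt.comp x h1).prodMk πN.hasFDerivAt
    rw [h2.fderiv]
    rfl
  have hΘs : ∀ᶠ x in 𝓝 x₀, ContDiffAt ℝ ∞ Θ x := by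
    filter_upwards [hf] with x hx
    exact (πR.contDiff.contDiffAt.comp x hx).prodMk πN.contDiff.contDiffAt
  have hinj : Function.Injective (fderiv ℝ Θ x₀) := by
    refine (injective_iff_map_eq_zero _).2 fun v hv => ?_
    rw [hΘd x₀ hf.self_of_nhds] at hv
    obtain ⟨h1, h2⟩ := Prod.ext_iff.1 hv
    have h3 : D₀ v = 0 := by
      have h4 := hπR ⟨D₀ v, v, rfl⟩
      have h5 : (⟨D₀ v, v, rfl⟩ : R) = 0 := h4.symm.trans h1
      exact congrArg Subtype.val h5
    have h4 := hπN ⟨v, h3⟩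
    have h5 : (⟨v, h3⟩ : N) = 0 := h4.symm.trans h2
    exact congrArg Subtype.val h5
  have hbij : Function.Bijective (fderiv ℝ Θ x₀) := by
    refine ⟨hinj, ?_⟩
    exact (LinearMap.injective_iff_surjective_of_finrank_eq_finrank
      (f := (fderiv ℝ Θ x₀).toLinearMap) (by rw [Module.finrank_prod, hdim])).1 hinj
  obtain ⟨P, hP, hmem, hPs⟩ := exists_smooth_localInverse hΘs hbij
  have hPm : ∀ᶠ x in 𝓝 x₀, x ∈ P.source := P.open_source.mem_nhds hmem
  have hinv : ∀ x ∈ P.source, P.symm (Θ x) = x := by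
    intro x hx
    rw [← hP]
    exact P.left_inv hx
  have hker : ∀ᶠ x in 𝓝 x₀, ∀ v, πR (fderiv ℝ f x v) = 0 → fderiv ℝ f x v = 0 := by
    filter_upwards [hf, hPm, hr] with x hx hxP hxr
    set D := fderiv ℝ f x with hD
    have hs : LinearMap.range (πR.comp D).toLinearMap = ⊤ := by
      refine LinearMap.range_eq_top.2 fun y => ?_
      obtain ⟨v, hv⟩ := (hPs x hxP).2.2.2 (y, 0)
      rw [hΘd x hx] at hv
      exact ⟨v, (Prod.ext_iff.1 hv).1⟩
    have h1 := finrank_range_add_finrank_ker' (πR.comp D)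
    have h2 := finrank_range_add_finrank_ker' D
    rw [hs, finrank_top] at h1
    have h3 : LinearMap.ker D.toLinearMap ≤ LinearMap.ker (πR.comp D).toLinearMap := by
      intro v hv
      have hv' : D v = 0 := hv
      change πR (D v) = 0
      rw [hv', map_zero]
    have h4 := Submodule.eq_of_le_of_finrank_le h3 (by omega)
    intro v hv
    have h5 : v ∈ LinearMap.ker (πR.comp D).toLinearMap := hv
    rw [← h4] at h5
    exact h5
  have hΘP : Tendsto P.symm (𝓝 (Θ x₀)) (𝓝 x₀) := by
    have h1 := (hPs x₀ hmem).2.1.continuousAt.tendsto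
    rwa [hinv x₀ hmem] at h1
  have hgP : ∀ᶠ y in 𝓝 (Θ x₀), ContDiffAt ℝ ∞ (fun y => g (P.symm y)) y := by
    have hyt : Θ x₀ ∈ P.target := by
      rw [← hP]
      exact P.map_source hmem
    filter_upwards [hΘP.eventually hg, P.open_target.mem_nhds hyt] with y hy hyt
    have h1 := (hPs (P.symm y) (P.map_target hyt)).2.1
    rw [← hP, P.right_inv hyt] at h1
    exact ContDiffAt.comp y hy h1
  have hsw : Tendsto (fun z : N × R => (z.2, z.1)) (𝓝 (πN x₀, πR (f x₀))) (𝓝 (Θ x₀)) :=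
    continuous_swap.tendsto _
  have hconst : ∀ᶠ z in 𝓝 (πN x₀, πR (f x₀)),
      g (P.symm (z.2, z.1)) = g (P.symm (z.2, πN x₀)) := by
    refine eventually_eq_of_fderiv_eq_zero (Φ := fun z : N × R => g (P.symm (z.2, z.1))) ?_
    have hyt : Θ x₀ ∈ P.target := by
      rw [← hP]
      exact P.map_source hmem
    filter_upwards [hsw.eventually (hΘP.eventually hg), hsw.eventually (hΘP.eventually hf),
      hsw.eventually (hΘP.eventually hk), hsw.eventually (hΘP.eventually hker),
      hsw.eventually (P.open_target.mem_nhds hyt)] with z h1 h2 h3 h4 h5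
    have hx := hPs (P.symm (z.2, z.1)) (P.map_target h5)
    set x := P.symm (z.2, z.1) with hxdef
    have hΘx : Θ x = (z.2, z.1) := by
      rw [← hP]
      exact P.right_inv h5
    have hsym : HasFDerivAt P.symm (fderiv ℝ P.symm (Θ x)) (z.2, z.1) := by
      rw [← hΘx]
      exact (hx.2.1.differentiableAt (by simp)).hasFDerivAt
    have hn : HasFDerivAt (fun n : N => (z.2, n)) (ContinuousLinearMap.inr ℝ R N) z.1 :=
      hasFDerivAt_prodMk_right z.2 z.1
    have h6 : HasFDerivAt (fun n : N => P.symm (z.2, n)) _ z.1 := HasFDerivAt.comp z.1 hsym hn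
    have hgd : HasFDerivAt g (fderiv ℝ g x) (P.symm (z.2, z.1)) :=
      (h1.differentiableAt (by simp)).hasFDerivAt
    have h7 : HasFDerivAt (fun n : N => g (P.symm (z.2, n))) _ z.1 := HasFDerivAt.comp z.1 hgd h6
    refine h7.congr_fderiv (ContinuousLinearMap.ext fun n => ?_)
    refine h3 _ (h4 _ ?_)
    have h8 : HasFDerivAt (fun y => Θ (P.symm y))
        ((fderiv ℝ Θ x).comp (fderiv ℝ P.symm (Θ x))) (z.2, z.1) :=
      HasFDerivAt.comp _ (hx.1.differentiableAt (by simp)).hasFDerivAt hsym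
    have h9 : HasFDerivAt (fun y => Θ (P.symm y)) (ContinuousLinearMap.id ℝ (R × N))
        (z.2, z.1) := by
      refine (hasFDerivAt_id _).congr_of_eventuallyEq ?_
      filter_upwards [P.open_target.mem_nhds h5] with y hy
      rw [← hP]
      exact P.right_inv hy
    have h10 := DFunLike.congr_fun (h8.unique h9) ((0 : R), n)
    rw [ContinuousLinearMap.comp_apply, hΘd x h2] at h10
    exact (Prod.ext_iff.1 h10).1
  refine ⟨fun y => g (P.symm (πR y, πN x₀)), ?_, ?_⟩
  · have h1 : Tendsto (fun y => (πR y, πN x₀)) (𝓝 (f x₀)) (𝓝 (Θ x₀)) :=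
      (by fun_prop : Continuous fun y => (πR y, πN x₀)).tendsto _
    filter_upwards [h1.eventually hgP] with y hy
    exact ContDiffAt.comp (g := fun y => g (P.symm y)) y hy
      (πR.contDiff.contDiffAt.prodMk contDiffAt_const)
  · have h1 : Tendsto (fun x => (πN x, πR (f x))) (𝓝 x₀) (𝓝 (πN x₀, πR (f x₀))) :=
      (πN.continuous.tendsto _).prodMk_nhds
        ((πR.continuous.tendsto _).comp hf.self_of_nhds.continuousAt.tendsto)
    filter_upwards [h1.eventually hconst, hPm] with x hx hxP
    rw [← hx]
    exact congrArg g (hinv x hxP).symm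

/-- The rank of the differential is lower semicontinuous. -/
theorem eventually_le_finrank_range {T V W : Type*} [TopologicalSpace T] [NormedAddCommGroup V]
    [NormedSpace ℝ V] [FiniteDimensional ℝ V] [NormedAddCommGroup W] [NormedSpace ℝ W]
    [FiniteDimensional ℝ W] {L : T → V →L[ℝ] W} {x₀ : T} (hL : ContinuousAt L x₀) :
    ∀ᶠ x in 𝓝 x₀, Module.finrank ℝ (LinearMap.range (L x₀).toLinearMap) ≤
      Module.finrank ℝ (LinearMap.range (L x).toLinearMap) := by
  obtain ⟨C, hC⟩ := (LinearMap.ker (L x₀).toLinearMap).exists_isCompl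
  set R := LinearMap.range (L x₀).toLinearMap with hR
  obtain ⟨π, hπ⟩ := exists_projection R
  set Q : T → C →L[ℝ] R := fun x => (π.comp (L x)).comp C.subtypeL with hQ
  have hinj : Function.Injective (Q x₀) := by
    refine (injective_iff_map_eq_zero _).2 fun v hv => ?_
    have h1 : π (⟨L x₀ v, v, rfl⟩ : R) = 0 := hv
    rw [hπ] at h1
    have h2 : L x₀ v = 0 := congrArg Subtype.val h1
    have h3 : (v : V) ∈ LinearMap.ker (L x₀).toLinearMap ⊓ C := ⟨h2, v.2⟩
    rw [hC.inf_eq_bot] at h3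
    exact Subtype.ext h3
  have hdim : Module.finrank ℝ C = Module.finrank ℝ R := by
    have h1 := finrank_range_add_finrank_ker' (L x₀)
    have h2 := Submodule.finrank_add_eq_of_isCompl hC
    rw [← hR] at h1
    omega
  have hbij : Function.Bijective (Q x₀) :=
    ⟨hinj, (LinearMap.injective_iff_surjective_of_finrank_eq_finrank
      (f := (Q x₀).toLinearMap) hdim).1 hinj⟩
  obtain ⟨e, he⟩ := exists_equiv_of_bijective hbij
  have hQc : ContinuousAt Q x₀ :=
    (continuousAt_const.clm_comp hL).clm_comp continuousAt_const
  have h5 := ContinuousLinearEquiv.nhds e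
  rw [he] at h5
  filter_upwards [hQc.eventually h5] with x hx
  obtain ⟨e', he'⟩ := hx
  rw [← hdim]
  have h6 : Function.Injective ((L x).toLinearMap.comp C.subtype) := by
    intro v w hvw
    refine e'.injective ?_
    have h7 : ∀ v, e' v = π (L x v) := fun v => DFunLike.congr_fun he' v
    rw [h7, h7]
    exact congrArg π hvw
  rw [← LinearMap.finrank_range_of_inj h6]
  exact Submodule.finrank_mono (LinearMap.range_comp_le_range _ _)

end Calculus

theorem tendsto_fst_nhds {X Y : Type*} [TopologicalSpace X] [TopologicalSpace Y] (a : X) (b : Y) :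
    Tendsto Prod.fst (𝓝 (a, b)) (𝓝 a) := continuous_fst.tendsto (a, b)

theorem tendsto_snd_nhds {X Y : Type*} [TopologicalSpace X] [TopologicalSpace Y] (a : X) (b : Y) :
    Tendsto Prod.snd (𝓝 (a, b)) (𝓝 b) := continuous_snd.tendsto (a, b)

section LocalGroup

variable {V E E' X : Type*} [NormedAddCommGroup V] [NormedSpace ℝ V] [FiniteDimensional ℝ V]
  [NormedAddCommGroup E] [NormedSpace ℝ E] [FiniteDimensional ℝ E]
  [NormedAddCommGroup E'] [NormedSpace ℝ E'] [FiniteDimensional ℝ E']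
  [NormedAddCommGroup X] [NormedSpace ℝ X]

/-- A smooth local group law near `0`. -/
structure IsLocalGroupLaw (m : V × V → V) (inv : V → V) : Prop where
  smooth_mul : ∀ᶠ z in 𝓝 (0 : V × V), ContDiffAt ℝ ∞ m z
  smooth_inv : ∀ᶠ v in 𝓝 (0 : V), ContDiffAt ℝ ∞ inv v
  mul_zero_zero : m 0 = 0
  inv_zero : inv 0 = 0
  inv_mul : ∀ᶠ v in 𝓝 (0 : V), m (inv v, v) = 0
  mul_inv : ∀ᶠ v in 𝓝 (0 : V), m (v, inv v) = 0
  mul_inv_cancel : ∀ᶠ z in 𝓝 (0 : V × V), m (m (z.1, inv z.2), z.2) = z.1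

/-- A smooth local action, near `c₀`, of a local group. -/
structure IsLocalGroupAction (m : V × V → V) (α : V × E → E) (c₀ : E) : Prop where
  smooth : ∀ᶠ z in 𝓝 ((0 : V), c₀), ContDiffAt ℝ ∞ α z
  zero : ∀ᶠ c in 𝓝 c₀, α (0, c) = c
  mul : ∀ᶠ z in 𝓝 (((0 : V), (0 : V)), c₀), α (z.1.1, α (z.1.2, z.2)) = α (m z.1, z.2)

/-- The differential at the identity of the orbit map through `c`. -/
def infAction (α : V × E → E) (c : E) : V →L[ℝ] E := fderiv ℝ (fun v => α (v, c)) 0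

variable {m : V × V → V} {inv : V → V} {α : V × E → E} {c₀ : E}

theorem IsLocalGroupLaw.tendsto_inv (hm : IsLocalGroupLaw m inv) :
    Tendsto inv (𝓝 0) (𝓝 0) := by
  have := hm.smooth_inv.self_of_nhds.continuousAt.tendsto
  rwa [hm.inv_zero] at this

theorem IsLocalGroupLaw.tendsto_mul (hm : IsLocalGroupLaw m inv) :
    Tendsto m (𝓝 (0, 0)) (𝓝 0) := by
  have := hm.smooth_mul.self_of_nhds.continuousAt.tendsto
  rwa [hm.mul_zero_zero] at this

theorem IsLocalGroupAction.zero_self (h : IsLocalGroupAction m α c₀) : α (0, c₀) = c₀ :=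
  h.zero.self_of_nhds

theorem IsLocalGroupAction.tendsto (h : IsLocalGroupAction m α c₀) :
    Tendsto α (𝓝 (0, c₀)) (𝓝 c₀) := by
  have := h.smooth.self_of_nhds.continuousAt.tendsto
  rwa [h.zero_self] at this

theorem tendsto_zero_prodMk (c : E) : Tendsto (fun c : E => ((0 : V), c)) (𝓝 c) (𝓝 (0, c)) :=
  (Continuous.prodMk_right (0 : V)).tendsto c

theorem ContDiffAt.comp_prodMk_right {α : V × E → X} {z : V × E} (h : ContDiffAt ℝ ∞ α z) :
    ContDiffAt ℝ ∞ (fun v => α (v, z.2)) z.1 :=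
  ContDiffAt.comp (g := α) (f := fun v => (v, z.2)) z.1 h (contDiffAt_id.prodMk contDiffAt_const)

theorem ContDiffAt.comp_prodMk_left {α : V × E → X} {z : V × E} (h : ContDiffAt ℝ ∞ α z) :
    ContDiffAt ℝ ∞ (fun c => α (z.1, c)) z.2 :=
  ContDiffAt.comp (g := α) (f := fun c => (z.1, c)) z.2 h (contDiffAt_const.prodMk contDiffAt_id)

/-- The derivative of an orbit map factors through the infinitesimal action. -/
theorem IsLocalGroupAction.eventually_hasFDerivAt (h : IsLocalGroupAction m α c₀)
    (hm : IsLocalGroupLaw m inv) :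
    ∀ᶠ z in 𝓝 ((0 : V), c₀), ∃ D : V →L[ℝ] V,
      HasFDerivAt (fun v => α (v, z.2)) ((infAction α (α z)).comp D) z.1 := by
  have hi : Tendsto (fun z : V × E => (z.1, inv z.1)) (𝓝 (0, c₀)) (𝓝 (0, 0)) :=
    (tendsto_fst_nhds _ _).prodMk_nhds (hm.tendsto_inv.comp (tendsto_fst_nhds _ _))
  have h0 : Tendsto (fun z : V × E => ((0 : V), α z)) (𝓝 (0, c₀)) (𝓝 (0, c₀)) :=
    tendsto_const_nhds.prodMk_nhds h.tendsto
  have hmul : ∀ᶠ y in 𝓝 (((0 : V), (0 : V)), c₀),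
      α (m (y.1.1, inv y.1.2), α (y.1.2, y.2)) = α (y.1.1, y.2) := by
    have h1 : Tendsto (fun y : (V × V) × E => (y.1.1, inv y.1.2)) (𝓝 ((0, 0), c₀)) (𝓝 (0, 0)) :=
      ((tendsto_fst_nhds _ _).comp (tendsto_fst_nhds _ _)).prodMk_nhds
        (hm.tendsto_inv.comp ((tendsto_snd_nhds _ _).comp (tendsto_fst_nhds _ _)))
    have h2 : Tendsto (fun y : (V × V) × E => ((m (y.1.1, inv y.1.2), y.1.2), y.2))
        (𝓝 ((0, 0), c₀)) (𝓝 ((0, 0), c₀)) :=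
      ((hm.tendsto_mul.comp h1).prodMk_nhds ((tendsto_snd_nhds _ _).comp (tendsto_fst_nhds _ _))).prodMk_nhds
        (tendsto_snd_nhds _ _)
    filter_upwards [h2.eventually h.mul, (tendsto_fst_nhds ((0 : V), (0 : V)) c₀).eventually
      hm.mul_inv_cancel] with y hy hy'
    rw [hy, hy']
  have hd : Tendsto (fun z : V × E => ((z.1, z.1), z.2)) (𝓝 (0, c₀)) (𝓝 ((0, 0), c₀)) :=
    ((tendsto_fst_nhds _ _).prodMk_nhds (tendsto_fst_nhds _ _)).prodMk_nhds (tendsto_snd_nhds _ _)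
  filter_upwards [hi.eventually hm.smooth_mul, h0.eventually h.smooth,
    hd.eventually hmul.eventually_nhds, (tendsto_fst_nhds (0 : V) c₀).eventually hm.mul_inv] with z h1 h2 h3 h4
  have h5 : ContDiffAt ℝ ∞ (fun v => m (v, inv z.1)) z.1 := ContDiffAt.comp_prodMk_right h1
  have h6 : HasFDerivAt (fun v => α (v, α z)) (infAction α (α z)) (m (z.1, inv z.1)) := by
    rw [h4]
    exact ((ContDiffAt.comp_prodMk_right h2).differentiableAt (by simp)).hasFDerivAt
  refine ⟨_, (HasFDerivAt.comp z.1 h6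
    (h5.differentiableAt (by simp)).hasFDerivAt).congr_of_eventuallyEq ?_⟩
  have h7 : Tendsto (fun v => ((v, z.1), z.2)) (𝓝 z.1) (𝓝 ((z.1, z.1), z.2)) :=
    (by fun_prop : Continuous fun v => ((v, z.1), z.2)).tendsto _
  filter_upwards [h7.eventually h3] with v hv
  exact hv.symm

/-- An infinitesimally invariant function is constant along the orbits. -/
theorem IsLocalGroupAction.eventually_invariant (h : IsLocalGroupAction m α c₀)
    (hm : IsLocalGroupLaw m inv) :
    ∀ᶠ z in 𝓝 ((0 : V), c₀), ∀ F : E → X, (∀ᶠ c in 𝓝 (α z), DifferentiableAt ℝ F c ∧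
      (fderiv ℝ F c).comp (infAction α c) = 0) → ∀ᶠ y in 𝓝 z, F (α y) = F (α (z.1, y.2)) := by
  filter_upwards [(h.eventually_hasFDerivAt hm).eventually_nhds, h.smooth] with z h1 h2 F hF
  refine eventually_eq_of_fderiv_eq_zero (Φ := fun y => F (α y)) (a := z.1) (b := z.2) ?_
  filter_upwards [h1, h2.continuousAt.eventually hF] with y hy hy'
  obtain ⟨D, hD⟩ := hy
  refine (HasFDerivAt.comp (g := F) y.1 hy'.1.hasFDerivAt hD).congr_fderiv ?_
  rw [← ContinuousLinearMap.comp_assoc, hy'.2, ContinuousLinearMap.zero_comp]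

theorem fderiv_comp_infAction_eq_zero {F : E → X} {c : E} (hα : ContDiffAt ℝ ∞ α (0, c))
    (h0 : α (0, c) = c) (hF : DifferentiableAt ℝ F c)
    (h : ∀ᶠ v in 𝓝 (0 : V), F (α (v, c)) = F c) :
    (fderiv ℝ F c).comp (infAction α c) = 0 := by
  have h1 : HasFDerivAt (fun v => α (v, c)) (infAction α c) 0 :=
    ((ContDiffAt.comp_prodMk_right hα).differentiableAt (by simp)).hasFDerivAt
  have h2 : HasFDerivAt F (fderiv ℝ F c) (α (0, c)) := by rw [h0]; exact hF.hasFDerivAt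
  have h3 : HasFDerivAt (fun v => F (α (v, c))) ((fderiv ℝ F c).comp (infAction α c)) 0 :=
    HasFDerivAt.comp (g := F) (0 : V) h2 h1
  exact h3.unique ((hasFDerivAt_const (F c) (0 : V)).congr_of_eventuallyEq h)

/-- A partial moving frame `w` with values in `W`, with cross-section `c₀ + K`. -/
structure IsMovingFrame (inv : V → V) (α : V × E → E) (c₀ : E) (W : Submodule ℝ V)
    (K : Submodule ℝ E) (w : E → V) : Prop where
  apply_self : w c₀ = 0
  smooth : ∀ᶠ c in 𝓝 c₀, ContDiffAt ℝ ∞ w c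
  mem : ∀ᶠ c in 𝓝 c₀, w c ∈ W
  sub_mem : ∀ᶠ c in 𝓝 c₀, α (inv (w c), c) - c₀ ∈ K
  apply_act : ∀ᶠ z in 𝓝 ((0 : V), c₀), z.1 ∈ W → z.2 - c₀ ∈ K → w (α z) = z.1
  injOn : ∀ᶠ z in 𝓝 ((0 : V), c₀), z.1 ∈ W → z.2 - c₀ ∈ K →
    ∀ u ∈ W, fderiv ℝ (fun v => α (v, z.2)) z.1 u = 0 → u = 0

theorem IsLocalGroupAction.exists_isMovingFrame (h : IsLocalGroupAction m α c₀)
    (hm : IsLocalGroupLaw m inv) :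
    ∃ (W : Submodule ℝ V) (K : Submodule ℝ E) (w : E → V), IsMovingFrame inv α c₀ W K w ∧
      Module.finrank ℝ W =
        Module.finrank ℝ (LinearMap.range (infAction α c₀).toLinearMap) := by
  set L := infAction α c₀ with hL
  obtain ⟨W, hW⟩ := (LinearMap.ker L.toLinearMap).exists_isCompl
  obtain ⟨K, hK⟩ := (LinearMap.range L.toLinearMap).exists_isCompl
  have hdim : Module.finrank ℝ W = Module.finrank ℝ (LinearMap.range L.toLinearMap) := by
    have h1 := finrank_range_add_finrank_ker' L
    have h2 := Submodule.finrank_add_eq_of_isCompl hW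
    omega
  set ι : W × K → V × E := fun y => ((y.1 : V), c₀ + y.2) with hι
  have hιs : ContDiff ℝ ∞ ι :=
    (W.subtypeL.contDiff.comp contDiff_fst).prodMk
      (contDiff_const.add (K.subtypeL.contDiff.comp contDiff_snd))
  have hι0 : ι (0, 0) = (0, c₀) := by simp [hι]
  have hιt : Tendsto ι (𝓝 (0, 0)) (𝓝 (0, c₀)) := by
    have := hιs.continuous.tendsto (0, 0)
    rwa [hι0] at this
  set Ξ : W × K → E := fun y => α (ι y) with hΞ
  have hΞs : ∀ᶠ y in 𝓝 (0 : W × K), ContDiffAt ℝ ∞ Ξ y := by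
    filter_upwards [hιt.eventually h.smooth] with y hy
    exact ContDiffAt.comp y hy hιs.contDiffAt
  have hΞ1 : ∀ᶠ y in 𝓝 (0 : W × K), ∀ u : W,
      fderiv ℝ Ξ y (u, 0) = fderiv ℝ (fun v => α (v, (ι y).2)) (ι y).1 u := by
    filter_upwards [hιt.eventually h.smooth, hΞs] with y hy hy' u
    have h1 : HasFDerivAt (fun a : W => Ξ (a, y.2)) _ y.1 :=
      HasFDerivAt.comp (g := Ξ) (f := fun a : W => (a, y.2)) y.1
        (hy'.differentiableAt (by simp)).hasFDerivAt (hasFDerivAt_prodMk_left y.1 y.2)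
    have h2 : HasFDerivAt (fun a : W => Ξ (a, y.2)) _ y.1 :=
      HasFDerivAt.comp (g := fun v => α (v, (ι y).2)) (f := W.subtypeL) y.1
        ((ContDiffAt.comp_prodMk_right hy).differentiableAt (by simp)).hasFDerivAt
        W.subtypeL.hasFDerivAt
    exact DFunLike.congr_fun (h1.unique h2) u
  have hΞ2 : ∀ κ : K, fderiv ℝ Ξ 0 (0, κ) = κ := by
    intro κ
    have h1 : HasFDerivAt (fun a : K => Ξ (0, a)) _ 0 :=
      HasFDerivAt.comp (g := Ξ) (f := fun a : K => ((0 : W), a)) (0 : K)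
        (hΞs.self_of_nhds.differentiableAt (by simp)).hasFDerivAt
        (hasFDerivAt_prodMk_right (0 : W) (0 : K))
    have h2 : HasFDerivAt (fun a : K => Ξ (0, a)) K.subtypeL 0 := by
      have h3 : HasFDerivAt (fun a : K => c₀ + (a : E)) K.subtypeL 0 :=
        K.subtypeL.hasFDerivAt.const_add c₀
      refine h3.congr_of_eventuallyEq ?_
      have h4 : Tendsto (fun a : K => c₀ + (a : E)) (𝓝 0) (𝓝 c₀) := by
        have := h3.continuousAt.tendsto
        simpa using this
      filter_upwards [h4.eventually h.zero] with a ha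
      exact ha
    exact DFunLike.congr_fun (h1.unique h2) κ
  have hΞd : ∀ u κ, fderiv ℝ Ξ 0 (u, κ) = L u + κ := by
    intro u κ
    have h1 : ((u, κ) : W × K) = (u, 0) + (0, κ) := by simp
    rw [h1, map_add, hΞ2, hΞ1.self_of_nhds u]
    congr 1
    rw [show ι (0 : W × K) = (0, c₀) from hι0]
    rfl
  have hinj : Function.Injective (fderiv ℝ Ξ 0) := by
    refine (injective_iff_map_eq_zero _).2 fun y hy => ?_
    obtain ⟨u, κ⟩ := y
    rw [hΞd] at hy
    have h1 : (κ : E) ∈ LinearMap.range L.toLinearMap ⊓ K :=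
      ⟨⟨-u, by
        change L (-u) = κ
        rw [map_neg]
        exact neg_eq_of_add_eq_zero_right hy⟩, κ.2⟩
    rw [hK.inf_eq_bot, Submodule.mem_bot] at h1
    rw [h1, add_zero] at hy
    have h2 : (u : V) ∈ LinearMap.ker L.toLinearMap ⊓ W := ⟨hy, u.2⟩
    rw [hW.inf_eq_bot, Submodule.mem_bot] at h2
    exact Prod.ext (Subtype.ext h2) (Subtype.ext h1)
  have hbij : Function.Bijective (fderiv ℝ Ξ 0) := by
    refine ⟨hinj, (LinearMap.injective_iff_surjective_of_finrank_eq_finrank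
      (f := (fderiv ℝ Ξ 0).toLinearMap) ?_).1 hinj⟩
    rw [Module.finrank_prod, hdim]
    exact Submodule.finrank_add_eq_of_isCompl hK
  obtain ⟨P, hP, hmem, hPs⟩ := exists_smooth_localInverse hΞs hbij
  have hΞ0 : Ξ 0 = c₀ := by
    change α (ι (0, 0)) = c₀
    rw [hι0, h.zero_self]
  have hct : c₀ ∈ P.target := by
    rw [← hΞ0, ← hP]
    exact P.map_source hmem
  have hP0 : P.symm c₀ = 0 := by
    rw [← hΞ0, ← hP]
    exact P.left_inv hmem
  have hPt : Tendsto P.symm (𝓝 c₀) (𝓝 0) := by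
    have := (P.continuousAt_symm hct).tendsto
    rwa [hP0] at this
  have hPi : ∀ᶠ y in 𝓝 (0 : W × K), P.symm (Ξ y) = y := by
    filter_upwards [P.open_source.mem_nhds hmem] with y hy
    rw [← hP]
    exact P.left_inv hy
  have hPr : ∀ᶠ c in 𝓝 c₀, Ξ (P.symm c) = c := by
    filter_upwards [P.open_target.mem_nhds hct] with c hc
    rw [← hP]
    exact P.right_inv hc
  have hlift : ∀ {Q : W × K → Prop}, (∀ᶠ y in 𝓝 (0 : W × K), Q y) →
      ∀ᶠ z in 𝓝 ((0 : V), c₀), ∀ (h1 : z.1 ∈ W) (h2 : z.2 - c₀ ∈ K), Q (⟨z.1, h1⟩, ⟨_, h2⟩) := by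
    intro Q hQ
    obtain ⟨ε, hε, hb⟩ := Metric.eventually_nhds_iff_ball.1 hQ
    have ht : Tendsto (fun z : V × E => (z.1, z.2 - c₀)) (𝓝 (0, c₀)) (𝓝 (0, 0)) := by
      have := (by fun_prop : Continuous fun z : V × E => (z.1, z.2 - c₀)).tendsto (0, c₀)
      simpa using this
    filter_upwards [ht (Metric.ball_mem_nhds _ hε)] with z hz h1 h2
    refine hb _ ?_
    rw [Metric.mem_ball, dist_zero_right]
    have h3 : (z.1, z.2 - c₀) ∈ Metric.ball ((0 : V), (0 : E)) ε := hz
    rw [Metric.mem_ball, ← Prod.zero_eq_mk, dist_zero_right] at h3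
    exact h3
  have hιz : ∀ (z : V × E) (h1 : z.1 ∈ W) (h2 : z.2 - c₀ ∈ K), ι (⟨z.1, h1⟩, ⟨_, h2⟩) = z :=
    fun z h1 h2 => Prod.ext rfl (add_sub_cancel c₀ z.2)
  refine ⟨W, K, fun c => ((P.symm c).1 : V), ⟨?_, ?_, ?_, ?_, ?_, ?_⟩, hdim⟩
  · rw [hP0]; rfl
  · filter_upwards [P.open_target.mem_nhds hct, hPr] with c hc hc'
    have h1 := (hPs _ (P.map_target hc)).2.1
    rw [hc'] at h1
    exact (W.subtypeL.contDiff.comp contDiff_fst).contDiffAt.comp c h1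
  · exact Eventually.of_forall fun c => (P.symm c).1.2
  · have h1 : ∀ᶠ y in 𝓝 (0 : W × K), α (inv y.1, Ξ y) = c₀ + y.2 := by
      have hf : Tendsto (fun y : W × K => (y.1 : V)) (𝓝 0) (𝓝 0) :=
        (tendsto_fst_nhds _ _).comp hιt
      have hs : Tendsto (fun y : W × K => c₀ + (y.2 : E)) (𝓝 0) (𝓝 c₀) :=
        (tendsto_snd_nhds _ _).comp hιt
      have h2 : Tendsto (fun y : W × K => ((inv y.1, (y.1 : V)), c₀ + (y.2 : E))) (𝓝 0)
          (𝓝 ((0, 0), c₀)) :=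
        ((hm.tendsto_inv.comp hf).prodMk_nhds hf).prodMk_nhds hs
      filter_upwards [h2.eventually h.mul, hf.eventually hm.inv_mul, hs.eventually h.zero] with y h3 h4 h5
      have h6 : α (inv y.1, Ξ y) = α (m (inv y.1, y.1), c₀ + y.2) := h3
      have h7 : m (inv y.1, y.1) = 0 := h4
      rw [h6, h7]
      exact h5
    filter_upwards [hPt.eventually h1, hPr] with c h2 h3
    rw [h3] at h2
    rw [h2, add_sub_cancel_left]
    exact (P.symm c).2.2
  · filter_upwards [hlift hPi] with z hz h1 h2
    have h3 := hz h1 h2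
    have h4 : Ξ (⟨z.1, h1⟩, ⟨_, h2⟩) = α z := congrArg α (hιz z h1 h2)
    rw [h4] at h3
    rw [h3]
  · have h1 : ∀ᶠ y in 𝓝 (0 : W × K), Function.Injective (fderiv ℝ Ξ y) := by
      filter_upwards [P.open_source.mem_nhds hmem] with y hy
      exact (hPs y hy).2.2.1
    filter_upwards [hlift (h1.and hΞ1)] with z hz h1 h2 u hu h3
    obtain ⟨h4, h5⟩ := hz h1 h2
    have h6 := h5 ⟨u, hu⟩
    rw [hιz z h1 h2] at h6
    have h7 := h4 (h6.trans (h3.trans (map_zero _).symm))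
    exact congrArg Subtype.val (Prod.ext_iff.1 h7).1

end LocalGroup

section Normalization

variable {V E E' X : Type*} [NormedAddCommGroup V] [NormedSpace ℝ V] [FiniteDimensional ℝ V]
  [NormedAddCommGroup E] [NormedSpace ℝ E] [FiniteDimensional ℝ E]
  [NormedAddCommGroup E'] [NormedSpace ℝ E'] [FiniteDimensional ℝ E']
  [NormedAddCommGroup X] [NormedSpace ℝ X]

/-- A local action on `E'` covering, via `π`, a local action on `E` with moving frame `w`, and
with orbits of dimension at most `dim W`. -/
structure IsFramedAction (m : V × V → V) (inv : V → V) (α : V × E → E) (c₀ : E)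
    (W : Submodule ℝ V) (K : Submodule ℝ E) (w : E → V) (α' : V × E' → E') (π : E' →L[ℝ] E)
    (c₀' : E') : Prop where
  law : IsLocalGroupLaw m inv
  base : IsLocalGroupAction m α c₀
  action : IsLocalGroupAction m α' c₀'
  frame : IsMovingFrame inv α c₀ W K w
  map_base : π c₀' = c₀
  equivariant : ∀ᶠ z in 𝓝 ((0 : V), c₀'), π (α' z) = α (z.1, π z.2)
  finrank_le : ∀ᶠ c in 𝓝 c₀',
    Module.finrank ℝ (LinearMap.range (infAction α' c).toLinearMap) ≤ Module.finrank ℝ W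

/-- The normalization map (invariantization) of a moving frame. -/
def normalize (inv : V → V) (w : E → V) (α' : V × E' → E') (π : E' →L[ℝ] E) (c : E') : E' :=
  α' (inv (w (π c)), c)

variable {m : V × V → V} {inv : V → V} {α : V × E → E} {c₀ : E} {W : Submodule ℝ V}
  {K : Submodule ℝ E} {w : E → V} {α' : V × E' → E'} {π : E' →L[ℝ] E} {c₀' : E'}

namespace IsFramedAction

theorem tendsto_proj (H : IsFramedAction m inv α c₀ W K w α' π c₀') :
    Tendsto π (𝓝 c₀') (𝓝 c₀) := by
  have := π.continuous.tendsto c₀'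
  rwa [H.map_base] at this

theorem tendsto_frame (H : IsFramedAction m inv α c₀ W K w α' π c₀') :
    Tendsto w (𝓝 c₀) (𝓝 0) := by
  have := H.frame.smooth.self_of_nhds.continuousAt.tendsto
  rwa [H.frame.apply_self] at this

theorem tendsto_frame_proj (H : IsFramedAction m inv α c₀ W K w α' π c₀') :
    Tendsto (fun c => w (π c)) (𝓝 c₀') (𝓝 0) := H.tendsto_frame.comp H.tendsto_proj

theorem normalize_self (H : IsFramedAction m inv α c₀ W K w α' π c₀') :
    normalize inv w α' π c₀' = c₀' := by
  rw [normalize, H.map_base, H.frame.apply_self, H.law.inv_zero, H.action.zero_self]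

theorem tendsto_inv_frame (H : IsFramedAction m inv α c₀ W K w α' π c₀') :
    Tendsto (fun c => (inv (w (π c)), c)) (𝓝 c₀') (𝓝 (0, c₀')) :=
  (H.law.tendsto_inv.comp H.tendsto_frame_proj).prodMk_nhds tendsto_id

theorem contDiffAt_normalize (H : IsFramedAction m inv α c₀ W K w α' π c₀') :
    ∀ᶠ c in 𝓝 c₀', ContDiffAt ℝ ∞ (normalize inv w α' π) c := by
  filter_upwards [H.tendsto_proj.eventually H.frame.smooth,
    H.tendsto_frame_proj.eventually H.law.smooth_inv,
    H.tendsto_inv_frame.eventually H.action.smooth] with c h1 h2 h3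
  have h4 : ContDiffAt ℝ ∞ (fun c => inv (w (π c))) c :=
    ContDiffAt.comp (g := inv) (f := fun c => w (π c)) c h2
      (ContDiffAt.comp (g := w) (f := π) c h1 π.contDiff.contDiffAt)
  exact ContDiffAt.comp (g := α') (f := fun c => (inv (w (π c)), c)) c h3
    (h4.prodMk contDiffAt_id)

theorem tendsto_normalize (H : IsFramedAction m inv α c₀ W K w α' π c₀') :
    Tendsto (normalize inv w α' π) (𝓝 c₀') (𝓝 c₀') := by
  have := H.contDiffAt_normalize.self_of_nhds.continuousAt.tendsto
  rwa [H.normalize_self] at this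

theorem proj_normalize_sub_mem (H : IsFramedAction m inv α c₀ W K w α' π c₀') :
    ∀ᶠ c in 𝓝 c₀', π (normalize inv w α' π c) - c₀ ∈ K := by
  filter_upwards [H.tendsto_inv_frame.eventually H.equivariant,
    H.tendsto_proj.eventually H.frame.sub_mem] with c h1 h2
  rw [normalize, h1]
  exact h2

theorem frame_act (H : IsFramedAction m inv α c₀ W K w α' π c₀') :
    ∀ᶠ z in 𝓝 ((0 : V), c₀'), z.1 ∈ W → π z.2 - c₀ ∈ K → w (π (α' z)) = z.1 := by
  have h1 : Tendsto (fun z : V × E' => (z.1, π z.2)) (𝓝 (0, c₀')) (𝓝 (0, c₀)) :=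
    (tendsto_fst_nhds _ _).prodMk_nhds (H.tendsto_proj.comp (tendsto_snd_nhds _ _))
  filter_upwards [h1.eventually H.frame.apply_act, H.equivariant] with z h2 h3 h4 h5
  rw [h3]
  exact h2 h4 h5

theorem normalize_of_mem (H : IsFramedAction m inv α c₀ W K w α' π c₀') :
    ∀ᶠ c in 𝓝 c₀', π c - c₀ ∈ K → normalize inv w α' π c = c := by
  filter_upwards [(tendsto_zero_prodMk c₀').eventually H.frame_act, H.action.zero] with c h1 h2 h3
  have h4 := h1 W.zero_mem h3
  rw [h2] at h4
  change w (π c) = 0 at h4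
  rw [normalize, h4, H.law.inv_zero, h2]

theorem act_normalize (H : IsFramedAction m inv α c₀ W K w α' π c₀') :
    ∀ᶠ c in 𝓝 c₀', α' (w (π c), normalize inv w α' π c) = c := by
  have h1 : Tendsto (fun c => ((w (π c), inv (w (π c))), c)) (𝓝 c₀') (𝓝 ((0, 0), c₀')) :=
    (H.tendsto_frame_proj.prodMk_nhds
      (H.law.tendsto_inv.comp H.tendsto_frame_proj)).prodMk_nhds tendsto_id
  filter_upwards [h1.eventually H.action.mul, H.tendsto_frame_proj.eventually H.law.mul_inv,
    H.action.zero] with c h2 h3 h4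
  rw [normalize]
  refine h2.trans ?_
  rw [h3, h4]

theorem normalize_act_of_mem (H : IsFramedAction m inv α c₀ W K w α' π c₀') :
    ∀ᶠ z in 𝓝 ((0 : V), c₀'), z.1 ∈ W → π z.2 - c₀ ∈ K → normalize inv w α' π (α' z) = z.2 := by
  have h1 : Tendsto (fun z : V × E' => ((inv z.1, z.1), z.2)) (𝓝 (0, c₀')) (𝓝 ((0, 0), c₀')) :=
    ((H.law.tendsto_inv.comp (tendsto_fst_nhds _ _)).prodMk_nhds
      (tendsto_fst_nhds _ _)).prodMk_nhds (tendsto_snd_nhds _ _)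
  filter_upwards [h1.eventually H.action.mul, (tendsto_fst_nhds _ _).eventually H.law.inv_mul,
    (tendsto_snd_nhds _ _).eventually H.action.zero, H.frame_act] with z h2 h3 h4 h5 h6 h7
  rw [normalize, h5 h6 h7]
  refine h2.trans ?_
  rw [h3, h4]

theorem tendsto_frame_normalize (H : IsFramedAction m inv α c₀ W K w α' π c₀') :
    Tendsto (fun c => (w (π c), normalize inv w α' π c)) (𝓝 c₀') (𝓝 (0, c₀')) :=
  H.tendsto_frame_proj.prodMk_nhds H.tendsto_normalize

theorem fderiv_normalize_comp_infAction (H : IsFramedAction m inv α c₀ W K w α' π c₀') :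
    ∀ᶠ c in 𝓝 c₀', (fderiv ℝ (normalize inv w α' π) c).comp (infAction α' c) = 0 := by
  have ht := H.tendsto_frame_normalize
  have hp : Tendsto (fun c => (w (π c), π (normalize inv w α' π c))) (𝓝 c₀') (𝓝 (0, c₀)) :=
    H.tendsto_frame_proj.prodMk_nhds (H.tendsto_proj.comp H.tendsto_normalize)
  filter_upwards [H.finrank_le, H.contDiffAt_normalize, H.act_normalize,
    H.proj_normalize_sub_mem, H.tendsto_proj.eventually H.frame.mem,
    ht.eventually (H.action.eventually_hasFDerivAt H.law),
    ht.eventually H.normalize_act_of_mem.eventually_nhds, hp.eventually H.frame.injOn,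
    ht.eventually H.equivariant.eventually_nhds, hp.eventually H.base.smooth]
    with c hr hs hc hK hW hD hn hi he hb
  obtain ⟨D, hD⟩ := hD
  simp only [hc] at hD
  set κ := normalize inv w α' π c with hκ
  have hmk : Tendsto (fun v : V => (v, κ)) (𝓝 (w (π c))) (𝓝 (w (π c), κ)) :=
    (Continuous.prodMk_left κ).tendsto _
  have hinj : Function.Injective
      (((infAction α' c).comp D).toLinearMap.comp W.subtype) := by
    refine (injective_iff_map_eq_zero _).2 fun u hu => Subtype.ext ?_
    have hu' : (infAction α' c).comp D u = 0 := hu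
    refine hi hW hK u u.2 ?_
    have h1 : HasFDerivAt (fun v => α (v, π κ)) (fderiv ℝ (fun v => α (v, π κ)) (w (π c)))
        (w (π c)) := ((ContDiffAt.comp_prodMk_right hb).differentiableAt (by simp)).hasFDerivAt
    have h2 : HasFDerivAt (fun v => π (α' (v, κ))) (π.comp ((infAction α' c).comp D)) (w (π c)) :=
      π.hasFDerivAt.comp (w (π c)) hD
    have h3 := h2.unique (h1.congr_of_eventuallyEq (hmk.eventually he))
    change fderiv ℝ (fun v => α (v, π κ)) (w (π c)) u = 0
    rw [← h3, ContinuousLinearMap.comp_apply, hu', map_zero]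
  have hle : LinearMap.range (((infAction α' c).comp D).toLinearMap.comp W.subtype) ≤
      LinearMap.range (infAction α' c).toLinearMap := by
    rintro _ ⟨u, rfl⟩
    exact ⟨D u, rfl⟩
  have heq := Submodule.eq_of_le_of_finrank_le hle
    (by rw [LinearMap.finrank_range_of_inj hinj]; exact hr)
  refine ContinuousLinearMap.ext fun v => ?_
  have hv : infAction α' c v ∈ LinearMap.range (infAction α' c).toLinearMap := ⟨v, rfl⟩
  rw [← heq] at hv
  obtain ⟨u, hu⟩ := hv
  have hu' : infAction α' c (D u) = infAction α' c v := hu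
  rw [ContinuousLinearMap.comp_apply, ← hu']
  have h1 : HasFDerivAt (normalize inv w α' π) (fderiv ℝ (normalize inv w α' π) c)
      (α' (w (π c), κ)) := by
    rw [hc]; exact (hs.differentiableAt (by simp)).hasFDerivAt
  have h2 : HasFDerivAt (fun u : W => α' ((u : V), κ)) _ (⟨w (π c), hW⟩ : W) :=
    HasFDerivAt.comp (g := fun v => α' (v, κ)) (f := W.subtypeL) (⟨w (π c), hW⟩ : W) hD
      W.subtypeL.hasFDerivAt
  have h3 : HasFDerivAt (fun u : W => normalize inv w α' π (α' ((u : V), κ))) _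
      (⟨w (π c), hW⟩ : W) := HasFDerivAt.comp (g := normalize inv w α' π) _ h1 h2
  have h4 : (fun u : W => normalize inv w α' π (α' ((u : V), κ))) =ᶠ[𝓝 (⟨w (π c), hW⟩ : W)]
      fun _ => κ := by
    have h5 : Tendsto (fun u : W => (u : V)) (𝓝 (⟨w (π c), hW⟩ : W)) (𝓝 (w (π c))) :=
      continuous_subtype_val.tendsto _
    filter_upwards [h5.eventually (hmk.eventually hn)] with u hu
    exact hu u.2 hK
  exact DFunLike.congr_fun (h3.unique ((hasFDerivAt_const κ _).congr_of_eventuallyEq h4)) u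

theorem normalize_act (H : IsFramedAction m inv α c₀ W K w α' π c₀') :
    ∀ᶠ z in 𝓝 ((0 : V), c₀'), normalize inv w α' π (α' z) = normalize inv w α' π z.2 := by
  have h1 := (H.action.eventually_invariant (X := E') H.law).self_of_nhds (normalize inv w α' π)
  rw [H.action.zero_self] at h1
  filter_upwards [h1 (by
    filter_upwards [H.contDiffAt_normalize, H.fderiv_normalize_comp_infAction] with c h2 h3
    exact ⟨h2.differentiableAt (by simp), h3⟩),
    (tendsto_snd_nhds _ _).eventually H.action.zero] with z h2 h3
  rw [h2]
  exact congrArg _ h3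

/-- Every infinitesimally invariant function is a smooth function of the normalization map. -/
theorem eventually_exists_factor (H : IsFramedAction m inv α c₀ W K w α' π c₀') :
    ∀ᶠ c in 𝓝 c₀', ∀ F : E' → X, (∀ᶠ c' in 𝓝 c, ContDiffAt ℝ ∞ F c' ∧
      (fderiv ℝ F c').comp (infAction α' c') = 0) →
      ∃ Ψ : E' → X, ContDiffAt ℝ ∞ Ψ (normalize inv w α' π c) ∧
        ∀ᶠ c' in 𝓝 c, F c' = Ψ (normalize inv w α' π c') := by
  have ht := H.tendsto_frame_normalize
  filter_upwards [ht.eventually (H.action.eventually_invariant (X := X) H.law),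
    H.act_normalize.eventually_nhds, ht.eventually H.action.smooth,
    H.contDiffAt_normalize, H.tendsto_proj.eventually H.frame.smooth] with c h1 h2 h3 h4 h5 F hF
  have hc := h2.self_of_nhds
  refine ⟨fun e => F (α' (w (π c), e)), ?_, ?_⟩
  · refine ContDiffAt.comp (g := F) (f := fun e => α' (w (π c), e)) _ ?_
      (ContDiffAt.comp_prodMk_left h3)
    rw [hc]
    exact hF.self_of_nhds.1
  · have h6 := h1 F (by
      rw [hc]
      filter_upwards [hF] with c' hc'
      exact ⟨hc'.1.differentiableAt (by simp), hc'.2⟩)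
    have h7 : Tendsto (fun c' => (w (π c'), normalize inv w α' π c')) (𝓝 c)
        (𝓝 (w (π c), normalize inv w α' π c)) :=
      ((ContinuousAt.comp (g := w) (f := π) h5.continuousAt
        π.continuous.continuousAt).tendsto).prodMk_nhds h4.continuousAt.tendsto
    filter_upwards [h7.eventually h6, h2] with c' h8 h9
    rw [h9] at h8
    exact h8

end IsFramedAction

end Normalization

section ChartPointFilter

variable {d : ℕ} {N : Type*} [TopologicalSpace N] [ChartedSpace (Vec d) N]
  [IsManifold 𝓘(ℝ, Vec d) ∞ N]

theorem eventually_nhds_iff_chartPt (x : N) {P : N → Prop} :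
    (∀ᶠ z in 𝓝 x, P z) ↔ ∀ᶠ v in 𝓝 (0 : Vec d), P (chartPt x v) := by
  constructor
  · intro h
    have h1 := (continuousAt_chartPt_zero (d := d) x).tendsto
    rw [chartPt_zero] at h1
    exact h1.eventually h
  · intro h
    have h1 : Tendsto (chartVec x : N → Vec d) (𝓝 x) (𝓝 0) := by
      have h2 : ContinuousAt (chartVec x : N → Vec d) x :=
        ((chartAt (Vec d) x).continuousAt (mem_chart_source _ x)).sub continuousAt_const
      have h3 := h2.tendsto
      rwa [chartVec_self] at h3
    filter_upwards [h1.eventually h, (chartAt (Vec d) x).open_source.mem_nhds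
      (mem_chart_source _ x)] with z hz hz'
    rwa [chartPt_chartVec hz'] at hz

/-- The rank of the differential at a point can be computed in the chart at a nearby point. -/
theorem range_mfderiv_chartPt {V : Type*} [NormedAddCommGroup V]
    [NormedSpace ℝ V] {f : N → V} {x : N} {v : Vec d}
    (hv : chartAt (Vec d) x x + v ∈ (chartAt (Vec d) x).target)
    (hf : DifferentiableAt ℝ (fun v : Vec d => f (chartPt x v)) v) :
    LinearMap.range (mfderiv 𝓘(ℝ, Vec d) 𝓘(ℝ, V) f (chartPt x v)).toLinearMap =
      LinearMap.range (fderiv ℝ (fun v : Vec d => f (chartPt x v)) v).toLinearMap := by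
  have hs : chartPt x v ∈ (chartAt (Vec d) x).source := (chartAt (Vec d) x).map_target hv
  have h1 := (contMDiffAt_chartPt hv).mdifferentiableAt (by simp)
  have h2 := (contMDiffAt_chartVec (d := d) hs).mdifferentiableAt (by simp)
  have hf' : MDifferentiableAt 𝓘(ℝ, Vec d) 𝓘(ℝ, V) (fun v : Vec d => f (chartPt x v)) v :=
    hf.mdifferentiableAt
  have he : f =ᶠ[𝓝 (chartPt x v)] (fun v : Vec d => f (chartPt x v)) ∘ chartVec x := by
    filter_upwards [(chartAt (Vec d) x).open_source.mem_nhds hs] with z hz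
    exact (congrArg f (chartPt_chartVec hz)).symm
  have hf'' : MDifferentiableAt 𝓘(ℝ, Vec d) 𝓘(ℝ, V) (fun v : Vec d => f (chartPt x v))
      (chartVec x (chartPt x v)) := by rwa [chartVec_chartPt hv]
  have h3 := mfderiv_comp (chartPt x v) hf'' h2
  have hfm : MDifferentiableAt 𝓘(ℝ, Vec d) 𝓘(ℝ, V) f (chartPt x v) :=
    (hf''.comp (chartPt x v) h2).congr_of_eventuallyEq he
  have h4 := mfderiv_comp v hfm h1
  refine le_antisymm ?_ ?_
  · rw [he.mfderiv_eq, h3, chartVec_chartPt hv, mfderiv_eq_fderiv]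
    exact LinearMap.range_comp_le_range _ _
  · rw [← mfderiv_eq_fderiv]
    change LinearMap.range (mfderiv 𝓘(ℝ, Vec d) 𝓘(ℝ, V) (f ∘ chartPt x) v).toLinearMap ≤ _
    rw [h4]
    exact LinearMap.range_comp_le_range _ _

end ChartPointFilter

section Invariants

variable {r p q k : ℕ} {G M : Type*} [Group G] [TopologicalSpace G] [ChartedSpace (Vec r) G]
  [LieGroup 𝓘(ℝ, Vec r) ∞ G] [TopologicalSpace M] [ChartedSpace (Vec p × Vec q) M]
  [IsManifold (Mdl p q) ∞ M]

variable (G) in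
theorem isLocalGroupLaw_mulCoord : IsLocalGroupLaw (mulCoord (r := r) G) (invCoord G) := by
  have : IsManifold 𝓘(ℝ, Vec r) ∞ G := LieGroup.toContMDiffMul.toIsManifold
  have hmul := eventually_mulCoord (r := r) G
  have hinv := eventually_invCoord (r := r) G
  have hit : Tendsto (invCoord (r := r) G) (𝓝 0) (𝓝 0) := by
    have := hinv.self_of_nhds.1.continuousAt.tendsto
    rwa [invCoord_zero] at this
  have hmt : Tendsto (mulCoord (r := r) G) (𝓝 0) (𝓝 0) := by
    have := hmul.self_of_nhds.1.continuousAt.tendsto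
    rwa [mulCoord_zero] at this
  have hpt := eventually_mem_chart_target (d := r) (1 : G)
  have h1 : Tendsto (fun v : Vec r => (invCoord G v, v)) (𝓝 0) (𝓝 0) := hit.prodMk_nhds tendsto_id
  have h2 : Tendsto (fun v : Vec r => (v, invCoord G v)) (𝓝 0) (𝓝 0) := tendsto_id.prodMk_nhds hit
  have h3 : Tendsto (fun z : Vec r × Vec r => (z.1, invCoord G z.2)) (𝓝 0) (𝓝 0) :=
    (tendsto_fst_nhds (0 : Vec r) (0 : Vec r)).prodMk_nhds (hit.comp (tendsto_snd_nhds _ _))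
  have h4 : Tendsto (fun z : Vec r × Vec r => (mulCoord G (z.1, invCoord G z.2), z.2)) (𝓝 0)
      (𝓝 0) := (hmt.comp h3).prodMk_nhds (tendsto_snd_nhds (0 : Vec r) (0 : Vec r))
  refine ⟨hmul.mono fun _ h => h.1, hinv.mono fun _ h => h.1, mulCoord_zero G, invCoord_zero G,
    ?_, ?_, ?_⟩
  · filter_upwards [h1.eventually hmul, hinv, (hmt.comp h1).eventually hpt] with v a b c
    refine (chartVec_chartPt c).symm.trans ?_
    simp [a.2, b.2]
  · filter_upwards [h2.eventually hmul, hinv, (hmt.comp h2).eventually hpt] with v a b c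
    refine (chartVec_chartPt c).symm.trans ?_
    simp [a.2, b.2]
  · filter_upwards [h4.eventually hmul, h3.eventually hmul,
      (tendsto_snd_nhds (0 : Vec r) (0 : Vec r)).eventually hinv, (hmt.comp h4).eventually hpt,
      (tendsto_fst_nhds (0 : Vec r) (0 : Vec r)).eventually hpt] with z a b c d e
    refine (chartVec_chartPt d).symm.trans (Eq.trans ?_ (chartVec_chartPt e))
    simp [a.2, b.2, c.2]

variable (A : LocalAction r p q G M) (φ : SmoothChart p q M)

theorem isLocalGroupAction_actCoord {x : JetCoord p q k} (hx : x ∈ coordDomain k φ) :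
    IsLocalGroupAction (mulCoord G) (A.actCoord φ k) x :=
  ⟨(A.eventually_actCoord φ hx).mono fun _ h => h.1,
    (eventually_mem_coordDomain hx).mono fun _ h => A.actCoord_zero φ h,
    A.eventually_actCoord_mul φ hx⟩

theorem orbitDim_ofCoord' (c : coordDomain k φ) :
    orbitDim A (Jet.ofCoord φ c) = Module.finrank ℝ (LinearMap.range
      (infAction (A.actCoord φ k) c.1).toLinearMap) := orbitDim_ofCoord A φ c

theorem isDiffInvariantNear_iff (c : coordDomain k φ) (F : Jet p q M k → ℝ) :
    IsDiffInvariantNear A F (Jet.ofCoord φ c) ↔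
      ∀ᶠ x in 𝓝 c.1, ContDiffAt ℝ ∞ (inCoord φ F) x ∧
        ∀ᶠ v in 𝓝 (0 : Vec r), inCoord φ F (A.actCoord φ k (v, x)) = inCoord φ F x := by
  have : IsManifold 𝓘(ℝ, Vec r) ∞ G := LieGroup.toContMDiffMul.toIsManifold
  refine (eventually_nhds_ofCoord φ c).trans (eventually_congr ?_)
  filter_upwards [eventually_mem_coordDomain c.2] with x hx
  have h1 : (∀ᶠ g in 𝓝 (1 : G),
      F (A.prolong k g (Jet.ofCoord φ ⟨x, hx⟩)) = F (Jet.ofCoord φ ⟨x, hx⟩)) ↔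
      ∀ᶠ v in 𝓝 (0 : Vec r), inCoord φ F (A.actCoord φ k (v, x)) = inCoord φ F x := by
    refine (eventually_nhds_iff_chartPt (d := r) (1 : G)).trans (eventually_congr ?_)
    have h2 : Tendsto (fun v : Vec r => (v, x)) (𝓝 0) (𝓝 (0, x)) :=
      (Continuous.prodMk_left x).tendsto 0
    filter_upwards [h2.eventually (A.eventually_actCoord φ hx)] with v hv
    obtain ⟨-, h3, h4, h5⟩ := hv
    rw [h5, inCoord_of_mem φ F hx, inCoord_of_mem φ F h4]
  constructor
  · intro h
    exact ⟨(smoothAtJet_iff φ ⟨x, hx⟩ F).1 (h hx).1, h1.1 (h hx).2⟩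
  · intro h _
    exact ⟨(smoothAtJet_iff φ ⟨x, hx⟩ F).2 h.1, h1.2 h.2⟩

theorem IsDiffInvariantNear.fderiv_comp_eq_zero {c : coordDomain k φ} {F : Jet p q M k → ℝ}
    (h : IsDiffInvariantNear A F (Jet.ofCoord φ c)) :
    ∀ᶠ x in 𝓝 c.1, ContDiffAt ℝ ∞ (inCoord φ F) x ∧
      (fderiv ℝ (inCoord φ F) x).comp (infAction (A.actCoord φ k) x) = 0 := by
  filter_upwards [(isDiffInvariantNear_iff A φ c F).1 h, eventually_mem_coordDomain c.2]
    with x h1 hx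
  exact ⟨h1.1, fderiv_comp_infAction_eq_zero (A.eventually_actCoord φ hx).self_of_nhds.1
    (A.actCoord_zero φ hx) (h1.1.differentiableAt (by simp)) h1.2⟩

theorem isDiffInvariantNear_coord (c : coordDomain k φ) {f : JetCoord p q k → ℝ}
    (h : ∀ᶠ x in 𝓝 c.1, ContDiffAt ℝ ∞ f x ∧
      ∀ᶠ v in 𝓝 (0 : Vec r), f (A.actCoord φ k (v, x)) = f x) :
    IsDiffInvariantNear A (fun ζ => f (Jet.coord φ ζ)) (Jet.ofCoord φ c) := by
  rw [isDiffInvariantNear_iff]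
  have h0 : ∀ x, x ∈ coordDomain k φ → inCoord φ (fun ζ : Jet p q M k => f (Jet.coord φ ζ)) x = f x := by
    intro x hx
    rw [inCoord_of_mem φ _ hx, Jet.coord_ofCoord]
  filter_upwards [h, (eventually_mem_coordDomain c.2).eventually_nhds] with x h1 h2
  have hx := h2.self_of_nhds
  refine ⟨h1.1.congr_of_eventuallyEq (h2.mono h0), ?_⟩
  have h3 : Tendsto (fun v : Vec r => (v, x)) (𝓝 0) (𝓝 (0, x)) :=
    (Continuous.prodMk_left x).tendsto 0
  filter_upwards [h1.2, h3.eventually (A.eventually_actCoord φ hx)] with v h4 h5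
  obtain ⟨-, h6, h7, h8⟩ := h5
  rw [h0 _ h7, h0 x hx, h4]

/-- The pullback of a differential invariant to a higher jet space is a differential invariant. -/
theorem IsDiffInvariantNear.comp_proj {j : ℕ} (hjk : j ≤ k) {c : coordDomain k φ}
    {F : Jet p q M j → ℝ}
    (h : IsDiffInvariantNear A F (Jet.proj hjk (Jet.ofCoord φ c))) :
    IsDiffInvariantNear A (fun ζ => F (Jet.proj hjk ζ)) (Jet.ofCoord φ c) := by
  rw [Jet.proj_ofCoord, isDiffInvariantNear_iff] at h
  rw [isDiffInvariantNear_iff]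
  have ht : Tendsto (truncCoord p q hjk) (𝓝 c.1) (𝓝 (truncCoord p q hjk c.1)) :=
    (truncCoord p q hjk).continuous.tendsto _
  have h0 : ∀ x, x ∈ coordDomain k φ → inCoord φ (fun ζ => F (Jet.proj hjk ζ)) x =
      inCoord φ F (truncCoord p q hjk x) := by
    intro x hx
    rw [inCoord_of_mem φ _ hx, Jet.proj_ofCoord, inCoord_of_mem φ F ((truncCoord_mem_iff hjk).2 hx)]
  filter_upwards [ht.eventually h, (eventually_mem_coordDomain c.2).eventually_nhds] with x h1 h2
  have hx := h2.self_of_nhds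
  refine ⟨(h1.1.comp x (truncCoord p q hjk).contDiff.contDiffAt).congr_of_eventuallyEq
    (h2.mono h0), ?_⟩
  have h3 : Tendsto (fun v : Vec r => (v, x)) (𝓝 0) (𝓝 (0, x)) :=
    (Continuous.prodMk_left x).tendsto 0
  filter_upwards [h1.2, h3.eventually (A.eventually_actCoord φ hx),
    h3.eventually (A.eventually_truncCoord_actCoord φ hjk hx)] with v h4 h5 h6
  obtain ⟨-, h7, h8, h9⟩ := h5
  rw [h0 _ h8, h0 x hx, h6, h4]

end Invariants

theorem finrank_range_comp_le_right {U V W : Type*} [NormedAddCommGroup U] [NormedSpace ℝ U]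
    [FiniteDimensional ℝ U] [NormedAddCommGroup V] [NormedSpace ℝ V] [NormedAddCommGroup W]
    [NormedSpace ℝ W] (L : V →L[ℝ] W) (L' : U →L[ℝ] V) :
    Module.finrank ℝ (LinearMap.range (L.comp L').toLinearMap) ≤
      Module.finrank ℝ (LinearMap.range L'.toLinearMap) := by
  have h : LinearMap.range (L.comp L').toLinearMap =
      (LinearMap.range L'.toLinearMap).map L.toLinearMap :=
    LinearMap.range_comp L'.toLinearMap L.toLinearMap
  rw [h]
  exact Submodule.finrank_map_le _ _

section InvariantRank

variable {r p q : ℕ} {G M S : Type*} [Group G] [TopologicalSpace G] [ChartedSpace (Vec r) G]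
  [LieGroup 𝓘(ℝ, Vec r) ∞ G] [TopologicalSpace M] [ChartedSpace (Vec p × Vec q) M]
  [IsManifold (Mdl p q) ∞ M] [TopologicalSpace S] [ChartedSpace (Vec p) S]
  [IsManifold 𝓘(ℝ, Vec p) ∞ S] {ι : S → M}

theorem prolongSubmanifold_eq_ofCoord (hι : IsSmoothImmersion p q ι) {φ : SmoothChart p q M}
    {s : S} (hφ : IsTransverse φ ι s) (k : ℕ) :
    ∃ h : prolongCoord hι φ k s 0 ∈ coordDomain k φ,
      prolongSubmanifold k hι s = Jet.ofCoord φ ⟨prolongCoord hι φ k s 0, h⟩ := by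
  have h := (eventually_prolongCoord hι hφ k).self_of_nhds.2
  simpa only [chartPt_zero] using h

theorem tendsto_prolongCoord (hι : IsSmoothImmersion p q ι) {φ : SmoothChart p q M}
    {s : S} (hφ : IsTransverse φ ι s) (k : ℕ) :
    Tendsto (prolongCoord hι φ k s) (𝓝 0) (𝓝 (prolongCoord hι φ k s 0)) :=
  (eventually_prolongCoord hι hφ k).self_of_nhds.1.continuousAt

theorem tendsto_prolongSubmanifold (hι : IsSmoothImmersion p q ι) (k : ℕ) (s : S) :
    Tendsto (fun σ : Vec p => prolongSubmanifold k hι (chartPt s σ)) (𝓝 0)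
      (𝓝 (prolongSubmanifold k hι s)) := by
  obtain ⟨φ, hφ⟩ := exists_isTransverse hι s
  obtain ⟨h, he⟩ := prolongSubmanifold_eq_ofCoord hι hφ k
  rw [he]
  intro U hU
  have h1 := (eventually_nhds_ofCoord φ ⟨_, h⟩ (P := fun ζ => ζ ∈ U)).1 hU
  rw [mem_map]
  filter_upwards [(tendsto_prolongCoord hι hφ k).eventually h1, eventually_prolongCoord hι hφ k]
    with σ h2 h3
  obtain ⟨-, h4, h5⟩ := h3
  change prolongSubmanifold k hι (chartPt s σ) ∈ U
  rw [h5]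
  exact h2 h4

theorem differentiableAt_prolongSubmanifold (hι : IsSmoothImmersion p q ι) {k N : ℕ} {s : S}
    {I : Jet p q M k → Fin N → ℝ}
    (hI : ∀ i, SmoothAtJet (fun ζ => I ζ i) (prolongSubmanifold k hι s)) :
    DifferentiableAt ℝ (fun σ : Vec p => I (prolongSubmanifold k hι (chartPt s σ))) 0 := by
  obtain ⟨φ, hφ⟩ := exists_isTransverse hι s
  obtain ⟨h, he⟩ := prolongSubmanifold_eq_ofCoord hι hφ k
  refine differentiableAt_pi.2 fun i => ?_
  have h1 := hI i
  rw [he, smoothAtJet_iff] at h1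
  have h2 : DifferentiableAt ℝ (fun σ => inCoord φ (fun ζ => I ζ i) (prolongCoord hι φ k s σ)) 0 :=
    (ContDiffAt.comp (g := inCoord φ (fun ζ => I ζ i)) (0 : Vec p) h1
      (eventually_prolongCoord hι hφ k).self_of_nhds.1).differentiableAt (by simp)
  refine h2.congr_of_eventuallyEq ?_
  filter_upwards [eventually_prolongCoord hι hφ k] with σ h3
  obtain ⟨-, h4, h5⟩ := h3
  rw [inCoord_of_mem φ _ h4, h5]

variable (A : LocalAction r p q G M)

theorem IsCompleteNear.smoothAtJet {A : LocalAction r p q G M} {k N : ℕ}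
    {I : Jet p q M k → Fin N → ℝ} {ζ : Jet p q M k} (h : IsCompleteNear A I ζ) (i : Fin N) :
    SmoothAtJet (fun ζ => I ζ i) ζ := (h.1 i).self_of_nhds.1

theorem IsInvariantRank.exists_fderiv {A : LocalAction r p q G M} {hι : IsSmoothImmersion p q ι}
    {k : ℕ} {s : S} {t : ℕ} (h : IsInvariantRank A hι k s t) :
    ∃ (N : ℕ) (I : Jet p q M k → Fin N → ℝ), IsCompleteNear A I (prolongSubmanifold k hι s) ∧
      t = Module.finrank ℝ (LinearMap.range (fderiv ℝ (fun σ : Vec p =>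
        I (prolongSubmanifold k hι (chartPt s σ))) 0).toLinearMap) := by
  obtain ⟨N, I, hI, rfl⟩ := h
  refine ⟨N, I, hI, ?_⟩
  rw [mfderiv_eq_fderiv_chartPt (differentiableAt_prolongSubmanifold hι hI.smoothAtJet)]
  rfl

theorem IsInvariantRank.le_dim {A : LocalAction r p q G M} {hι : IsSmoothImmersion p q ι} {k : ℕ}
    {s : S} {t : ℕ} (h : IsInvariantRank A hι k s t) : t ≤ p := by
  obtain ⟨N, I, -, rfl⟩ := h.exists_fderiv
  refine (LinearMap.finrank_range_le _).trans ?_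
  exact (finrank_euclideanSpace_fin (𝕜 := ℝ) (n := p)).le

/-- The invariant rank does not decrease with the order and does not depend on the choice of the
complete family. -/
theorem IsInvariantRank.le {A : LocalAction r p q G M} {hι : IsSmoothImmersion p q ι} {j k : ℕ}
    (hjk : j ≤ k) {s : S} {t t' : ℕ} (h : IsInvariantRank A hι j s t)
    (h' : IsInvariantRank A hι k s t') : t ≤ t' := by
  obtain ⟨N, I, hI, rfl⟩ := h.exists_fderiv
  obtain ⟨N', I', hI', rfl⟩ := h'.exists_fderiv
  have hd := differentiableAt_prolongSubmanifold hι hI'.smoothAtJet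
  obtain ⟨φ, hφ⟩ := exists_isTransverse hι s
  obtain ⟨hm, he⟩ := prolongSubmanifold_eq_ofCoord hι hφ k
  have h1 : ∀ i, ∃ H : (Fin N' → ℝ) → ℝ, ContDiffAt ℝ ∞ H (I' (prolongSubmanifold k hι s)) ∧
      ∀ᶠ ζ in 𝓝 (prolongSubmanifold k hι s), I (Jet.proj hjk ζ) i = H (I' ζ) := by
    intro i
    refine hI'.2 (fun ζ => I (Jet.proj hjk ζ) i) ?_
    rw [he]
    refine IsDiffInvariantNear.comp_proj A φ hjk (F := fun ζ => I ζ i) ?_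
    rw [← he]
    exact hI.1 i
  choose H hH hHe using h1
  have h2 : (fun σ : Vec p => I (prolongSubmanifold j hι (chartPt s σ))) =ᶠ[𝓝 0]
      fun σ => (fun y i => H i y) (I' (prolongSubmanifold k hι (chartPt s σ))) := by
    filter_upwards [(tendsto_prolongSubmanifold hι k s).eventually (eventually_all.2 hHe)]
      with σ hσ
    exact funext hσ
  have h3 : DifferentiableAt ℝ (fun y i => H i y)
      (I' (prolongSubmanifold k hι (chartPt s (0 : Vec p)))) := by
    rw [chartPt_zero]
    exact differentiableAt_pi.2 fun i => (hH i).differentiableAt (by simp)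
  have h4 := HasFDerivAt.comp (0 : Vec p) h3.hasFDerivAt hd.hasFDerivAt
  rw [h2.fderiv_eq]
  have h5 : fderiv ℝ (fun σ : Vec p => (fun y i => H i y)
    (I' (prolongSubmanifold k hι (chartPt s σ)))) 0 = _ := h4.fderiv
  rw [h5]
  exact finrank_range_comp_le_right _ _

/-- Near a regular jet on `S` the prolonged actions of all higher orders share a moving frame. -/
theorem exists_isFramedAction (hι : IsSmoothImmersion p q ι) {φ : SmoothChart p q M} {s : S}
    (hφ : IsTransverse φ ι s) {n : ℕ} (hs : HasMaxOrbit A (prolongSubmanifold n hι s)) :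
    ∃ (W : Submodule ℝ (Vec r)) (K : Submodule ℝ (JetCoord p q n)) (w : JetCoord p q n → Vec r),
      ∀ (k : ℕ) (hnk : n ≤ k), IsFramedAction (mulCoord G) (invCoord G) (A.actCoord φ n)
        (prolongCoord hι φ n s 0) W K w (A.actCoord φ k) (truncCoord p q hnk)
        (prolongCoord hι φ k s 0) := by
  obtain ⟨hm, he⟩ := prolongSubmanifold_eq_ofCoord hι hφ n
  have hG := isLocalGroupLaw_mulCoord (r := r) G
  have hA := isLocalGroupAction_actCoord A φ hm
  obtain ⟨W, K, w, hw, hW⟩ := hA.exists_isMovingFrame hG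
  refine ⟨W, K, w, fun k hnk => ?_⟩
  obtain ⟨hm', -⟩ := prolongSubmanifold_eq_ofCoord hι hφ k
  refine ⟨hG, hA, isLocalGroupAction_actCoord A φ hm', hw,
    (truncCoord_prolongCoord hι hφ hnk).self_of_nhds,
    A.eventually_truncCoord_actCoord φ hnk hm', ?_⟩
  filter_upwards [eventually_mem_coordDomain hm'] with x hx
  rw [hW, ← orbitDim_ofCoord' A φ ⟨x, hx⟩, ← orbitDim_ofCoord' A φ ⟨_, hm⟩, ← he]
  exact hs _ _

variable {A} {m : Vec r × Vec r → Vec r} {inv : Vec r → Vec r} {n k : ℕ} {φ : SmoothChart p q M}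
  {α : Vec r × JetCoord p q n → JetCoord p q n} {c₀ : JetCoord p q n}
  {W : Submodule ℝ (Vec r)} {K : Submodule ℝ (JetCoord p q n)} {w : JetCoord p q n → Vec r}
  {π : JetCoord p q k →L[ℝ] JetCoord p q n} {c : JetCoord p q k}

/-- The components of the normalization map form a complete family of invariants. -/
theorem IsFramedAction.eventually_isCompleteNear
    (H : IsFramedAction m inv α c₀ W K w (A.actCoord φ k) π c) {N : ℕ}
    (e : JetCoord p q k ≃L[ℝ] (Fin N → ℝ)) :
    ∀ᶠ x in 𝓝 c, ∀ hx : x ∈ coordDomain k φ, IsCompleteNear A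
      (fun ζ => e (normalize inv w (A.actCoord φ k) π (Jet.coord φ ζ)))
      (Jet.ofCoord φ ⟨x, hx⟩) := by
  have h0 : ∀ᶠ x in 𝓝 c, ∀ᶠ v in 𝓝 (0 : Vec r),
      normalize inv w (A.actCoord φ k) π (A.actCoord φ k (v, x)) =
        normalize inv w (A.actCoord φ k) π x := by
    filter_upwards [(tendsto_zero_prodMk c).eventually H.normalize_act.eventually_nhds] with x hx
    exact ((Continuous.prodMk_left x).tendsto (0 : Vec r)).eventually hx
  filter_upwards [(H.contDiffAt_normalize.and h0).eventually_nhds,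
    H.eventually_exists_factor (X := ℝ)] with x h1 h2 hx
  refine ⟨fun i => ?_, fun F hF => ?_⟩
  · refine isDiffInvariantNear_coord A φ ⟨x, hx⟩
      (f := fun y => e (normalize inv w (A.actCoord φ k) π y) i) ?_
    filter_upwards [h1] with y hy
    refine ⟨?_, hy.2.mono fun v hv => by rw [hv]⟩
    exact ((ContinuousLinearMap.proj (R := ℝ) (φ := fun _ : Fin N => ℝ) i).contDiff.comp
      e.contDiff).contDiffAt.comp y hy.1
  · obtain ⟨Ψ, hΨ, hΨe⟩ := h2 (inCoord φ F) (hF.fderiv_comp_eq_zero A φ)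
    refine ⟨fun y => Ψ (e.symm y), ?_, ?_⟩
    · refine ContDiffAt.comp (g := Ψ) (f := e.symm) _ ?_ e.symm.contDiff.contDiffAt
      beta_reduce
      rw [Jet.coord_ofCoord, e.symm_apply_apply]
      exact hΨ
    · rw [eventually_nhds_ofCoord]
      filter_upwards [hΨe] with y hy hym
      rw [Jet.coord_ofCoord, e.symm_apply_apply, ← hy, inCoord_of_mem φ F hym]

theorem IsFramedAction.eventually_isInvariantRank {hι : IsSmoothImmersion p q ι} {s : S}
    (hφ : IsTransverse φ ι s)
    (H : IsFramedAction m inv α c₀ W K w (A.actCoord φ k) π (prolongCoord hι φ k s 0)) :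
    ∀ᶠ σ in 𝓝 (0 : Vec p), IsInvariantRank A hι k (chartPt s σ)
      (Module.finrank ℝ (LinearMap.range (fderiv ℝ (fun σ =>
        normalize inv w (A.actCoord φ k) π (prolongCoord hι φ k s σ)) σ).toLinearMap)) := by
  obtain ⟨N, ⟨e⟩⟩ : ∃ N : ℕ, Nonempty (JetCoord p q k ≃L[ℝ] (Fin N → ℝ)) :=
    ⟨_, ⟨(Module.finBasis ℝ (JetCoord p q k)).equivFunL⟩⟩
  have ht := tendsto_prolongCoord hι hφ k
  filter_upwards [ht.eventually (H.eventually_isCompleteNear e), eventually_prolongCoord hι hφ k,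
    ht.eventually H.contDiffAt_normalize, eventually_mem_chart_target s] with σ h1 h2 h3 h4
  obtain ⟨h5, h6, h7⟩ := h2
  refine ⟨_, fun ζ => e (normalize inv w (A.actCoord φ k) π (Jet.coord φ ζ)), ?_, ?_⟩
  · rw [h7]
    exact h1 h6
  · have h8 : DifferentiableAt ℝ (fun σ => normalize inv w (A.actCoord φ k) π
        (prolongCoord hι φ k s σ)) σ :=
      (ContDiffAt.comp (g := normalize inv w (A.actCoord φ k) π) σ h3 h5).differentiableAt (by simp)
    have h9 : HasFDerivAt (fun σ => e (normalize inv w (A.actCoord φ k) π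
        (prolongCoord hι φ k s σ))) _ σ := e.hasFDerivAt.comp σ h8.hasFDerivAt
    have h10 := congrArg (fun L : Vec p →L[ℝ] (Fin N → ℝ) =>
      Module.finrank ℝ (LinearMap.range L.toLinearMap)) h9.fderiv
    have h11 := finrank_range_comp_le_right (e.symm : (Fin N → ℝ) →L[ℝ] JetCoord p q k)
      ((e : JetCoord p q k →L[ℝ] (Fin N → ℝ)).comp (fderiv ℝ (fun σ =>
        normalize inv w (A.actCoord φ k) π (prolongCoord hι φ k s σ)) σ))
    rw [← ContinuousLinearMap.comp_assoc, e.coe_symm_comp_coe, ContinuousLinearMap.id_comp] at h11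
    have h12 := h11.antisymm (finrank_range_comp_le_right _ _)
    rw [range_mfderiv_chartPt h4 h9.differentiableAt]
    exact h12.trans h10.symm

end InvariantRank

/-- The normalization map is the identity along the fibres of the projection. -/
theorem IsFramedAction.fderiv_normalize_of_proj_eq_zero {V E E' : Type*} [NormedAddCommGroup V]
    [NormedSpace ℝ V] [FiniteDimensional ℝ V] [NormedAddCommGroup E] [NormedSpace ℝ E]
    [FiniteDimensional ℝ E] [NormedAddCommGroup E'] [NormedSpace ℝ E'] [FiniteDimensional ℝ E']
    {m : V × V → V} {inv : V → V} {α : V × E → E} {c₀ : E} {W : Submodule ℝ V}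
    {K : Submodule ℝ E} {w : E → V} {α' : V × E' → E'} {π : E' →L[ℝ] E} {c₀' : E'}
    (H : IsFramedAction m inv α c₀ W K w α' π c₀') :
    ∀ᶠ x in 𝓝 c₀', π x - c₀ ∈ K → ∀ ξ, π ξ = 0 →
      fderiv ℝ (normalize inv w α' π) x ξ = ξ := by
  filter_upwards [H.normalize_of_mem.eventually_nhds, H.contDiffAt_normalize] with x h1 h2 hx ξ hξ
  have h3 : HasDerivAt (fun t : ℝ => normalize inv w α' π (x + t • ξ)) _ 0 :=
    (h2.differentiableAt (by simp)).hasFDerivAt.hasLineDerivAt ξ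
  have h4 : HasDerivAt (fun t : ℝ => x + t • ξ) ξ 0 := by
    simpa using ((hasDerivAt_id (0 : ℝ)).smul_const ξ).const_add x
  refine h3.unique (h4.congr_of_eventuallyEq ?_)
  have h5 : Tendsto (fun t : ℝ => x + t • ξ) (𝓝 0) (𝓝 x) := by
    have := h4.continuousAt.tendsto
    simpa using this
  filter_upwards [h5.eventually h1] with t ht
  exact ht (by rw [map_add, map_smul, hξ, smul_zero, add_zero]; exact hx)

section Coordinates

variable {p q : ℕ}

theorem truncCoord_surjective {j k : ℕ} (hjk : j ≤ k) :
    Function.Surjective (truncCoord p q hjk) := by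
  intro y
  have hi : Function.Injective (MIdx.castLE (p := p) hjk) := fun a b hab =>
    MIdx.exps_injective (congrArg MIdx.exps hab :)
  refine ⟨(y.1, Function.extend (MIdx.castLE hjk) y.2 0), ?_⟩
  rw [truncCoord_apply]
  refine Prod.ext rfl (funext fun J => ?_)
  exact hi.extend_apply _ _ _

theorem contDiff_horizontal {k : ℕ} (z : Vec p) :
    ContDiff ℝ ∞ fun c : JetCoord p q (k + 1) => horizontal c z := by
  simp only [horizontal_apply]
  refine contDiff_const.prodMk (contDiff_pi.2 fun J => ?_)
  simp only [Finset.sum_apply, Pi.smul_apply, shift]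
  fun_prop

theorem horizontal_stdVec {k : ℕ} (c : JetCoord p q (k + 1)) (i : Fin p) (J : MIdx p k) :
    (horizontal c (stdVec p i)).2 J = c.2 (MIdx.add i J) := by
  rw [horizontal_apply]
  change (∑ i', (stdVec p i) i' • shift i' c.2) J = _
  rw [Finset.sum_apply, Finset.sum_eq_single i]
  · simp [shift]
  · intro b _ hb
    simp [hb]
  · simp

end Coordinates

section Stabilization

variable {r p q : ℕ} {G M S : Type*} [Group G] [TopologicalSpace G] [ChartedSpace (Vec r) G]
  [LieGroup 𝓘(ℝ, Vec r) ∞ G] [TopologicalSpace M] [ChartedSpace (Vec p × Vec q) M]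
  [IsManifold (Mdl p q) ∞ M] [TopologicalSpace S] [ChartedSpace (Vec p) S]
  [IsManifold 𝓘(ℝ, Vec p) ∞ S] {ι : S → M} {A : LocalAction r p q G M}
  {hι : IsSmoothImmersion p q ι} {φ : SmoothChart p q M} {s : S} {n : ℕ}
  {W : Submodule ℝ (Vec r)} {K : Submodule ℝ (JetCoord p q n)} {w : JetCoord p q n → Vec r}

/-- The normalized prolongation of the submanifold, whose components are the restrictions of a
complete family of invariants. -/
def normalizedProlong (A : LocalAction r p q G M) (hι : IsSmoothImmersion p q ι)
    (φ : SmoothChart p q M) (s : S) (w : JetCoord p q n → Vec r) {k : ℕ} (hnk : n ≤ k)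
    (σ : Vec p) : JetCoord p q k :=
  normalize (invCoord G) w (A.actCoord φ k) (truncCoord p q hnk) (prolongCoord hι φ k s σ)

theorem eventually_contDiffAt_normalizedProlong {k : ℕ} (hnk : n ≤ k) (hφ : IsTransverse φ ι s)
    (H : IsFramedAction (mulCoord G) (invCoord G) (A.actCoord φ n) (prolongCoord hι φ n s 0) W K w
      (A.actCoord φ k) (truncCoord p q hnk) (prolongCoord hι φ k s 0)) :
    ∀ᶠ σ in 𝓝 (0 : Vec p), ContDiffAt ℝ ∞ (normalizedProlong A hι φ s w hnk) σ := by
  filter_upwards [eventually_prolongCoord hι hφ k,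
    (tendsto_prolongCoord hι hφ k).eventually H.contDiffAt_normalize] with σ h1 h2
  exact ContDiffAt.comp (g := normalize (invCoord G) w (A.actCoord φ k) (truncCoord p q hnk))
    (f := prolongCoord hι φ k s) σ h2 h1.1

theorem truncCoord_normalizedProlong {j k : ℕ} (hnj : n ≤ j) (hjk : j ≤ k)
    (hφ : IsTransverse φ ι s)
    (H : IsFramedAction (mulCoord G) (invCoord G) (A.actCoord φ n) (prolongCoord hι φ n s 0) W K w
      (A.actCoord φ k) (truncCoord p q (hnj.trans hjk)) (prolongCoord hι φ k s 0)) :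
    ∀ᶠ σ in 𝓝 (0 : Vec p), truncCoord p q hjk
      (normalizedProlong A hι φ s w (hnj.trans hjk) σ) = normalizedProlong A hι φ s w hnj σ := by
  obtain ⟨hm, -⟩ := prolongSubmanifold_eq_ofCoord hι hφ k
  filter_upwards [(H.tendsto_inv_frame.comp (tendsto_prolongCoord hι hφ k)).eventually
    (A.eventually_truncCoord_actCoord φ hjk hm), truncCoord_prolongCoord hι hφ hjk] with σ h1 h2
  refine h1.trans ?_
  change A.actCoord φ j (invCoord G (w (truncCoord p q (hnj.trans hjk) (prolongCoord hι φ k s σ))),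
    truncCoord p q hjk (prolongCoord hι φ k s σ)) = _
  rw [← truncCoord_truncCoord hnj hjk, h2]
  rfl

/-- The group parameter normalizing the `n`-jets of the submanifold. -/
def normalizingParam (G : Type*) [Group G] [TopologicalSpace G] [ChartedSpace (Vec r) G]
    (hι : IsSmoothImmersion p q ι) (φ : SmoothChart p q M) (s : S)
    (w : JetCoord p q n → Vec r) (σ : Vec p) : Vec r := invCoord G (w (prolongCoord hι φ n s σ))

theorem normalizedProlong_eq {k : ℕ} (hnk : n ≤ k) (hφ : IsTransverse φ ι s) :
    ∀ᶠ σ in 𝓝 (0 : Vec p), normalizedProlong A hι φ s w hnk σ =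
      A.actCoord φ k (normalizingParam G hι φ s w σ, prolongCoord hι φ k s σ) := by
  filter_upwards [truncCoord_prolongCoord hι hφ hnk] with σ h
  rw [normalizedProlong, normalize, h]
  rfl

/-- The recurrence formula: differentiating a relation `f_{k+1} = Φ ∘ f_k` between normalized
prolongations along the submanifold. -/
theorem eventually_recurrence (hφ : IsTransverse φ ι s)
    (H : ∀ (k : ℕ) (hnk : n ≤ k), IsFramedAction (mulCoord G) (invCoord G) (A.actCoord φ n)
        (prolongCoord hι φ n s 0) W K w (A.actCoord φ k) (truncCoord p q hnk)
        (prolongCoord hι φ k s 0)) {k : ℕ} (hnk : n ≤ k)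
    {Φ : JetCoord p q k → JetCoord p q (k + 1)}
    (hΦ : ∀ᶠ c in 𝓝 (normalizedProlong A hι φ s w hnk 0), ContDiffAt ℝ ∞ Φ c)
    (hf : ∀ᶠ σ in 𝓝 (0 : Vec p), normalizedProlong A hι φ s w (hnk.trans (Nat.le_succ k)) σ =
      Φ (normalizedProlong A hι φ s w hnk σ)) :
    ∀ᶠ σ in 𝓝 (0 : Vec p), ∀ z,
      fderiv ℝ (normalize (invCoord G) w (A.actCoord φ (k + 1))
          (truncCoord p q (hnk.trans (Nat.le_succ k))))
        (normalizedProlong A hι φ s w (hnk.trans (Nat.le_succ k)) σ)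
        (horizontal (normalizedProlong A hι φ s w (hnk.trans (Nat.le_add_right k 2)) σ) z) =
      fderiv ℝ Φ (normalizedProlong A hι φ s w hnk σ)
        (fderiv ℝ (normalize (invCoord G) w (A.actCoord φ k) (truncCoord p q hnk))
          (normalizedProlong A hι φ s w hnk σ)
          (horizontal (normalizedProlong A hι φ s w (hnk.trans (Nat.le_succ k)) σ) z)) := by
  have hk1 := hnk.trans (Nat.le_succ k)
  have hk2 := hnk.trans (Nat.le_add_right k 2)
  have hv : Tendsto (normalizingParam G hι φ s w) (𝓝 0) (𝓝 0) :=
    (H n le_rfl).law.tendsto_inv.comp ((H n le_rfl).tendsto_frame.comp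
      (tendsto_prolongCoord hι hφ n))
  have hvs : Tendsto (fun σ => (normalizingParam G hι φ s w σ, σ)) (𝓝 0) (𝓝 (0, 0)) :=
    hv.prodMk_nhds tendsto_id
  have hJ : ∀ j, Tendsto (fun z : Vec r × Vec p => (z.1, prolongCoord hι φ j s z.2)) (𝓝 (0, 0))
      (𝓝 (0, prolongCoord hι φ j s 0)) := fun j =>
    (tendsto_fst_nhds _ _).prodMk_nhds ((tendsto_prolongCoord hι hφ j).comp (tendsto_snd_nhds _ _))
  have hinv : ∀ j (hnj : n ≤ j), ∀ᶠ z in 𝓝 ((0 : Vec r), (0 : Vec p)),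
      normalize (invCoord G) w (A.actCoord φ j) (truncCoord p q hnj)
        (A.actCoord φ j (z.1, prolongCoord hι φ j s z.2)) =
      normalizedProlong A hι φ s w hnj z.2 := fun j hnj =>
    (hJ j).eventually (H j hnj).normalize_act
  have hft : ∀ j (hnj : n ≤ j), Tendsto (normalizedProlong A hι φ s w hnj) (𝓝 0)
      (𝓝 (prolongCoord hι φ j s 0)) := fun j hnj =>
    (H j hnj).tendsto_normalize.comp (tendsto_prolongCoord hι hφ j)
  have hf0 : normalizedProlong A hι φ s w hnk 0 = prolongCoord hι φ k s 0 :=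
    (H k hnk).normalize_self
  rw [hf0] at hΦ
  have hκ := fun j hnj => (hft j hnj).eventually (H j hnj).contDiffAt_normalize
  filter_upwards [normalizedProlong_eq (A := A) (w := w) hnk hφ,
    normalizedProlong_eq (A := A) (w := w) hk1 hφ, normalizedProlong_eq (A := A) (w := w) hk2 hφ,
    hvs.eventually (hinv k hnk).eventually_nhds, hvs.eventually (hinv (k + 1) hk1).eventually_nhds,
    hf.eventually_nhds, hκ k hnk, hκ (k + 1) hk1, (hft k hnk).eventually hΦ,
    hvs.eventually (eventually_hasFDerivAt_actCoord_prolongCoord hι A hφ k),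
    hvs.eventually (eventually_hasFDerivAt_actCoord_prolongCoord hι A hφ (k + 1))]
    with σ e0 e1 e2 i0 i1 hfσ hκ0 hκ1 hΦσ hB0 hB1 z
  set v := normalizingParam G hι φ s w σ with hvdef
  simp only at hB0 hB1
  rw [← e1] at hB0
  rw [← e2] at hB1
  set B := fderiv ℝ (fun σ => (A.moved φ (v, φ.1 (ι (chartPt s σ)))).1) σ with hB
  have hmk : Tendsto (fun y : Vec p => (v, y)) (𝓝 σ) (𝓝 (v, σ)) :=
    (Continuous.prodMk_right v).tendsto σ
  have d0 : HasFDerivAt (normalize (invCoord G) w (A.actCoord φ k) (truncCoord p q hnk))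
      (fderiv ℝ (normalize (invCoord G) w (A.actCoord φ k) (truncCoord p q hnk))
        (normalizedProlong A hι φ s w hnk σ))
      (A.actCoord φ k (v, prolongCoord hι φ k s σ)) := by
    rw [← e0]
    exact (hκ0.differentiableAt (by simp)).hasFDerivAt
  have d1 : HasFDerivAt (normalize (invCoord G) w (A.actCoord φ (k + 1)) (truncCoord p q hk1))
      (fderiv ℝ (normalize (invCoord G) w (A.actCoord φ (k + 1)) (truncCoord p q hk1))
        (normalizedProlong A hι φ s w hk1 σ))
      (A.actCoord φ (k + 1) (v, prolongCoord hι φ (k + 1) s σ)) := by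
    rw [← e1]
    exact (hκ1.differentiableAt (by simp)).hasFDerivAt
  have c0 : HasFDerivAt (normalizedProlong A hι φ s w hnk) _ σ :=
    (HasFDerivAt.comp (f := fun y => A.actCoord φ k (v, prolongCoord hι φ k s y)) σ d0
      hB0.2).congr_of_eventuallyEq ((hmk.eventually i0).mono fun y hy => hy.symm)
  have c1 : HasFDerivAt (normalizedProlong A hι φ s w hk1) _ σ :=
    (HasFDerivAt.comp (f := fun y => A.actCoord φ (k + 1) (v, prolongCoord hι φ (k + 1) s y)) σ d1
      hB1.2).congr_of_eventuallyEq ((hmk.eventually i1).mono fun y hy => hy.symm)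
  have c2 : HasFDerivAt (fun y => Φ (normalizedProlong A hι φ s w hnk y)) _ σ :=
    HasFDerivAt.comp (g := Φ) σ (hΦσ.differentiableAt (by simp)).hasFDerivAt c0
  obtain ⟨y, rfl⟩ := hB0.1.2 z
  exact DFunLike.congr_fun (c1.unique (c2.congr_of_eventuallyEq hfσ)) y

end Stabilization

section Stabilization

variable {r p q : ℕ} {G M S : Type*} [Group G] [TopologicalSpace G] [ChartedSpace (Vec r) G]
  [LieGroup 𝓘(ℝ, Vec r) ∞ G] [TopologicalSpace M] [ChartedSpace (Vec p × Vec q) M]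
  [IsManifold (Mdl p q) ∞ M] [TopologicalSpace S] [ChartedSpace (Vec p) S]
  [IsManifold 𝓘(ℝ, Vec p) ∞ S] {ι : S → M} {A : LocalAction r p q G M}
  {hι : IsSmoothImmersion p q ι} {φ : SmoothChart p q M} {s : S} {n : ℕ}
  {W : Submodule ℝ (Vec r)} {K : Submodule ℝ (JetCoord p q n)} {w : JetCoord p q n → Vec r}

/-- If `f_{k+1}` is a function of `f_k`, then so is `f_{k+2}`. -/
theorem exists_factor_succ (hφ : IsTransverse φ ι s)
    (H : ∀ (k : ℕ) (hnk : n ≤ k), IsFramedAction (mulCoord G) (invCoord G) (A.actCoord φ n)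
        (prolongCoord hι φ n s 0) W K w (A.actCoord φ k) (truncCoord p q hnk)
        (prolongCoord hι φ k s 0)) {k : ℕ} (hnk : n ≤ k)
    {Φ : JetCoord p q k → JetCoord p q (k + 1)}
    (hΦ : ∀ᶠ c in 𝓝 (normalizedProlong A hι φ s w hnk 0), ContDiffAt ℝ ∞ Φ c)
    (hf : ∀ᶠ σ in 𝓝 (0 : Vec p), normalizedProlong A hι φ s w (hnk.trans (Nat.le_succ k)) σ =
      Φ (normalizedProlong A hι φ s w hnk σ)) :
    ∃ Ψ : JetCoord p q k → JetCoord p q (k + 2),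
      (∀ᶠ c in 𝓝 (normalizedProlong A hι φ s w hnk 0), ContDiffAt ℝ ∞ Ψ c) ∧
      ∀ᶠ σ in 𝓝 (0 : Vec p), normalizedProlong A hι φ s w (hnk.trans (Nat.le_add_right k 2)) σ =
        Ψ (normalizedProlong A hι φ s w hnk σ) := by
  have hk1 := hnk.trans (Nat.le_succ k)
  have hk2 := hnk.trans (Nat.le_add_right k 2)
  have hrec := eventually_recurrence hφ H hnk hΦ hf
  set c₀ := prolongCoord hι φ k s 0 with hc₀
  set f₀ := normalizedProlong A hι φ s w hnk with hf₀
  set f₁ := normalizedProlong A hι φ s w hk1 with hf₁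
  set f₂ := normalizedProlong A hι φ s w hk2 with hf₂
  set κ₀ := normalize (invCoord G) w (A.actCoord φ k) (truncCoord p q hnk) with hκ₀
  set κ₁ := normalize (invCoord G) w (A.actCoord φ (k + 1)) (truncCoord p q hk1) with hκ₁
  have hf00 : f₀ 0 = c₀ := (H k hnk).normalize_self
  have hf10 : f₁ 0 = prolongCoord hι φ (k + 1) s 0 := (H (k + 1) hk1).normalize_self
  have hΦ0 : Φ c₀ = prolongCoord hι φ (k + 1) s 0 := by
    rw [← hf10, hf.self_of_nhds, hf00]
  rw [hf00] at hΦ ⊢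
  obtain ⟨E, hE⟩ := (truncCoord p q (Nat.le_succ k)).toLinearMap.exists_rightInverse_of_surjective
    (LinearMap.range_eq_top.2 (truncCoord_surjective (Nat.le_succ k)))
  have hE' : ∀ y, truncCoord p q (Nat.le_succ k) (E y) = y := fun y => LinearMap.congr_fun hE y
  have hEs : ContDiff ℝ ∞ E := (LinearMap.toContinuousLinearMap E).contDiff
  have hΦt : Tendsto Φ (𝓝 c₀) (𝓝 (prolongCoord hι φ (k + 1) s 0)) := by
    rw [← hΦ0]
    exact hΦ.self_of_nhds.continuousAt
  have hft : Tendsto f₁ (𝓝 0) (𝓝 (prolongCoord hι φ (k + 1) s 0)) :=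
    (H (k + 1) hk1).tendsto_normalize.comp (tendsto_prolongCoord hι hφ (k + 1))
  set R : Vec p → JetCoord p q k → JetCoord p q (k + 1) := fun z c =>
    E (horizontal (Φ c) z) + fderiv ℝ Φ c (fderiv ℝ κ₀ c (horizontal (Φ c) z)) -
      fderiv ℝ κ₁ (Φ c) (E (horizontal (Φ c) z)) with hR
  have hRs : ∀ z, ∀ᶠ c in 𝓝 c₀, ContDiffAt ℝ ∞ (R z) c := by
    intro z
    filter_upwards [hΦ, (H k hnk).contDiffAt_normalize,
      hΦt.eventually (H (k + 1) hk1).contDiffAt_normalize] with c h1 h2 h3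
    have h4 : ContDiffAt ℝ ∞ (fun c => horizontal (Φ c) z) c :=
      ContDiffAt.comp (g := fun c => horizontal c z) c (contDiff_horizontal z).contDiffAt h1
    have h5 : ContDiffAt ℝ ∞ (fun c => E (horizontal (Φ c) z)) c :=
      ContDiffAt.comp (g := E) c hEs.contDiffAt h4
    have h6 : ContDiffAt ℝ ∞ (fderiv ℝ κ₁) (Φ c) := h3.fderiv_right (by simp)
    have h7 : ContDiffAt ℝ ∞ (fun c => fderiv ℝ κ₁ (Φ c)) c :=
      ContDiffAt.comp (g := fderiv ℝ κ₁) c h6 h1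
    exact (h5.add ((h1.fderiv_right (by simp)).clm_apply
      ((h2.fderiv_right (by simp)).clm_apply h4))).sub (h7.clm_apply h5)
  have hRe : ∀ᶠ σ in 𝓝 (0 : Vec p), ∀ z, horizontal (f₂ σ) z = R z (f₀ σ) := by
    filter_upwards [hrec, hf, hft.eventually (H (k + 1) hk1).fderiv_normalize_of_proj_eq_zero,
      (tendsto_prolongCoord hι hφ (k + 1)).eventually (H (k + 1) hk1).proj_normalize_sub_mem,
      truncCoord_normalizedProlong hk1 (Nat.le_succ (k + 1)) hφ (H (k + 2) hk2)]
      with σ h1 h2 h3 h4 h5 z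
    have h6 : truncCoord p q (Nat.le_succ k) (horizontal (f₂ σ) z) = horizontal (f₁ σ) z := by
      rw [truncCoord_horizontal]
      exact congrArg (fun c => horizontal c z) h5
    have h7 := h3 h4 (horizontal (f₂ σ) z - E (horizontal (f₁ σ) z)) (by
      rw [← truncCoord_truncCoord hnk (Nat.le_succ k), map_sub, h6, hE', sub_self, map_zero])
    rw [map_sub, h1 z] at h7
    simp only [hR]
    rw [← h2]
    rw [eq_comm, sub_eq_iff_eq_add] at h7
    rw [h7]
    abel
  have hψ : ∀ J : MIdx p (k + 2), ∃ ψ : JetCoord p q k → Vec q,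
      (∀ᶠ c in 𝓝 c₀, ContDiffAt ℝ ∞ ψ c) ∧ ∀ᶠ σ in 𝓝 (0 : Vec p), (f₂ σ).2 J = ψ (f₀ σ) := by
    intro J
    rcases J.eq_zero_or_add with rfl | ⟨i, J', rfl⟩
    · refine ⟨fun c => (Φ c).2 MIdx.zero, ?_, ?_⟩
      · filter_upwards [hΦ] with c hc
        exact contDiffAt_pi.1 hc.snd MIdx.zero
      · filter_upwards [hf, truncCoord_normalizedProlong hk1 (Nat.le_succ (k + 1)) hφ
          (H (k + 2) hk2)] with σ h1 h2
        rw [← h1]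
        exact congrArg (fun c : JetCoord p q (k + 1) => c.2 MIdx.zero) h2
    · refine ⟨fun c => (R (stdVec p i) c).2 J', ?_, ?_⟩
      · filter_upwards [hRs (stdVec p i)] with c hc
        exact contDiffAt_pi.1 hc.snd J'
      · filter_upwards [hRe] with σ h1
        rw [← h1, horizontal_stdVec]
  choose ψ hψs hψe using hψ
  refine ⟨fun c => ((Φ c).1, fun J => ψ J c), ?_, ?_⟩
  · filter_upwards [hΦ, eventually_all.2 hψs] with c h1 h2
    exact h1.fst.prodMk (contDiffAt_pi.2 h2)
  · filter_upwards [hf, eventually_all.2 hψe, truncCoord_normalizedProlong hk1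
      (Nat.le_succ (k + 1)) hφ (H (k + 2) hk2)] with σ h1 h2 h3
    refine Prod.ext ?_ (funext h2)
    rw [← h1]
    exact congrArg (fun c : JetCoord p q (k + 1) => c.1) h3

/-- The rank of the invariants of order at most `k` at a nearby point of the submanifold. -/
def normalizedRank (A : LocalAction r p q G M) (hι : IsSmoothImmersion p q ι)
    (φ : SmoothChart p q M) (s : S) (w : JetCoord p q n → Vec r) {k : ℕ} (hnk : n ≤ k)
    (σ : Vec p) : ℕ :=
  Module.finrank ℝ (LinearMap.range (fderiv ℝ (normalizedProlong A hι φ s w hnk) σ).toLinearMap)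

theorem eventually_normalizedRank_le (hφ : IsTransverse φ ι s)
    (H : ∀ (k : ℕ) (hnk : n ≤ k), IsFramedAction (mulCoord G) (invCoord G) (A.actCoord φ n)
        (prolongCoord hι φ n s 0) W K w (A.actCoord φ k) (truncCoord p q hnk)
        (prolongCoord hι φ k s 0)) {k : ℕ} (hnk : n ≤ k)
    (h0 : ∀ᶠ σ in 𝓝 (0 : Vec p),
      normalizedRank A hι φ s w hnk σ ≤ normalizedRank A hι φ s w hnk 0)
    (h1 : ∀ᶠ σ in 𝓝 (0 : Vec p), normalizedRank A hι φ s w (hnk.trans (Nat.le_succ k)) σ ≤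
      normalizedRank A hι φ s w hnk σ) :
    ∀ᶠ σ in 𝓝 (0 : Vec p), normalizedRank A hι φ s w (hnk.trans (Nat.le_add_right k 2)) σ ≤
      normalizedRank A hι φ s w hnk σ := by
  have hk1 := hnk.trans (Nat.le_succ k)
  have hs0 := eventually_contDiffAt_normalizedProlong hnk hφ (H k hnk)
  have hs1 := eventually_contDiffAt_normalizedProlong hk1 hφ (H (k + 1) hk1)
  have hker : ∀ᶠ σ in 𝓝 (0 : Vec p), ∀ v,
      fderiv ℝ (normalizedProlong A hι φ s w hnk) σ v = 0 →
        fderiv ℝ (normalizedProlong A hι φ s w hk1) σ v = 0 := by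
    filter_upwards [h1, hs1, (truncCoord_normalizedProlong hnk (Nat.le_succ k) hφ
      (H (k + 1) hk1)).eventually_nhds] with σ h2 h3 h4
    have h5 : HasFDerivAt (normalizedProlong A hι φ s w hnk) _ σ :=
      ((truncCoord p q (Nat.le_succ k)).hasFDerivAt.comp σ
        (h3.differentiableAt (by simp)).hasFDerivAt).congr_of_eventuallyEq
        (h4.mono fun y hy => hy.symm)
    set D₀ := fderiv ℝ (normalizedProlong A hι φ s w hnk) σ with hD₀
    set D₁ := fderiv ℝ (normalizedProlong A hι φ s w hk1) σ with hD₁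
    have h6 : LinearMap.ker D₁.toLinearMap ≤ LinearMap.ker D₀.toLinearMap := by
      intro v hv
      have hv' : D₁ v = 0 := hv
      change D₀ v = 0
      rw [hD₀, h5.fderiv, ContinuousLinearMap.comp_apply, hv', map_zero]
    have h7 := finrank_range_add_finrank_ker' D₀
    have h8 := finrank_range_add_finrank_ker' D₁
    have h9 : Module.finrank ℝ (LinearMap.range D₁.toLinearMap) ≤
      Module.finrank ℝ (LinearMap.range D₀.toLinearMap) := h2
    have h10 := Submodule.eq_of_le_of_finrank_le h6 (by omega)
    intro v hv
    have h11 : v ∈ LinearMap.ker D₀.toLinearMap := hv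
    rw [← h10] at h11
    exact h11
  obtain ⟨Φ, hΦ, hf⟩ := exists_factor hs0 hs1 h0 hker
  obtain ⟨Ψ, hΨ, hg⟩ := exists_factor_succ hφ H hnk hΦ hf
  filter_upwards [hs0, hg.eventually_nhds, hs0.self_of_nhds.continuousAt.eventually hΨ]
    with σ h2 h3 h4
  have h5 : HasFDerivAt (normalizedProlong A hι φ s w (hnk.trans (Nat.le_add_right k 2))) _ σ :=
    (HasFDerivAt.comp (g := Ψ) σ (h4.differentiableAt (by simp)).hasFDerivAt
      (h2.differentiableAt (by simp)).hasFDerivAt).congr_of_eventuallyEq h3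
  rw [normalizedRank, h5.fderiv]
  exact finrank_range_comp_le_right _ _

theorem eventually_normalizedRank_ge (hφ : IsTransverse φ ι s) {k : ℕ} (hnk : n ≤ k)
    (H : IsFramedAction (mulCoord G) (invCoord G) (A.actCoord φ n) (prolongCoord hι φ n s 0) W K w
      (A.actCoord φ k) (truncCoord p q hnk) (prolongCoord hι φ k s 0)) :
    ∀ᶠ σ in 𝓝 (0 : Vec p),
      normalizedRank A hι φ s w hnk 0 ≤ normalizedRank A hι φ s w hnk σ := by
  have h := (eventually_contDiffAt_normalizedProlong hnk hφ H).self_of_nhds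
  exact eventually_le_finrank_range (h.fderiv_right (m := ∞) (by simp)).continuousAt

/-- The rank of the invariant map, as a function on the submanifold: existence, and its behaviour
near a point. -/
theorem exists_local_rank (A : LocalAction r p q G M) (hι : IsSmoothImmersion p q ι) {s : S}
    (hs : HasMaxOrbit A (prolongSubmanifold n hι s)) :
    ∃ τ : ℕ → S → ℕ, ∀ k, n ≤ k →
      (∀ᶠ s' in 𝓝 s, IsInvariantRank A hι k s' (τ k s')) ∧ (∀ᶠ s' in 𝓝 s, τ k s ≤ τ k s') ∧
      ((∀ᶠ s' in 𝓝 s, τ k s' ≤ τ k s) → (∀ᶠ s' in 𝓝 s, τ (k + 1) s' ≤ τ k s') →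
        ∀ᶠ s' in 𝓝 s, τ (k + 2) s' ≤ τ k s') := by
  obtain ⟨φ, hφ⟩ := exists_isTransverse hι s
  obtain ⟨W, K, w, H⟩ := exists_isFramedAction A hι hφ hs
  classical
  have hc : ∀ᶠ σ in 𝓝 (0 : Vec p), chartVec s (chartPt s σ) = σ :=
    (eventually_mem_chart_target s).mono fun σ h => chartVec_chartPt h
  have hc0 : (chartVec s s : Vec p) = 0 := chartVec_self s
  refine ⟨fun k s' => if h : n ≤ k then normalizedRank A hι φ s w h (chartVec s s') else 0,
    fun k hnk => ?_⟩
  have hk1 := hnk.trans (Nat.le_succ k)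
  have hk2 := hnk.trans (Nat.le_add_right k 2)
  simp only [eventually_nhds_iff_chartPt (d := p) s, dif_pos hnk, dif_pos hk1, dif_pos hk2, hc0]
  refine ⟨?_, ?_, fun h1 h2 => ?_⟩
  · filter_upwards [(H k hnk).eventually_isInvariantRank hφ, hc] with σ h1 h2
    rw [h2]
    exact h1
  · filter_upwards [eventually_normalizedRank_ge hφ hnk (H k hnk), hc] with σ h1 h2
    rwa [h2]
  · have h3 := eventually_normalizedRank_le hφ H hnk
      (by filter_upwards [h1, hc] with σ a b; rwa [b] at a)
      (by filter_upwards [h2, hc] with σ a b; rwa [b] at a)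
    filter_upwards [h3, hc] with σ a b
    rwa [b]

end Stabilization

/-- A nondecreasing bounded sequence which becomes constant as soon as two consecutive terms
agree. -/
theorem exists_isLeast_stable {ρ : ℕ → ℕ} {p n l : ℕ} (hl : n ≤ l)
    (hmono : ∀ k, n ≤ k → ρ k ≤ ρ (k + 1)) (hp : ∀ k, n ≤ k → ρ k ≤ p)
    (hstab : ∀ k, n ≤ k → ρ k = ρ (k + 1) → ρ (k + 2) = ρ (k + 1)) :
    (∀ s, n ≤ s → ρ s = ρ (s + 1) → ∀ k, s ≤ k → ρ k = ρ s) ∧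
      ∃ s, IsLeast {k : ℕ | l ≤ k ∧ ρ k = ρ (k + 1)} s ∧ (l ≤ n + p → s ≤ n + p) := by
  have hconst : ∀ s, n ≤ s → ρ s = ρ (s + 1) → ∀ k, s ≤ k → ρ k = ρ s ∧ ρ (k + 1) = ρ s := by
    intro s hs h k hk
    induction k, hk using Nat.le_induction with
    | base => exact ⟨rfl, h.symm⟩
    | succ k hk ih => exact ⟨ih.2, (hstab k (hs.trans hk) (ih.1.trans ih.2.symm)).trans ih.2⟩
  have hgrow : ∀ j i, (∀ k, j ≤ k → k < j + i → ρ k < ρ (k + 1)) → i ≤ ρ (j + i) := by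
    intro j i
    induction i with
    | zero => exact fun _ => Nat.zero_le _
    | succ i ih =>
      intro h
      have h1 := ih fun k h1 h2 => h k h1 (by omega)
      have h2 := h (j + i) (by omega) (by omega)
      change i + 1 ≤ ρ (j + i + 1)
      omega
  refine ⟨fun s hs h k hk => (hconst s hs h k hk).1, ?_⟩
  have hne : ∃ k, l ≤ k ∧ ρ k = ρ (k + 1) := by
    by_contra! hcon
    have h1 := hgrow l (p + 1) fun k hk _ => lt_of_le_of_ne (hmono k (hl.trans hk)) (hcon k hk)
    have h2 := hp (l + (p + 1)) (by omega)
    omega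
  classical
  refine ⟨Nat.find hne, ⟨Nat.find_spec hne, fun k hk => Nat.find_min' hne hk⟩, fun hlp => ?_⟩
  set s := Nat.find hne with hs
  by_cases hsl : s ≤ l
  · exact hsl.trans hlp
  have hns : n ≤ s := hl.trans (Nat.find_spec hne).1
  have h1 := hgrow n (s - n) fun k hk hks => by
    refine lt_of_le_of_ne (hmono k hk) fun h => ?_
    rcases le_or_gt l k with h2 | h2
    · have := Nat.find_min' hne ⟨h2, h⟩
      omega
    · have h3 := hconst k hk h l h2.le
      exact hsl (Nat.find_min' hne ⟨le_rfl, h3.1.trans h3.2.symm⟩)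
  have h2 := hp (n + (s - n)) (by omega)
  omega

theorem exists_max_of_bounded {S : Type*} [Nonempty S] {f : S → ℕ} {N : ℕ} (h : ∀ s, f s ≤ N) :
    ∃ s₀, ∀ s, f s ≤ f s₀ := by
  have hb : BddAbove (Set.range f) := ⟨N, by rintro _ ⟨s, rfl⟩; exact h s⟩
  obtain ⟨s₀, hs₀⟩ := Nat.sSup_mem (Set.range_nonempty f) hb
  exact ⟨s₀, fun s => hs₀ ▸ le_csSup hb ⟨s, rfl⟩⟩

section InvariantOrder

variable {r p q : ℕ} {G M S : Type*} [Group G] [TopologicalSpace G] [ChartedSpace (Vec r) G]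
  [LieGroup 𝓘(ℝ, Vec r) ∞ G] [TopologicalSpace M] [ChartedSpace (Vec p × Vec q) M]
  [IsManifold (Mdl p q) ∞ M] [TopologicalSpace S] [ChartedSpace (Vec p) S]
  [IsManifold 𝓘(ℝ, Vec p) ∞ S] {ι : S → M} {n : ℕ}

/-- The rank function of the invariants on a submanifold with regular `n`-jets. -/
theorem exists_rank (A : LocalAction r p q G M) (hι : IsSmoothImmersion p q ι)
    (hs : ∀ s, HasMaxOrbit A (prolongSubmanifold n hι s)) :
    ∃ R : ℕ → S → ℕ, ∀ k, n ≤ k → ∀ s,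
      (∀ t, IsInvariantRank A hι k s t ↔ t = R k s) ∧ (∀ᶠ s' in 𝓝 s, R k s ≤ R k s') ∧
      ((∀ᶠ s' in 𝓝 s, R k s' ≤ R k s) → (∀ᶠ s' in 𝓝 s, R (k + 1) s' ≤ R k s') →
        ∀ᶠ s' in 𝓝 s, R (k + 2) s' ≤ R k s') := by
  have hex : ∀ k s, ∃ t, n ≤ k → IsInvariantRank A hι k s t := by
    intro k s
    obtain ⟨τ, hτ⟩ := exists_local_rank A hι (hs s)
    exact ⟨τ k s, fun hk => (hτ k hk).1.self_of_nhds⟩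
  choose R hR using hex
  have huniq : ∀ k, n ≤ k → ∀ s t, IsInvariantRank A hι k s t → t = R k s := fun k hk s t ht =>
    le_antisymm (ht.le le_rfl (hR k s hk)) ((hR k s hk).le le_rfl ht)
  refine ⟨R, fun k hk s => ?_⟩
  obtain ⟨τ, hτ⟩ := exists_local_rank A hι (hs s)
  have heq : ∀ j, n ≤ j → ∀ᶠ s' in 𝓝 s, τ j s' = R j s' := fun j hj =>
    (hτ j hj).1.mono fun s' h => huniq j hj s' _ h
  obtain ⟨-, h1, h2⟩ := hτ k hk
  have e0 := heq k hk
  have e1 := heq (k + 1) (by omega)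
  have e2 := heq (k + 2) (by omega)
  have e := e0.self_of_nhds
  refine ⟨fun t => ⟨huniq k hk s t, fun h => h ▸ hR k s hk⟩, ?_, fun h3 h4 => ?_⟩
  · filter_upwards [h1, e0] with s' a b
    omega
  · have h5 := h2 (by filter_upwards [h3, e0] with s' a b; omega)
      (by filter_upwards [h4, e0, e1] with s' a b c; omega)
    filter_upwards [h5, e0, e2] with s' a b c
    omega

end InvariantOrder

end JetGeom

end

open JetGeom in
theorem mainTheorem11 {r p q : ℕ} (hq : 1 ≤ q)
    {G : Type*} [Group G] [TopologicalSpace G] [ChartedSpace (Vec r) G] [LieGroup 𝓘(ℝ, Vec r) ∞ G]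
    {M : Type*} [TopologicalSpace M] [ChartedSpace (Vec p × Vec q) M] [IsManifold (Mdl p q) ∞ M]
    (A : LocalAction r p q G M) (n : ℕ) (hn : IsStabilizationOrder A n)
    {S : Type*} [TopologicalSpace S] [ChartedSpace (Vec p) S] [IsManifold 𝓘(ℝ, Vec p) ∞ S]
    {ι : S → M} (hι : IsSmoothImmersion p q ι) (l : ℕ) (hl : n ≤ l)
    (hS : IsRegularSubmanifold A hι n l) :
    ∃ t : ℕ → ℕ,
      (∀ k, l ≤ k → ∀ (s : S) (τ : ℕ), IsInvariantRank A hι k s τ ↔ τ = t k) ∧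
      (∀ k, l ≤ k → t k ≤ t (k + 1) ∧ t k ≤ p) ∧
      (∀ s, l ≤ s → t s = t (s + 1) → ∀ k, s ≤ k → t k = t s) ∧
      ∃ s, IsLeast {k : ℕ | l ≤ k ∧ t k = t (k + 1)} s ∧ (l ≤ n + p → s ≤ n + p) := by
  rcases isEmpty_or_nonempty S with hS' | hS'
  · exact ⟨fun _ => 0, fun _ _ s => isEmptyElim s, fun _ _ => ⟨le_rfl, Nat.zero_le _⟩,
      fun _ _ _ _ _ => rfl, l, ⟨⟨le_rfl, rfl⟩, fun _ hk => hk.1⟩, id⟩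
  obtain ⟨R, hR⟩ := exists_rank A hι hS.1
  have hrank : ∀ k, n ≤ k → ∀ s, IsInvariantRank A hι k s (R k s) := fun k hk s =>
    ((hR k hk s).1 _).2 rfl
  have hp : ∀ s k, n ≤ k → R k s ≤ p := fun s k hk => (hrank k hk s).le_dim
  have hmono : ∀ s k, n ≤ k → R k s ≤ R (k + 1) s := fun s k hk =>
    (hrank k hk s).le (Nat.le_succ k) (hrank (k + 1) (hk.trans (Nat.le_succ k)) s)
  have hconst : ∀ k, l ≤ k → ∀ s s', R k s = R k s' := fun k hk s s' =>
    hS.2 k hk s s' _ _ (hrank k (hl.trans hk) s) (hrank k (hl.trans hk) s')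
  obtain ⟨s₀, hs₀⟩ := exists_max_of_bounded (f := fun s => ∑ k ∈ Finset.Icc n l, R k s)
    (N := ∑ _k ∈ Finset.Icc n l, p)
    fun s => Finset.sum_le_sum fun k hk => hp s k (Finset.mem_Icc.1 hk).1
  have hloc : ∀ k, n ≤ k → ∀ᶠ s in 𝓝 s₀, R k s = R k s₀ := by
    intro k hk
    rcases le_or_gt l k with h | h
    · exact Filter.Eventually.of_forall fun s => hconst k h s s₀
    have h1 : ∀ᶠ s in 𝓝 s₀, ∀ j ∈ Finset.Icc n l, R j s₀ ≤ R j s :=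
      (Filter.eventually_all_finset _).2 fun j hj => (hR j (Finset.mem_Icc.1 hj).1 s₀).2.1
    filter_upwards [h1] with s hs
    have h2 := (Finset.sum_eq_sum_iff_of_le hs).1
      (le_antisymm (Finset.sum_le_sum hs) (hs₀ s))
    exact (h2 k (Finset.mem_Icc.2 ⟨hk, h.le⟩)).symm
  have hstab : ∀ k, n ≤ k → R k s₀ = R (k + 1) s₀ → R (k + 2) s₀ = R (k + 1) s₀ := by
    intro k hk h
    have h1 := (hR k hk s₀).2.2 ((hloc k hk).mono fun s hs => hs.le) (by
      filter_upwards [hloc k hk, hloc (k + 1) (hk.trans (Nat.le_succ k))] with s a b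
      omega)
    have h2 := h1.self_of_nhds
    have h3 := hmono s₀ (k + 1) (hk.trans (Nat.le_succ k))
    exact le_antisymm (h2.trans h.le) h3
  obtain ⟨h1, h2⟩ := exists_isLeast_stable hl (hmono s₀) (hp s₀) hstab
  refine ⟨fun k => R k s₀, fun k hk s τ => ?_, fun k hk => ⟨hmono s₀ k (hl.trans hk),
    hp s₀ k (hl.trans hk)⟩, fun s hs => h1 s (hl.trans hs), h2⟩
  rw [(hR k (hl.trans hk) s).1 τ, hconst k hk s s₀]
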